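/- \textbf{Setting.} Let $\mathbf O(2)$ act on $\mathbb R^2\cong\mathbb C$, $z=x+iy$, in the standard way. Let $\kappa_x(x,y)=(x,-y)$ and $\kappa_y(x,y)=(-x,y)$, let $\rho_\theta$ be the rotation of angle $\theta$, let $\mathbf Z_n=\langle\rho_{2\pi/n}\rangle$, $\mathbf D_n(\kappa)=\langle\rho_{2\pi/n},\kappa\rangle$ for a reflection $\kappa$, $\mathbf D_n=\mathbf D_n(\kappa_x)$, $\mathbf Z_2\times\mathbf Z_2=\langle\kappa_x,\kappa_y\rangle$, $\mathbf Z_2(\gamma)=\langle\gamma\rangle$ for $\gamma$ of order two, and $\mathbf 1$ the trivial group. For a subgroup $\Gamma\le\mathbf O(2)$ and a homomorphism $\eta:\Gamma\to\{\pm1\}$, $\mathcal P(\Gamma)$ is the ring of $\Gamma$-invariant real polynomials in $x,y$, and $\overrightarrow{\mathcal P}^{\eta}(\Gamma)$ is the $\mathcal P(\Gamma)$-module of polynomial maps $B=\begin{pmatrix}c&b\\b&a\end{pmatrix}:\mathbb R^2\to \mathrm{Sym}_2$ with $B(\gamma u)=\eta(\gamma)\,\gamma B(u)\gamma^t$ for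 all $\gamma\in\Gamma$, $u\in\mathbb R^2$. A form $\omega=a\,dy^2+2b\,dx\,dy+c\,dx^2$ with smooth coefficients on $\mathbb R^2$ is $\Gamma_\eta$-equivariant if $\omega(\gamma u,\gamma v)=\eta(\gamma)\omega(u,v)$ for all $\gamma \in \Gamma$, $u,v\in\mathbb R^2$. Put $\delta=b^2-ac$ and $\Omega=\{\delta>0\}$. On $\Omega$ the equation $\omega=0$ defines two transverse foliations $\mathscr F_\varepsilon$, $\varepsilon=\pm1$; the tangent line of $\mathscr F_\varepsilon$ is spanned by $(a,-b+\varepsilon\sqrt\delta)$ and $(-b-\varepsilon\sqrt\delta,c)$, which are parallel and not both zero. Let $\lambda(\gamma)=1$ if $\gamma\in\Gamma$ preserves each of the two foliations, and $\lambda(\gamma)=-1$ if it interchanges them. \textbf{Statement.} (A) In each row $\Gamma[K]$ below there is a homomorphism $\eta:\Gamma\to\{\pm1\}$ with $\ker\eta=K$ (a row written $\Gamma$ means $K=\Gamma$). For such $\eta$, $\overrightarrow{\mathcal P}^{\eta}(\Gamma)$ consists exactly of the $B$ with the listed $a,b,c$, where the $p_i$ range over $\mathcal P(\Gamma)$. Moreover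 there are smooth $\Gamma_\eta$-equivariant forms $\omega$ with $\Omega\ne\emptyset$, and for every such $\omega$ the map $\lambda$ is well defined on $\Gamma$ and $\ker\lambda$ is the listed group. Notation: $R_k=\mathrm{Re}(z^k)$, $I_k=\mathrm{Im}(z^k)$. 1. $\mathbf{SO}(2)$; $\ker\lambda=\mathbf{SO}(2)$: $a=p_1+(y^2-x^2)p_2+2xyp_3$, $b=2xyp_2+(x^2-y^2)p_3$, $c=p_1+(x^2-y^2)p_2-2xyp_3$. 2. $\mathbf O(2)$; $\ker\lambda=\mathbf{SO}(2)$: $a=p_1+(y^2-x^2)p_2$, $b=2xyp_2$, $c=p_1+(x^2-y^2)p_2$. 3. $\mathbf O(2)[\mathbf{SO}(2)]$; $\ker\lambda=\mathbf O(2)$: $a=2xyp$, $b=(x^2-y^2)p$, $c=-2xyp$. 4. $\mathbf Z_n$, $n\ge3$; $\ker\lambda=\mathbf Z_n$: $a=p_1+(y^2-x^2)p_2+2xyp_3-R_{n-2}p_4-I_{n-2}p_5$, $b=2xyp_2+(x^2-y^2)p_3+R_{n-2}p_5-I_{n-2}p_4$, $c=p_1+(x^2-y^2)p_2-2xyp_3+R_{n-2}p_4+I_{n-2}p_5$.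 5. $\mathbf Z_{2m}[\mathbf Z_m]$, $m\ge2$; $\ker\lambda=\mathbf Z_m$: $a=-R_{m-2}p_1-I_{m-2}p_2+R_mp_3-R_{m+2}p_4+I_{m+2}p_5+I_mp_6$, $b=-I_{m-2}p_1+R_{m-2}p_2+I_{m+2}p_4+R_{m+2}p_5$, $c=R_{m-2}p_1+I_{m-2}p_2+R_mp_3+R_{m+2}p_4-I_{m+2}p_5+I_mp_6$. 6. $\mathbf D_n$, $n\ge3$; $\ker\lambda=\mathbf Z_n$: $a=p_1+(y^2-x^2)p_2-R_{n-2}p_3$, $b=2xyp_2-I_{n-2}p_3$, $c=p_1+(x^2-y^2)p_2+R_{n-2}p_3$. 7. $\mathbf D_n[\mathbf Z_n]$, $n\ge3$; $\ker\lambda=\mathbf D_n$: $a=2xyp_1-I_{n-2}p_2+I_np_3$, $b=(x^2-y^2)p_1+R_{n-2}p_2$, $c=-2xyp_1+I_{n-2}p_2+I_np_3$. 8. $\mathbf D_{2m}[\mathbf D_m(\kappa_x)]$, $m\ge2$; $\ker\lambda=\mathbf D_m(\rho_{\pi/m}\kappa_x)$, which equals $\mathbf D_m(\kappa_y)$ when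 $m$ is odd: $a=-R_{m-2}p_1+R_mp_2-R_{m+2}p_3$, $b=-I_{m-2}p_1+I_{m+2}p_3$, $c=R_{m-2}p_1+R_mp_2+R_{m+2}p_3$. 9. $\mathbf Z_2(\kappa_x)$; $\ker\lambda=\mathbf 1$: $a=p_1$, $b=yp_2$, $c=p_3$. 10. $\mathbf Z_2(\kappa_x)[\mathbf 1]$; $\ker\lambda=\mathbf Z_2(\kappa_x)$: $a=yp_1$, $b=p_2$, $c=yp_3$. 11. $\mathbf Z_2\times\mathbf Z_2$; $\ker\lambda=\mathbf Z_2(-I)$: $a=p_1$, $b=xyp_2$, $c=p_3$. 12. $\mathbf Z_2\times\mathbf Z_2[\mathbf Z_2(-I)]$; $\ker\lambda=\mathbf Z_2\times\mathbf Z_2$: $a=xyp_1$, $b=p_2$, $c=xyp_3$. 13. $\mathbf Z_2\times\mathbf Z_2[\mathbf Z_2(\kappa_x)]$; $\ker\lambda=\mathbf Z_2(\kappa_y)$: $a=xp_1$, $b=yp_2$, $c=xp_3$. 14. $\mathbf 1$; $\ker\lambda=\mathbf 1$: $a=p_1$, $b=p_2$, $c=p_3$. 15. $\mathbf Z_2(-I)$;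 $\ker\lambda=\mathbf Z_2(-I)$: $a=p_1$, $b=p_2$, $c=p_3$. 16. $\mathbf Z_2(-I)[\mathbf 1]$; $\ker\lambda=\mathbf 1$: $a=xp_1+yp_2$, $b=xp_3+yp_4$, $c=xp_5+yp_6$. (B) The list is complete up to conjugacy: for every closed subgroup $\Gamma\le\mathbf O(2)$ and every homomorphism $\eta:\Gamma\to\{\pm1\}$ there are $g\in\mathbf O(2)$ and a row $\Gamma_0[K_0]$ with $\ker\lambda=L_0$ such that $\Gamma=g\Gamma_0g^{-1}$, $\ker\eta=gK_0g^{-1}$, there are smooth $\Gamma_\eta$-equivariant forms $\omega$ with $\Omega\neq\emptyset$ and $\ker\lambda=gL_0g^{-1}$ for each of them, and $\overrightarrow{\mathcal P}^{\eta}(\Gamma)$ consists exactly of the polynomial maps $M$ with $M(gu)=g\,N(u)\,g^t$ for all $u\in\mathbb R^2$, for some $N$ of the general form in that row. -/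

import Mathlib

open scoped Matrix

noncomputable section

namespace EquivariantBDE

/-- The plane, with coordinates `x = u 0` and `y = u 1`. -/
abbrev Plane : Type := Fin 2 → ℝ

/-- The orthogonal group `O(2)`, acting on the plane by `γ.1 *ᵥ u`. -/
abbrev O2 : Type := Matrix.orthogonalGroup (Fin 2) ℝ

/-- The rotation of angle `θ`. -/
def rot (θ : ℝ) : O2 :=
  ⟨!![Real.cos θ, -Real.sin θ; Real.sin θ, Real.cos θ], by
    rw [Matrix.mem_orthogonalGroup_iff]
    have h := Real.sin_sq_add_cos_sq θ
    ext i j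
    fin_cases i <;> fin_cases j <;> simp [Matrix.mul_apply, Matrix.star_apply] <;> nlinarith⟩

/-- The reflection across the `x`-axis, `(x, y) ↦ (x, -y)`. -/
def kx : O2 :=
  ⟨!![1, 0; 0, -1], by
    rw [Matrix.mem_orthogonalGroup_iff]
    ext i j
    fin_cases i <;> fin_cases j <;> simp [Matrix.mul_apply]⟩

/-- The reflection across the `y`-axis, `(x, y) ↦ (-x, y)`. -/
def ky : O2 :=
  ⟨!![-1, 0; 0, 1], by
    rw [Matrix.mem_orthogonalGroup_iff]
    ext i j
    fin_cases i <;> fin_cases j <;> simp [Matrix.mul_apply]⟩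

/-- Minus the identity. -/
def negI : O2 :=
  ⟨-1, by rw [Matrix.mem_orthogonalGroup_iff]; simp⟩

/-- The subgroup `SO(2)` of `O(2)`. -/
def SO2 : Subgroup O2 where
  carrier := {γ | γ.1.det = 1}
  mul_mem' := by
    intro a b (ha : a.1.det = 1) (hb : b.1.det = 1)
    change (a.1 * b.1).det = 1
    rw [Matrix.det_mul, ha, hb, one_mul]
  one_mem' := Matrix.det_one
  inv_mem' := by
    intro a (ha : a.1.det = 1)
    have h : (a.1 * (a⁻¹).1).det = 1 := by
      rw [← Matrix.det_one (n := Fin 2) (R := ℝ)]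
      exact congrArg (fun b : O2 => b.1.det) (mul_inv_cancel a)
    rwa [Matrix.det_mul, ha, one_mul] at h

/-- The cyclic group `Z_n` generated by the rotation of angle `2π/n`. -/
def cyc (n : ℕ) : Subgroup O2 := Subgroup.zpowers (rot (2 * Real.pi / n))

/-- The dihedral group `D_n(κ)` generated by the rotation of angle `2π/n` and by `κ`. -/
def dih (n : ℕ) (κ : O2) : Subgroup O2 := Subgroup.closure {rot (2 * Real.pi / n), κ}

/-- The group `Z₂ × Z₂` generated by the two reflections across the axes. -/
def klein : Subgroup O2 := Subgroup.closure {kx, ky}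

/-- Real polynomials in the two variables `x`, `y`. -/
abbrev Poly : Type := MvPolynomial (Fin 2) ℝ

/-- The ring `P(Γ)` of `Γ`-invariant polynomials. -/
def invariants (Γ : Subgroup O2) : Subalgebra ℝ Poly where
  carrier := {p | ∀ γ ∈ Γ, ∀ u : Plane,
    MvPolynomial.eval (γ.1 *ᵥ u) p = MvPolynomial.eval u p}
  mul_mem' := by
    intro p q hp hq γ hγ u
    rw [map_mul, map_mul, hp γ hγ u, hq γ hγ u]
  add_mem' := by
    intro p q hp hq γ hγ u
    rw [map_add, map_add, hp γ hγ u, hq γ hγ u]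
  algebraMap_mem' := by
    intro r γ _ u
    simp [MvPolynomial.algebraMap_eq]

/-- Polynomial maps from the plane to the `2 × 2` matrices. -/
abbrev PolyForm : Type := Matrix (Fin 2) (Fin 2) Poly

/-- The value at `u` of a polynomial matrix-valued map. -/
def PolyForm.evalAt (M : PolyForm) (u : Plane) : Matrix (Fin 2) (Fin 2) ℝ :=
  M.map (MvPolynomial.eval u)

/-- The `P(Γ)`-module of `Γ_η`-equivariant polynomial quadratic forms on the plane: symmetric
`B` with `B(γ u) = η(γ) γ B(u) γᵗ`. -/
def equivariantForms (Γ : Subgroup O2) (η : Γ →* ℤˣ) :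
    Submodule (invariants Γ) PolyForm where
  carrier := {M | M.IsSymm ∧ ∀ (γ : Γ) (u : Plane),
    PolyForm.evalAt M (γ.1.1 *ᵥ u) =
      (((η γ : ℤˣ) : ℤ) : ℝ) • (γ.1.1 * PolyForm.evalAt M u * γ.1.1ᵀ)}
  add_mem' := by
    rintro M N ⟨hM, hM'⟩ ⟨hN, hN'⟩
    refine ⟨hM.add hN, fun γ u => ?_⟩
    have e : ∀ v, PolyForm.evalAt (M + N) v = PolyForm.evalAt M v + PolyForm.evalAt N v := fun v => by
      ext i j; simp [PolyForm.evalAt]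
    rw [e, e, hM', hN', Matrix.mul_add, Matrix.add_mul, smul_add]
  zero_mem' := by
    refine ⟨Matrix.isSymm_zero, fun γ u => ?_⟩
    have e : ∀ v, PolyForm.evalAt (0 : PolyForm) v = 0 := fun v => by
      ext i j; simp [PolyForm.evalAt]
    rw [e, e]; simp
  smul_mem' := by
    rintro p M ⟨hM, hM'⟩
    refine ⟨hM.smul p, fun γ u => ?_⟩
    have e : ∀ v, PolyForm.evalAt (p • M) v = MvPolynomial.eval v p.1 • PolyForm.evalAt M v :=
      fun v => by
        ext i j
        simp [PolyForm.evalAt, Subalgebra.smul_def]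
    rw [e, e, hM', p.2 γ.1 γ.2 u, Matrix.mul_smul, Matrix.smul_mul, smul_comm]

/-- The matrix of the quadratic form `a dy² + 2 b dx dy + c dx²`. -/
def quad (a b c : Poly) : PolyForm := !![c, b; b, a]

/-- The coordinate polynomial `x`. -/
def x : Poly := MvPolynomial.X 0

/-- The coordinate polynomial `y`. -/
def y : Poly := MvPolynomial.X 1

/-- The real and imaginary parts of `z ^ k`, `z = x + i y`, as polynomials in `x`, `y`. -/
def powZ : ℕ → Poly × Poly
  | 0 => (1, 0)
  | k + 1 => (x * (powZ k).1 - y * (powZ k).2, x * (powZ k).2 + y * (powZ k).1)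

/-- `Re (z ^ k)`. -/
def reZ (k : ℕ) : Poly := (powZ k).1

/-- `Im (z ^ k)`. -/
def imZ (k : ℕ) : Poly := (powZ k).2

theorem eval_powZ (k : ℕ) (u : Plane) :
    MvPolynomial.eval u (reZ k) = (((u 0 : ℂ) + u 1 * Complex.I) ^ k).re ∧
    MvPolynomial.eval u (imZ k) = (((u 0 : ℂ) + u 1 * Complex.I) ^ k).im := by
  unfold reZ imZ
  induction k with
  | zero => simp [powZ]
  | succ k ih => simp [powZ, pow_succ', ih.1, ih.2, x, y, Complex.mul_re, Complex.mul_im]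

/-- A binary differential equation `a dy² + 2 b dx dy + c dx² = 0` with smooth coefficients
on the plane. -/
structure BDE where
  a : Plane → ℝ
  b : Plane → ℝ
  c : Plane → ℝ
  smooth_a : ContDiff ℝ (⊤ : ℕ∞) a
  smooth_b : ContDiff ℝ (⊤ : ℕ∞) b
  smooth_c : ContDiff ℝ (⊤ : ℕ∞) c

namespace BDE

/-- The quadratic differential form at the point `u`, on the tangent vector `v = (dx, dy)`. -/
def form (Q : BDE) (u v : Plane) : ℝ :=
  Q.a u * v 1 ^ 2 + 2 * Q.b u * v 0 * v 1 + Q.c u * v 0 ^ 2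

/-- `Γ_η`-equivariance: `Q(γ u, γ v) = η(γ) Q(u, v)`. -/
def IsEquivariant (Q : BDE) (Γ : Subgroup O2) (η : Γ →* ℤˣ) : Prop :=
  ∀ (γ : Γ) (u v : Plane),
    Q.form (γ.1.1 *ᵥ u) (γ.1.1 *ᵥ v) = (((η γ : ℤˣ) : ℤ) : ℝ) * Q.form u v

/-- The discriminant function `δ = b² - a c`. -/
def disc (Q : BDE) (u : Plane) : ℝ := Q.b u ^ 2 - Q.a u * Q.c u

/-- The region `Ω` where the discriminant function is positive. -/
def Omega (Q : BDE) : Set Plane := {u | 0 < Q.disc u}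

/-- For `ε = ±1` and `u ∈ Ω`, the solution direction of the equation at `u` that is spanned by
`X = (a, -b + ε √δ)` where `X` does not vanish, and by `(-b - ε √δ, c)` where that vector does
not vanish (the two are parallel, and at least one of them is nonzero). -/
def direction (Q : BDE) (ε : ℤˣ) (u : Plane) : Set Plane :=
  {v | Q.a u * v 1 = (-Q.b u + ((ε : ℤ) : ℝ) * √(Q.disc u)) * v 0 ∧
    (-Q.b u - ((ε : ℤ) : ℝ) * √(Q.disc u)) * v 1 = Q.c u * v 0}

/-- For `ε = -1` and `ε = 1`, the two foliations of `Ω` by solutions of the equation. A foliation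
is given by all its regular integral curves `(I, φ)`, where `I` is a nonempty open interval. -/
def foliation (Q : BDE) (ε : ℤˣ) : Set (Set ℝ × (ℝ → Plane)) :=
  {C | IsOpen C.1 ∧ C.1.OrdConnected ∧ C.1.Nonempty ∧ ∀ t ∈ C.1, C.2 t ∈ Q.Omega ∧
    ∃ v ∈ Q.direction ε (C.2 t), v ≠ 0 ∧ HasDerivAt C.2 v t}

/-- `γ` maps the foliation `ε` onto the foliation `ε'`. -/
def MapsFoliation (Q : BDE) (γ : O2) (ε ε' : ℤˣ) : Prop :=
  (fun C : Set ℝ × (ℝ → Plane) => (C.1, fun t => γ.1 *ᵥ C.2 t)) '' Q.foliation ε =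
    Q.foliation ε'

end BDE

/-- `L` is the kernel of the homomorphism `λ : Γ → {±1}` that is `1` on the elements preserving
each of the two foliations and `-1` on those interchanging them, for every `Γ_η`-equivariant
binary differential equation with `Ω` nonempty (`λ` being well defined for each of these, and at
least one of these existing). -/
def IsKerLambda (Γ : Subgroup O2) (η : Γ →* ℤˣ) (L : Subgroup O2) : Prop :=
  L ≤ Γ ∧ (∃ Q : BDE, Q.IsEquivariant Γ η ∧ Q.Omega.Nonempty) ∧
    ∀ Q : BDE, Q.IsEquivariant Γ η → Q.Omega.Nonempty → ∀ γ ∈ Γ,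
    (γ ∈ L ↔ ∀ ε : ℤˣ, Q.MapsFoliation γ ε ε) ∧
    (γ ∉ L ↔ ∀ ε : ℤˣ, Q.MapsFoliation γ ε (-ε))

/-- The kernel of `η : Γ → {±1}`, as a subgroup of `O(2)`. -/
def kerEta (Γ : Subgroup O2) (η : Γ →* ℤˣ) : Subgroup O2 := η.ker.map Γ.subtype

/-- The conjugate `g H g⁻¹`. -/
def conj (g : O2) (H : Subgroup O2) : Subgroup O2 := H.map (MulAut.conj g).toMonoidHom

/-- The table of general forms: `Table Γ K L S` says that it has a row with group `Γ`,
`ker η = K`, `ker λ = L`, in which the general form runs over the set `S`. -/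
inductive Table : Subgroup O2 → Subgroup O2 → Subgroup O2 → Set PolyForm → Prop
  | row_so2 : Table SO2 SO2 SO2
      {B | ∃ p₁ p₂ p₃ : invariants SO2, B = quad
        (p₁ + (y ^ 2 - x ^ 2) * p₂ + 2 * x * y * p₃)
        (2 * x * y * p₂ + (x ^ 2 - y ^ 2) * p₃)
        (p₁ + (x ^ 2 - y ^ 2) * p₂ - 2 * x * y * p₃)}
  | row_o2 : Table ⊤ ⊤ SO2
      {B | ∃ p₁ p₂ : invariants ⊤, B = quad
        (p₁ + (y ^ 2 - x ^ 2) * p₂)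
        (2 * x * y * p₂)
        (p₁ + (x ^ 2 - y ^ 2) * p₂)}
  | row_o2_so2 : Table ⊤ SO2 ⊤
      {B | ∃ p : invariants ⊤, B = quad
        (2 * x * y * p)
        ((x ^ 2 - y ^ 2) * p)
        (-(2 * x * y * p))}
  | row_cyc (n : ℕ) (hn : 3 ≤ n) : Table (cyc n) (cyc n) (cyc n)
      {B | ∃ p₁ p₂ p₃ p₄ p₅ : invariants (cyc n), B = quad
        (p₁ + (y ^ 2 - x ^ 2) * p₂ + 2 * x * y * p₃ - reZ (n - 2) * p₄ - imZ (n - 2) * p₅)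
        (2 * x * y * p₂ + (x ^ 2 - y ^ 2) * p₃ + reZ (n - 2) * p₅ - imZ (n - 2) * p₄)
        (p₁ + (x ^ 2 - y ^ 2) * p₂ - 2 * x * y * p₃ + reZ (n - 2) * p₄ + imZ (n - 2) * p₅)}
  | row_cyc_cyc (m : ℕ) (hm : 2 ≤ m) : Table (cyc (2 * m)) (cyc m) (cyc m)
      {B | ∃ p₁ p₂ p₃ p₄ p₅ p₆ : invariants (cyc (2 * m)), B = quad
        (-(reZ (m - 2) * p₁) - imZ (m - 2) * p₂ + reZ m * p₃ - reZ (m + 2) * p₄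
          + imZ (m + 2) * p₅ + imZ m * p₆)
        (-(imZ (m - 2) * p₁) + reZ (m - 2) * p₂ + imZ (m + 2) * p₄ + reZ (m + 2) * p₅)
        (reZ (m - 2) * p₁ + imZ (m - 2) * p₂ + reZ m * p₃ + reZ (m + 2) * p₄
          - imZ (m + 2) * p₅ + imZ m * p₆)}
  | row_dih (n : ℕ) (hn : 3 ≤ n) : Table (dih n kx) (dih n kx) (cyc n)
      {B | ∃ p₁ p₂ p₃ : invariants (dih n kx), B = quad
        (p₁ + (y ^ 2 - x ^ 2) * p₂ - reZ (n - 2) * p₃)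
        (2 * x * y * p₂ - imZ (n - 2) * p₃)
        (p₁ + (x ^ 2 - y ^ 2) * p₂ + reZ (n - 2) * p₃)}
  | row_dih_cyc (n : ℕ) (hn : 3 ≤ n) : Table (dih n kx) (cyc n) (dih n kx)
      {B | ∃ p₁ p₂ p₃ : invariants (dih n kx), B = quad
        (2 * x * y * p₁ - imZ (n - 2) * p₂ + imZ n * p₃)
        ((x ^ 2 - y ^ 2) * p₁ + reZ (n - 2) * p₂)
        (-(2 * x * y * p₁) + imZ (n - 2) * p₂ + imZ n * p₃)}
  | row_dih_dih (m : ℕ) (hm : 2 ≤ m) :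
      Table (dih (2 * m) kx) (dih m kx) (dih m (rot (Real.pi / m) * kx))
      {B | ∃ p₁ p₂ p₃ : invariants (dih (2 * m) kx), B = quad
        (-(reZ (m - 2) * p₁) + reZ m * p₂ - reZ (m + 2) * p₃)
        (-(imZ (m - 2) * p₁) + imZ (m + 2) * p₃)
        (reZ (m - 2) * p₁ + reZ m * p₂ + reZ (m + 2) * p₃)}
  | row_z2 : Table (Subgroup.zpowers kx) (Subgroup.zpowers kx) ⊥
      {B | ∃ p₁ p₂ p₃ : invariants (Subgroup.zpowers kx), B = quad p₁ (y * p₂) p₃}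
  | row_z2_one : Table (Subgroup.zpowers kx) ⊥ (Subgroup.zpowers kx)
      {B | ∃ p₁ p₂ p₃ : invariants (Subgroup.zpowers kx), B = quad (y * p₁) p₂ (y * p₃)}
  | row_klein : Table klein klein (Subgroup.zpowers negI)
      {B | ∃ p₁ p₂ p₃ : invariants klein, B = quad p₁ (x * y * p₂) p₃}
  | row_klein_negI : Table klein (Subgroup.zpowers negI) klein
      {B | ∃ p₁ p₂ p₃ : invariants klein, B = quad (x * y * p₁) p₂ (x * y * p₃)}
  | row_klein_kx : Table klein (Subgroup.zpowers kx) (Subgroup.zpowers ky)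
      {B | ∃ p₁ p₂ p₃ : invariants klein, B = quad (x * p₁) (y * p₂) (x * p₃)}
  | row_one : Table ⊥ ⊥ ⊥
      {B | ∃ p₁ p₂ p₃ : invariants ⊥, B = quad p₁ p₂ p₃}
  | row_negI : Table (Subgroup.zpowers negI) (Subgroup.zpowers negI) (Subgroup.zpowers negI)
      {B | ∃ p₁ p₂ p₃ : invariants (Subgroup.zpowers negI), B = quad p₁ p₂ p₃}
  | row_negI_one : Table (Subgroup.zpowers negI) ⊥ ⊥
      {B | ∃ p₁ p₂ p₃ p₄ p₅ p₆ : invariants (Subgroup.zpowers negI), B = quad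
        (x * p₁ + y * p₂) (x * p₃ + y * p₄) (x * p₅ + y * p₆)}

end EquivariantBDE

end

/-!
Write a symmetric matrix `B` with entries `c`, `b`, `a` through its half trace `t = (a + c) / 2` and
the complex number `W = (c - a) / 2 + i b`. Conjugation of `B` by the rotation by `ζ` fixes `t` and
multiplies `W` by `ζ ^ 2`; conjugation by `κ_x` fixes `t` and conjugates `W`
(`isCovariant_rot_iff`, `isCovariant_qform_kx_iff`). Equivariance, which has to be tested on
generators only, says therefore that `t` and `W` are relative invariants of given types.

*Relative invariants.* A polynomial function is a combination of the monomials `z ^ j * conj z ^ k`.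
Averaging over the rotations of order `N` removes all monomials except those with `j - k ≡ r`
modulo `N` from a function of type `ζ ^ r` (`expansion_filter`), and compatibility with conjugation
makes the coefficients real. Each remaining monomial is an invariant one times `z ^ r` or
`conj z ^ s`, where `r + s = N`, and `z ^ N` acts on the module generated by these two functions
over the invariants of `D_N`, because `z ^ N = 2 Re (z ^ N) - conj z ^ N`. This gives
`dih_decomposition`. For the cyclic group one first splits a function into `f₁ + i f₂` with both
parts compatible with conjugation, and for `SO(2)` and `O(2)` one takes `N` beyond the degree. A
sign of `η` on the generating rotation of order `2 m` is absorbed by `ζ ^ m = -1`, and a sign on the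
reflection by multiplication by `i`.

*The kernel of `λ`.* A direction `v` belongs to the foliation `ε` if and only if `B v = ε √δ J v`,
with `J` the quarter turn, which commutes with `γ` up to `det γ`. Hence `γ` carries the foliation
`ε` to the foliation `det γ * η γ * ε`. The two foliations are different because an integral curve
exists (Picard–Lindelöf, `BDE.foliation_one_nonempty`) and its velocity cannot satisfy both
equations. So `λ = det * η` (`isKerLambda_of_det`), and forms with `Ω ≠ ∅` exist because a form of
the row has negative determinant at `(1, 0)`.

*Completeness.* The angles of the rotations in a closed subgroup form a closed additive subgroup
of `ℝ`, which is dense or cyclic (`rotations_of_isClosed`). If there are reflections, one of them is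
moved to `κ_x` by conjugation with a rotation; if `η` is not trivial on the rotations, it is chosen
in the kernel of `η` (`classification`). All that is asserted of a row is transported by
conjugation (`IsRow.transport`).
-/

namespace EquivariantBDE

/-! ### Rotations, reflections and the subgroups of `O(2)` -/

theorem rot_val (θ : ℝ) :
    (rot θ).1 = !![Real.cos θ, -Real.sin θ; Real.sin θ, Real.cos θ] := rfl

theorem rot_add (θ φ : ℝ) : rot (θ + φ) = rot θ * rot φ := by
  apply Subtype.ext
  change (rot (θ + φ)).1 = (rot θ).1 * (rot φ).1
  simp only [rot_val]
  ext i j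
  fin_cases i <;> fin_cases j <;> simp [Matrix.mul_apply, Real.cos_add, Real.sin_add] <;> ring

theorem rot_zero : rot 0 = 1 := by
  apply Subtype.ext
  change (rot 0).1 = 1
  ext i j
  fin_cases i <;> fin_cases j <;> simp [rot_val]

theorem rot_neg (θ : ℝ) : rot (-θ) = (rot θ)⁻¹ :=
  eq_inv_of_mul_eq_one_left (by rw [← rot_add, neg_add_cancel, rot_zero])

theorem rot_nsmul (k : ℕ) (θ : ℝ) : rot (k * θ) = rot θ ^ k := by
  induction k with
  | zero => simp [rot_zero]
  | succ k ih => rw [pow_succ, ← ih, ← rot_add]; congr 1; push_cast; ring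

theorem rot_zsmul (k : ℤ) (θ : ℝ) : rot (k * θ) = rot θ ^ k := by
  cases k with
  | ofNat k => simpa using rot_nsmul k θ
  | negSucc k =>
    rw [zpow_negSucc, ← rot_nsmul, ← rot_neg]; congr 1; push_cast; ring

theorem rot_two_pi : rot (2 * Real.pi) = 1 := by
  apply Subtype.ext
  change (rot _).1 = 1
  ext i j
  fin_cases i <;> fin_cases j <;> simp [rot_val]

theorem rot_eq_one_iff (θ : ℝ) : rot θ = 1 ↔ ∃ k : ℤ, (k : ℝ) * (2 * Real.pi) = θ := by
  constructor
  · intro h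
    have h1 : (rot θ).1 0 0 = (1 : Matrix (Fin 2) (Fin 2) ℝ) 0 0 := by rw [h]; rfl
    rw [← Real.cos_eq_one_iff]
    simpa [rot_val] using h1
  · rintro ⟨k, rfl⟩
    rw [rot_zsmul, rot_two_pi, one_zpow]

theorem kx_val : kx.1 = !![1, 0; 0, -1] := rfl

theorem kx_mul_kx : kx * kx = 1 := by
  apply Subtype.ext
  change kx.1 * kx.1 = 1
  ext i j
  fin_cases i <;> fin_cases j <;> simp [kx_val, Matrix.mul_apply]

theorem kx_mul_rot (θ : ℝ) : kx * rot θ = rot (-θ) * kx := by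
  apply Subtype.ext
  change kx.1 * (rot θ).1 = (rot (-θ)).1 * kx.1
  ext i j
  fin_cases i <;> fin_cases j <;> simp [kx_val, rot_val, Matrix.mul_apply]

theorem negI_eq : negI = rot Real.pi := by
  apply Subtype.ext
  change (-1 : Matrix (Fin 2) (Fin 2) ℝ) = (rot Real.pi).1
  ext i j
  fin_cases i <;> fin_cases j <;> simp [rot_val]

theorem ky_eq : ky = rot Real.pi * kx := by
  apply Subtype.ext
  change !![-1, 0; 0, 1] = (rot Real.pi).1 * kx.1
  ext i j
  fin_cases i <;> fin_cases j <;> simp [rot_val, kx_val, Matrix.mul_apply]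

theorem det_mul (γ γ' : O2) : (γ * γ').1.det = γ.1.det * γ'.1.det :=
  Matrix.det_mul γ.1 γ'.1

theorem det_rot (θ : ℝ) : (rot θ).1.det = 1 := by
  have h := Real.sin_sq_add_cos_sq θ
  simp only [rot_val, Matrix.det_fin_two_of]
  linarith [h]

theorem det_kx : kx.1.det = -1 := by simp [kx_val]

theorem transpose_mul_self (γ : O2) : γ.1ᵀ * γ.1 = 1 := by
  simpa [Matrix.star_eq_conjTranspose] using (Matrix.mem_orthogonalGroup_iff' (Fin 2) ℝ).1 γ.2

theorem self_mul_transpose (γ : O2) : γ.1 * γ.1ᵀ = 1 := by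
  simpa [Matrix.star_eq_conjTranspose] using (Matrix.mem_orthogonalGroup_iff (Fin 2) ℝ).1 γ.2

theorem inv_val (γ : O2) : (γ⁻¹).1 = γ.1ᵀ := by
  have h : (γ⁻¹).1 * γ.1 = 1 := congrArg (fun b : O2 => b.1) (inv_mul_cancel γ)
  calc (γ⁻¹).1 = (γ⁻¹).1 * (γ.1 * γ.1ᵀ) := by rw [self_mul_transpose, mul_one]
    _ = γ.1ᵀ := by rw [← mul_assoc, h, one_mul]

theorem det_sq (γ : O2) : γ.1.det = 1 ∨ γ.1.det = -1 := by
  have h := congrArg Matrix.det (self_mul_transpose γ)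
  rw [Matrix.det_mul, Matrix.det_transpose, Matrix.det_one] at h
  exact mul_self_eq_one_iff.1 h

theorem mem_SO2 {γ : O2} : γ ∈ SO2 ↔ γ.1.det = 1 := Iff.rfl

theorem rot_mem_SO2 (θ : ℝ) : rot θ ∈ SO2 := det_rot θ

theorem exists_rot_of_mem_SO2 {γ : O2} (h : γ ∈ SO2) : ∃ θ, γ = rot θ := by
  have h1 := transpose_mul_self γ
  have h2 : γ.1.det = 1 := h
  rw [Matrix.det_fin_two] at h2
  have e00 := congrFun (congrFun h1 0) 0
  have e01 := congrFun (congrFun h1 0) 1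
  have e11 := congrFun (congrFun h1 1) 1
  simp [Matrix.mul_apply, Fin.sum_univ_two] at e00 e01 e11
  have hn : ‖(γ.1 0 0 + γ.1 1 0 * Complex.I : ℂ)‖ = 1 := by
    rw [Complex.norm_add_mul_I, Real.sqrt_eq_one]; nlinarith
  refine ⟨Complex.arg (γ.1 0 0 + γ.1 1 0 * Complex.I), Subtype.ext ?_⟩
  have hne : (γ.1 0 0 + γ.1 1 0 * Complex.I : ℂ) ≠ 0 := by
    intro h0; rw [h0] at hn; simp at hn
  have hc := Complex.cos_arg hne
  have hs := Complex.sin_arg (γ.1 0 0 + γ.1 1 0 * Complex.I : ℂ)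
  rw [hn] at hc hs
  simp at hc hs
  have a11 : γ.1 1 1 = γ.1 0 0 := by
    linear_combination γ.1 0 0 * h2 - γ.1 1 1 * e00 + γ.1 1 0 * e01
  have a01 : γ.1 0 1 = - γ.1 1 0 := by
    linear_combination -γ.1 1 0 * h2 - γ.1 0 1 * e00 + γ.1 0 0 * e01
  rw [rot_val, hc, hs]
  ext i j
  fin_cases i <;> fin_cases j <;> simp [a11, a01]

theorem exists_rot_mul_kx {γ : O2} (h : γ ∉ SO2) : ∃ θ, γ = rot θ * kx := by
  have hd : (γ * kx) ∈ SO2 := by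
    have := (det_sq γ).resolve_left h
    rw [mem_SO2, det_mul, this, det_kx]; norm_num
  obtain ⟨θ, hθ⟩ := exists_rot_of_mem_SO2 hd
  exact ⟨θ, by rw [← hθ, mul_assoc, kx_mul_kx, mul_one]⟩

theorem det_rot_mul_kx (θ : ℝ) : (rot θ * kx).1.det = -1 := by
  rw [det_mul, det_rot, det_kx]; norm_num

theorem rot_mul_kx_not_mem_SO2 (θ : ℝ) : rot θ * kx ∉ SO2 := by
  rw [mem_SO2, det_rot_mul_kx]; norm_num

theorem rot_pow_self {n : ℕ} (hn : n ≠ 0) : rot (2 * Real.pi / n) ^ n = 1 := by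
  rw [← rot_nsmul, mul_div_cancel₀ _ (by exact_mod_cast hn), rot_two_pi]

theorem rot_zpow_eq_one_iff {n : ℕ} (hn : n ≠ 0) (k : ℤ) :
    rot (2 * Real.pi / n) ^ k = 1 ↔ (n : ℤ) ∣ k := by
  have hn' : (n : ℝ) ≠ 0 := by exact_mod_cast hn
  rw [← rot_zsmul, rot_eq_one_iff]
  constructor
  · rintro ⟨l, hl⟩
    refine ⟨l, ?_⟩
    have : (l : ℝ) * n = k := by
      field_simp at hl
      linarith
    rw [mul_comm]
    exact_mod_cast this.symm
  · rintro ⟨l, rfl⟩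
    refine ⟨l, ?_⟩
    push_cast
    field_simp

theorem mem_cyc {n : ℕ} {γ : O2} : γ ∈ cyc n ↔ ∃ k : ℤ, rot (2 * Real.pi / n) ^ k = γ :=
  Subgroup.mem_zpowers_iff

theorem gen_mem_cyc (n : ℕ) : rot (2 * Real.pi / n) ∈ cyc n := Subgroup.mem_zpowers _

theorem cyc_le_SO2 (n : ℕ) : cyc n ≤ SO2 := by
  rw [cyc, Subgroup.zpowers_le]; exact rot_mem_SO2 _

/-- A reflection conjugates every rotation into its inverse. -/
theorem reflection_conj {κ ρ : O2} (hκ : κ ∉ SO2) (hρ : ρ ∈ SO2) : κ * ρ = ρ⁻¹ * κ := by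
  obtain ⟨α, rfl⟩ := exists_rot_mul_kx hκ
  obtain ⟨θ, rfl⟩ := exists_rot_of_mem_SO2 hρ
  rw [mul_assoc, kx_mul_rot, ← mul_assoc, ← mul_assoc, ← rot_add, ← rot_neg, ← rot_add, add_comm]

theorem reflection_mul_self {κ : O2} (hκ : κ ∉ SO2) : κ * κ = 1 := by
  obtain ⟨α, rfl⟩ := exists_rot_mul_kx hκ
  rw [mul_assoc, ← mul_assoc kx, kx_mul_rot, mul_assoc (rot (-α)), kx_mul_kx, mul_one, ← rot_add,
    add_neg_cancel, rot_zero]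

theorem mul_mem_SO2_iff (γ γ' : O2) : γ * γ' ∈ SO2 ↔ (γ ∈ SO2 ↔ γ' ∈ SO2) := by
  simp only [mem_SO2, det_mul]
  rcases det_sq γ with h | h <;> rcases det_sq γ' with h' | h' <;> rw [h, h'] <;> norm_num

theorem cyc_le_dih (n : ℕ) (κ : O2) : cyc n ≤ dih n κ := by
  rw [cyc, Subgroup.zpowers_le]; exact Subgroup.subset_closure (by simp)

theorem gen_mem_dih (n : ℕ) (κ : O2) : rot (2 * Real.pi / n) ∈ dih n κ :=
  Subgroup.subset_closure (by simp)

theorem refl_mem_dih (n : ℕ) (κ : O2) : κ ∈ dih n κ := Subgroup.subset_closure (by simp)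

theorem mem_dih {n : ℕ} {κ : O2} (hκ : κ ∉ SO2) {γ : O2} :
    γ ∈ dih n κ ↔ γ ∈ cyc n ∨ γ * κ ∈ cyc n := by
  constructor
  · intro h
    have comm : ∀ ρ ∈ cyc n, κ * ρ = ρ⁻¹ * κ := fun ρ hρ =>
      reflection_conj hκ (cyc_le_SO2 n hρ)
    induction h using Subgroup.closure_induction with
    | mem x hx =>
      rcases hx with rfl | rfl
      · exact Or.inl (gen_mem_cyc n)
      · rw [reflection_mul_self hκ]; exact Or.inr (one_mem _)
    | one => exact Or.inl (one_mem _)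
    | mul a b _ _ ha hb =>
      rcases ha with ha | ha <;> rcases hb with hb | hb
      · exact Or.inl (mul_mem ha hb)
      · rw [mul_assoc]; exact Or.inr (mul_mem ha hb)
      · right
        have : a * b * κ = a * κ * b⁻¹ := by
          rw [mul_assoc a κ, comm _ (inv_mem hb), inv_inv, mul_assoc]
        rw [this]; exact mul_mem ha (inv_mem hb)
      · left
        have : a * b = (a * κ) * (b * κ)⁻¹ := by
          have h1 : b = (b * κ) * κ := by rw [mul_assoc, reflection_mul_self hκ, mul_one]
          have h2 := comm _ (inv_mem hb)
          rw [inv_inv] at h2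
          rw [mul_assoc, h2, ← h1]
        rw [this]; exact mul_mem ha (inv_mem hb)
    | inv a _ ha =>
      rcases ha with ha | ha
      · exact Or.inl (inv_mem ha)
      · right
        have h2 := comm _ (inv_mem ha)
        have h3 : a⁻¹ * κ = a * κ := by
          have hr : a ∉ SO2 := by
            intro h'
            have := cyc_le_SO2 n ha
            rw [mul_mem_SO2_iff] at this
            exact hκ (this.1 h')
          rw [inv_eq_of_mul_eq_one_left (reflection_mul_self hr)]
        rw [h3]; exact ha
  · rintro (h | h)
    · exact cyc_le_dih n κ h
    · have : γ = (γ * κ) * κ := by rw [mul_assoc, reflection_mul_self hκ, mul_one]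
      rw [this]; exact mul_mem (cyc_le_dih n κ h) (refl_mem_dih n κ)

theorem kx_not_mem_SO2 : kx ∉ SO2 := by rw [mem_SO2, det_kx]; norm_num

theorem mem_dih_iff_of_mem_SO2 {n : ℕ} {κ γ : O2} (hκ : κ ∉ SO2) (hγ : γ ∈ SO2) :
    γ ∈ dih n κ ↔ γ ∈ cyc n := by
  rw [mem_dih hκ, or_iff_left]
  intro h
  have := cyc_le_SO2 n h
  rw [mul_mem_SO2_iff] at this
  exact hκ (this.1 hγ)

theorem mem_dih_iff_of_not_mem_SO2 {n : ℕ} {κ γ : O2} (hκ : κ ∉ SO2) (hγ : γ ∉ SO2) :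
    γ ∈ dih n κ ↔ γ * κ ∈ cyc n := by
  rw [mem_dih hκ, or_iff_right]
  exact fun h => hγ (cyc_le_SO2 n h)

theorem cyc_one : cyc 1 = ⊥ := by
  rw [cyc, Nat.cast_one, div_one, rot_two_pi, Subgroup.zpowers_one_eq_bot]

theorem cyc_two : cyc 2 = Subgroup.zpowers negI := by
  rw [cyc, negI_eq, Nat.cast_two, mul_div_cancel_left₀ _ two_ne_zero]

theorem dih_one (κ : O2) : dih 1 κ = Subgroup.zpowers κ := by
  rw [dih, Nat.cast_one, div_one, rot_two_pi, Subgroup.closure_insert_one,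
    Subgroup.zpowers_eq_closure]

theorem dih_two : dih 2 kx = klein := by
  rw [dih, klein, Nat.cast_two, mul_div_cancel_left₀ _ two_ne_zero]
  apply le_antisymm
  · rw [Subgroup.closure_le]
    have hx : kx ∈ Subgroup.closure {kx, ky} := Subgroup.subset_closure (by simp)
    have hy : ky ∈ Subgroup.closure {kx, ky} := Subgroup.subset_closure (by simp)
    rintro _ (rfl | rfl)
    · have : rot Real.pi = ky * kx := by rw [ky_eq, mul_assoc, kx_mul_kx, mul_one]
      rw [this]; exact mul_mem hy hx
    · exact hx
  · rw [Subgroup.closure_le]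
    have hx : kx ∈ Subgroup.closure {rot Real.pi, kx} := Subgroup.subset_closure (by simp)
    have hy : rot Real.pi ∈ Subgroup.closure {rot Real.pi, kx} := Subgroup.subset_closure (by simp)
    rintro _ (rfl | rfl)
    · exact hx
    · rw [ky_eq]; exact mul_mem hy hx

theorem gen_two_mul_sq {m : ℕ} (hm : m ≠ 0) :
    rot (2 * Real.pi / (2 * m : ℕ)) ^ (2 : ℤ) = rot (2 * Real.pi / m) := by
  rw [← rot_zsmul]
  congr 1
  have : (m : ℝ) ≠ 0 := by exact_mod_cast hm
  push_cast
  field_simp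

/-- The rotations of order `m` are the even powers of the rotation of order `2 m`. -/
theorem gen_zpow_mem_cyc_half {m : ℕ} (hm : m ≠ 0) (k : ℤ) :
    rot (2 * Real.pi / (2 * m : ℕ)) ^ k ∈ cyc m ↔ Even k := by
  rw [mem_cyc, ← gen_two_mul_sq hm]
  constructor
  · rintro ⟨l, hl⟩
    rw [← zpow_mul, ← mul_inv_eq_one, ← zpow_neg, ← zpow_add,
      rot_zpow_eq_one_iff (by omega)] at hl
    obtain ⟨j, hj⟩ := hl
    push_cast at hj
    exact ⟨l - m * j, by linear_combination -hj⟩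
  · rintro ⟨l, rfl⟩
    exact ⟨l, by rw [← zpow_mul]; congr 1; ring⟩

theorem cyc_half_le {m : ℕ} (hm : m ≠ 0) : cyc m ≤ cyc (2 * m) := by
  rw [cyc, Subgroup.zpowers_le, ← gen_two_mul_sq hm]
  exact zpow_mem (gen_mem_cyc _) _

theorem mul_mem_cyc_half {m : ℕ} (hm : m ≠ 0) {γ γ' : O2} (h : γ ∈ cyc (2 * m))
    (h' : γ' ∈ cyc (2 * m)) : γ * γ' ∈ cyc m ↔ (γ ∈ cyc m ↔ γ' ∈ cyc m) := by
  obtain ⟨k, rfl⟩ := mem_cyc.1 h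
  obtain ⟨l, rfl⟩ := mem_cyc.1 h'
  rw [← zpow_add, gen_zpow_mem_cyc_half hm, gen_zpow_mem_cyc_half hm, gen_zpow_mem_cyc_half hm,
    Int.even_add]

theorem dih_half_le {m : ℕ} (hm : m ≠ 0) {κ : O2} (h : κ ∈ dih (2 * m) kx) :
    dih m κ ≤ dih (2 * m) kx := by
  rw [dih, Subgroup.closure_le]
  rintro _ (rfl | rfl)
  · exact cyc_le_dih _ _ (cyc_half_le hm (gen_mem_cyc m))
  · exact h

theorem rot_pi_div (m : ℕ) : rot (Real.pi / m) = rot (2 * Real.pi / (2 * m : ℕ)) := by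
  congr 1; push_cast; rw [mul_div_mul_left _ _ two_ne_zero]

/-- Membership in `D_m(κ_x)`, for the elements of `D_{2m}`, is a character. -/
theorem mul_mem_dih_half {m : ℕ} (hm : m ≠ 0) {γ γ' : O2} (h : γ ∈ dih (2 * m) kx)
    (h' : γ' ∈ dih (2 * m) kx) : γ * γ' ∈ dih m kx ↔ (γ ∈ dih m kx ↔ γ' ∈ dih m kx) := by
  by_cases hγ : γ ∈ dih m kx
  · simp [hγ, Subgroup.mul_mem_cancel_left _ hγ]
  by_cases hγ' : γ' ∈ dih m kx
  · simp [hγ, hγ', Subgroup.mul_mem_cancel_right _ hγ']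
  simp only [hγ, hγ', iff_true]
  -- both factors lie in the coset of the generator `rot (π / m)`
  have coset : ∀ δ ∈ dih (2 * m) kx, δ ∉ dih m kx →
      ∃ δ' ∈ dih m kx, δ = rot (2 * Real.pi / (2 * m : ℕ)) * δ' := by
    intro δ hδ hn
    set g := rot (2 * Real.pi / (2 * m : ℕ)) with hg
    refine ⟨g⁻¹ * δ, ?_, by group⟩
    rcases (mem_dih kx_not_mem_SO2).1 hδ with h1 | h1
    · obtain ⟨k, rfl⟩ := mem_cyc.1 h1
      apply cyc_le_dih
      rw [← hg, ← zpow_neg_one, ← zpow_add, hg, gen_zpow_mem_cyc_half hm]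
      have : ¬ Even k := fun hk => hn (cyc_le_dih _ _ ((gen_zpow_mem_cyc_half hm k).2 hk))
      rw [Int.even_add]; simp [this]
    · obtain ⟨k, hk⟩ := mem_cyc.1 h1
      rw [mem_dih kx_not_mem_SO2]
      right
      rw [mul_assoc, ← hk, ← hg, ← zpow_neg_one, ← zpow_add, hg, gen_zpow_mem_cyc_half hm]
      have : ¬ Even k := fun hk' => hn ((mem_dih kx_not_mem_SO2).2 (Or.inr (by
        rw [← hk]; exact (gen_zpow_mem_cyc_half hm k).2 hk')))
      rw [Int.even_add]; simp [this]
  obtain ⟨δ, hδ, rfl⟩ := coset γ h hγ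
  obtain ⟨δ', hδ', rfl⟩ := coset γ' h' hγ'
  set g := rot (2 * Real.pi / (2 * m : ℕ)) with hg
  have hg2 : g * g ∈ cyc m := by
    have := (gen_zpow_mem_cyc_half hm 2).2 even_two
    rwa [zpow_two] at this
  rw [← mul_assoc, Subgroup.mul_mem_cancel_right _ hδ']
  by_cases hs : δ ∈ SO2
  · obtain ⟨θ, rfl⟩ := exists_rot_of_mem_SO2 hs
    have : g * rot θ * g = g * g * rot θ := by
      rw [mul_assoc, mul_assoc, hg, ← rot_add θ, add_comm θ, rot_add]
    rw [this, Subgroup.mul_mem_cancel_left _ (cyc_le_dih _ _ hg2)]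
    exact hδ
  · rw [mul_assoc, reflection_conj hs (rot_mem_SO2 _), ← mul_assoc, mul_inv_cancel, one_mul]
    exact hδ

theorem refl_half_mem_dih (m : ℕ) : rot (Real.pi / m) * kx ∈ dih (2 * m) kx := by
  rw [rot_pi_div]; exact mul_mem (gen_mem_dih _ _) (refl_mem_dih _ _)

/-- Inside `D_{2m}`, the group `D_m(ρ_{π/m} κ_x)` is the kernel of the product of the determinant
and the character with kernel `D_m(κ_x)`. -/
theorem mem_dih_half_iff {m : ℕ} (hm : m ≠ 0) {γ : O2} (h : γ ∈ dih (2 * m) kx) :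
    γ ∈ dih m (rot (Real.pi / m) * kx) ↔ (γ ∈ dih m kx ↔ γ ∈ SO2) := by
  by_cases hs : γ ∈ SO2
  · rw [mem_dih_iff_of_mem_SO2 (rot_mul_kx_not_mem_SO2 _) hs,
      mem_dih_iff_of_mem_SO2 kx_not_mem_SO2 hs]
    simp [hs]
  · rw [mem_dih_iff_of_not_mem_SO2 (rot_mul_kx_not_mem_SO2 _) hs,
      mem_dih_iff_of_not_mem_SO2 kx_not_mem_SO2 hs]
    rw [mem_dih_iff_of_not_mem_SO2 kx_not_mem_SO2 hs] at h
    obtain ⟨k, hk⟩ := mem_cyc.1 h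
    have e : γ * (rot (Real.pi / m) * kx) = γ * kx * (rot (Real.pi / m))⁻¹ := by
      rw [← rot_neg, mul_assoc γ, kx_mul_rot, neg_neg]
    rw [e, ← hk, rot_pi_div, ← zpow_neg_one, ← zpow_add, gen_zpow_mem_cyc_half hm,
      gen_zpow_mem_cyc_half hm, Int.even_add]
    simp [hs]

theorem dih_rot_pi_eq (m : ℕ) (hm : m ≠ 0) (hodd : Odd m) :
    dih m (rot (Real.pi / m) * kx) = dih m ky := by
  obtain ⟨k, hk⟩ := hodd
  have hm' : (m : ℝ) ≠ 0 := by exact_mod_cast hm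
  have e : ky = rot (2 * Real.pi / m) ^ k * (rot (Real.pi / m) * kx) := by
    rw [ky_eq, ← mul_assoc, ← rot_nsmul, ← rot_add]
    congr 2
    field_simp
    rw [hk]; push_cast; ring
  have e' : rot (Real.pi / m) * kx = (rot (2 * Real.pi / m) ^ k)⁻¹ * ky := by
    rw [e, inv_mul_cancel_left]
  apply le_antisymm
  · rw [dih, Subgroup.closure_le]
    rintro _ (rfl | rfl)
    · exact gen_mem_dih _ _
    · rw [e']
      exact mul_mem (inv_mem (pow_mem (gen_mem_dih _ _) _)) (refl_mem_dih _ _)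
  · rw [dih, Subgroup.closure_le]
    rintro _ (rfl | rfl)
    · exact gen_mem_dih _ _
    · have := mul_mem (pow_mem (gen_mem_dih m (rot (Real.pi / m) * kx)) k)
        (refl_mem_dih m (rot (Real.pi / m) * kx))
      rw [← e] at this; exact this

/-! ### The action of symmetries on the two foliations -/

namespace BDE

/-- The symmetric matrix of the quadratic form at `u`. -/
def mat (Q : BDE) (u : Plane) : Matrix (Fin 2) (Fin 2) ℝ := !![Q.c u, Q.b u; Q.b u, Q.a u]

/-- `v` is a solution direction of sign `ε` exactly when `B(u) v = ε √δ J v`, where `J` is the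
rotation by a quarter turn. -/
theorem mem_direction_iff (Q : BDE) (ε : ℤˣ) (u v : Plane) :
    v ∈ Q.direction ε u ↔
      Q.mat u *ᵥ v = (((ε : ℤ) : ℝ) * √(Q.disc u)) • (!![0, -1; 1, 0] *ᵥ v) := by
  rw [funext_iff, Fin.forall_fin_two]
  change _ ∧ _ ↔ _
  simp only [mat, Matrix.mulVec, dotProduct, Fin.sum_univ_two, Pi.smul_apply, smul_eq_mul,
    Matrix.of_apply, Matrix.cons_val', Matrix.cons_val_zero, Matrix.cons_val_one,
    Matrix.cons_val_fin_one]
  constructor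
  · rintro ⟨h1, h2⟩
    exact ⟨by linear_combination -h2, by linear_combination h1⟩
  · rintro ⟨h1, h2⟩
    exact ⟨by linear_combination h2, by linear_combination -h1⟩

theorem disc_eq (Q : BDE) (u : Plane) : Q.disc u = -(Q.mat u).det := by
  rw [disc, mat, Matrix.det_fin_two_of]; ring

theorem form_eq (Q : BDE) (u v : Plane) : Q.form u v = v ⬝ᵥ (Q.mat u *ᵥ v) := by
  simp [form, mat, Matrix.mulVec, dotProduct, Fin.sum_univ_two]; ring

/-- A symmetric matrix is determined by its quadratic form. -/
theorem eq_of_forall_quadratic {A B : Matrix (Fin 2) (Fin 2) ℝ} (hA : A.IsSymm) (hB : B.IsSymm)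
    (h : ∀ v : Plane, v ⬝ᵥ (A *ᵥ v) = v ⬝ᵥ (B *ᵥ v)) : A = B := by
  have h0 := h ![1, 0]
  have h1 := h ![0, 1]
  have h2 := h ![1, 1]
  have sA : A 0 1 = A 1 0 := hA.apply 1 0
  have sB : B 0 1 = B 1 0 := hB.apply 1 0
  simp [Matrix.mulVec, dotProduct, Fin.sum_univ_two] at h0 h1 h2
  ext i j
  fin_cases i <;> fin_cases j <;> simp <;> linarith

theorem isSymm_mat (Q : BDE) (u : Plane) : (Q.mat u).IsSymm := by
  apply Matrix.IsSymm.ext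
  intro i j
  fin_cases i <;> fin_cases j <;> simp [mat]

/-- Equivariance of a form in terms of its matrix: `B(γ u) = η(γ) γ B(u) γᵗ`. -/
theorem isEquivariant_iff (Q : BDE) (Γ : Subgroup O2) (η : Γ →* ℤˣ) :
    Q.IsEquivariant Γ η ↔ ∀ (γ : Γ) (u : Plane), Q.mat (γ.1.1 *ᵥ u) =
      (((η γ : ℤˣ) : ℤ) : ℝ) • (γ.1.1 * Q.mat u * γ.1.1ᵀ) := by
  have key : ∀ (γ : Γ) (B : Matrix (Fin 2) (Fin 2) ℝ) (v : Plane),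
      (γ.1.1 *ᵥ v) ⬝ᵥ ((γ.1.1 * B * γ.1.1ᵀ) *ᵥ (γ.1.1 *ᵥ v)) = v ⬝ᵥ (B *ᵥ v) := by
    intro γ B v
    rw [Matrix.mulVec_mulVec, mul_assoc, transpose_mul_self, mul_one, ← Matrix.mulVec_mulVec,
      Matrix.dotProduct_mulVec, Matrix.vecMul_mulVec, transpose_mul_self, Matrix.vecMul_one]
  constructor
  · intro h γ u
    apply eq_of_forall_quadratic (isSymm_mat _ _)
    · apply Matrix.IsSymm.smul
      rw [Matrix.IsSymm, Matrix.transpose_mul, Matrix.transpose_mul, Matrix.transpose_transpose,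
        (isSymm_mat Q u).eq, mul_assoc]
    · intro v
      have h1 := h γ u (γ.1.1ᵀ *ᵥ v)
      have h2 := key γ (Q.mat u) (γ.1.1ᵀ *ᵥ v)
      rw [form_eq, form_eq, Matrix.mulVec_mulVec, self_mul_transpose, Matrix.one_mulVec] at h1
      rw [Matrix.mulVec_mulVec v, self_mul_transpose, Matrix.one_mulVec] at h2
      rw [h1, Matrix.smul_mulVec, dotProduct_smul, h2, smul_eq_mul]
  · intro h γ u v
    rw [form_eq, form_eq, h, Matrix.smul_mulVec, dotProduct_smul, key, smul_eq_mul]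

theorem units_cast_mul_self (e : ℤˣ) : ((e : ℤ) : ℝ) * ((e : ℤ) : ℝ) = 1 := by
  rcases Int.units_eq_one_or e with rfl | rfl <;> simp

theorem disc_smul {Q : BDE} {Γ : Subgroup O2} {η : Γ →* ℤˣ} (hQ : Q.IsEquivariant Γ η) (γ : Γ)
    (u : Plane) : Q.disc (γ.1.1 *ᵥ u) = Q.disc u := by
  rw [disc_eq, disc_eq, (isEquivariant_iff Q Γ η).1 hQ, Matrix.det_smul, Matrix.det_mul,
    Matrix.det_mul, Matrix.det_transpose, Fintype.card_fin, pow_two, units_cast_mul_self]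
  rcases det_sq γ.1 with h | h <;> rw [h] <;> ring

/-- An element of `O(2)` commutes with the quarter turn up to its determinant. -/
theorem quarterTurn_mul (γ : O2) :
    (!![0, -1; 1, 0] : Matrix (Fin 2) (Fin 2) ℝ) * γ.1 = γ.1.det • (γ.1 * !![0, -1; 1, 0]) := by
  by_cases h : γ ∈ SO2
  · obtain ⟨θ, rfl⟩ := exists_rot_of_mem_SO2 h
    rw [det_rot]
    ext i j
    fin_cases i <;> fin_cases j <;> simp [rot_val, Matrix.mul_apply, Fin.sum_univ_two]
  · obtain ⟨θ, rfl⟩ := exists_rot_mul_kx h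
    rw [det_rot_mul_kx]
    change _ * ((rot θ).1 * kx.1) = (-1 : ℝ) • ((rot θ).1 * kx.1 * _)
    ext i j
    fin_cases i <;> fin_cases j <;> simp [rot_val, kx_val, Matrix.mul_apply, Fin.sum_univ_two]

/-- A symmetry `γ` carries directions of sign `ε` to directions of sign `det γ · η(γ) · ε`. -/
theorem smul_mem_direction {Q : BDE} {Γ : Subgroup O2} {η : Γ →* ℤˣ} (hQ : Q.IsEquivariant Γ η)
    (γ : Γ) {ε ε' : ℤˣ} (hε : ((ε' : ℤ) : ℝ) = ((η γ : ℤ) : ℝ) * γ.1.1.det * ((ε : ℤ) : ℝ))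
    {u v : Plane} (hv : v ∈ Q.direction ε u) :
    γ.1.1 *ᵥ v ∈ Q.direction ε' (γ.1.1 *ᵥ u) := by
  rw [mem_direction_iff] at hv ⊢
  rw [disc_smul hQ, (isEquivariant_iff Q Γ η).1 hQ, Matrix.mulVec_mulVec v,
    Matrix.mulVec_mulVec v, quarterTurn_mul, Matrix.smul_mulVec, Matrix.smul_mul, mul_assoc,
    transpose_mul_self, mul_one,
    Matrix.smul_mulVec, ← Matrix.mulVec_mulVec v γ.1.1 (Q.mat u), hv,
    Matrix.mulVec_smul, Matrix.mulVec_mulVec v, smul_smul, smul_smul, hε]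
  congr 1
  rcases det_sq γ.1 with h | h <;> rw [h] <;> ring

theorem smul_mem_foliation {Q : BDE} {Γ : Subgroup O2} {η : Γ →* ℤˣ} (hQ : Q.IsEquivariant Γ η)
    (γ : Γ) {ε ε' : ℤˣ} (hε : ((ε' : ℤ) : ℝ) = ((η γ : ℤ) : ℝ) * γ.1.1.det * ((ε : ℤ) : ℝ))
    {C : Set ℝ × (ℝ → Plane)} (hC : C ∈ Q.foliation ε) :
    (C.1, fun t => γ.1.1 *ᵥ C.2 t) ∈ Q.foliation ε' := by
  obtain ⟨h1, h2, h3, h4⟩ := hC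
  refine ⟨h1, h2, h3, fun t ht => ?_⟩
  obtain ⟨h5, v, hv, hv0, hd⟩ := h4 t ht
  refine ⟨?_, γ.1.1 *ᵥ v, smul_mem_direction hQ γ hε hv, ?_, ?_⟩
  · change 0 < Q.disc (γ.1.1 *ᵥ C.2 t)
    rw [disc_smul hQ]; exact h5
  · intro h0
    apply hv0
    rw [← Matrix.one_mulVec v, ← transpose_mul_self γ.1, ← Matrix.mulVec_mulVec, h0,
      Matrix.mulVec_zero]
  · exact ((Matrix.mulVecLin γ.1.1).toContinuousLinearMap.hasFDerivAt).comp_hasDerivAt t hd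

theorem mapsFoliation_of_eq {Q : BDE} {Γ : Subgroup O2} {η : Γ →* ℤˣ}
    (hQ : Q.IsEquivariant Γ η) (γ : Γ) {ε ε' : ℤˣ}
    (hε : ((ε' : ℤ) : ℝ) = ((η γ : ℤ) : ℝ) * γ.1.1.det * ((ε : ℤ) : ℝ)) :
    Q.MapsFoliation γ.1 ε ε' := by
  apply Set.Subset.antisymm
  · rintro _ ⟨C, hC, rfl⟩
    exact smul_mem_foliation hQ γ hε hC
  · intro C hC
    have hinv : ((ε : ℤ) : ℝ) = ((η γ⁻¹ : ℤ) : ℝ) * (γ⁻¹).1.1.det * ((ε' : ℤ) : ℝ) := by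
      have e1 : (γ⁻¹).1.1.det = γ.1.1.det := by
        rw [Subgroup.coe_inv, inv_val, Matrix.det_transpose]
      have e2 : η γ⁻¹ = η γ := by rw [map_inv, Int.units_inv_eq_self]
      have e3 := units_cast_mul_self (η γ)
      rw [e1, e2, hε]
      rcases det_sq γ.1 with h | h <;> rw [h] <;>
        linear_combination (-((ε : ℤ) : ℝ)) * e3
    refine ⟨_, smul_mem_foliation hQ γ⁻¹ hinv hC, Prod.ext rfl (funext fun t => ?_)⟩
    simp only [Subgroup.coe_inv, inv_val]
    rw [Matrix.mulVec_mulVec, self_mul_transpose, Matrix.one_mulVec]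

theorem contDiff_disc (Q : BDE) : ContDiff ℝ (⊤ : ℕ∞) Q.disc :=
  (Q.smooth_b.pow 2).sub (Q.smooth_a.mul Q.smooth_c)

/-- A field of directions of the foliation `ε = 1` that is `C¹` and nonzero at a point of `Ω` has
an integral curve in `Ω` there. -/
theorem foliation_one_nonempty_of_field (Q : BDE) {u₀ : Plane} (hu₀ : u₀ ∈ Q.Omega)
    {X : Plane → Plane} (hX : ContDiffAt ℝ 1 X u₀) (hX0 : X u₀ ≠ 0)
    (hdir : ∀ u ∈ Q.Omega, X u ∈ Q.direction 1 u) : (Q.foliation 1).Nonempty := by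
  obtain ⟨α, hα0, r, hr, hα⟩ :=
    ContDiffAt.exists_forall_mem_closedBall_exists_eq_forall_mem_Ioo_hasDerivAt₀ hX 0
  have hcont : ContinuousAt α 0 := (hα 0 ⟨by linarith, by linarith⟩).continuousAt
  have hev : ∀ᶠ u in nhds u₀, u ∈ Q.Omega ∧ X u ≠ 0 :=
    ((Q.contDiff_disc.continuous.continuousAt.eventually_const_lt hu₀)).and
      (hX.continuousAt.eventually_ne hX0)
  rw [← hα0] at hev
  obtain ⟨s, hs, hball⟩ := Metric.eventually_nhds_iff_ball.1 (hcont.eventually hev)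
  refine ⟨(Set.Ioo (-(min r s)) (min r s), α), isOpen_Ioo, Set.ordConnected_Ioo,
    ⟨0, by simp [hr, hs]⟩, fun t ht => ?_⟩
  have ht' : t ∈ Metric.ball (0 : ℝ) s := by
    rw [Real.ball_eq_Ioo, zero_sub, zero_add]
    exact ⟨by linarith [ht.1, min_le_right r s], by linarith [ht.2, min_le_right r s]⟩
  have ht'' : t ∈ Set.Ioo (0 - r) (0 + r) :=
    ⟨by linarith [ht.1, min_le_left r s], by linarith [ht.2, min_le_left r s]⟩
  obtain ⟨h1, h2⟩ := hball t ht'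
  exact ⟨h1, X (α t), hdir _ h1, h2, hα t ht''⟩

/-- Integral curves exist: one of the two spanning vector fields is nonzero, and both are smooth
in `Ω`. -/
theorem foliation_one_nonempty (Q : BDE) (hΩ : Q.Omega.Nonempty) : (Q.foliation 1).Nonempty := by
  obtain ⟨u₀, hu₀⟩ := hΩ
  have hu₀' : 0 < Q.disc u₀ := hu₀
  have ha : ContDiffAt ℝ 1 Q.a u₀ := (Q.smooth_a.of_le (by simp)).contDiffAt
  have hb : ContDiffAt ℝ 1 Q.b u₀ := (Q.smooth_b.of_le (by simp)).contDiffAt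
  have hc : ContDiffAt ℝ 1 Q.c u₀ := (Q.smooth_c.of_le (by simp)).contDiffAt
  have hs : ContDiffAt ℝ 1 (fun u => √(Q.disc u)) u₀ :=
    (Q.contDiff_disc.of_le (by simp)).contDiffAt.sqrt hu₀'.ne'
  have hsq : ∀ u ∈ Q.Omega, √(Q.disc u) ^ 2 = Q.b u ^ 2 - Q.a u * Q.c u := fun u hu => by
    rw [Real.sq_sqrt (le_of_lt hu), disc]
  by_cases h : Q.a u₀ = 0 ∧ -Q.b u₀ + √(Q.disc u₀) = 0
  · apply foliation_one_nonempty_of_field Q hu₀ (X := fun u => ![-Q.b u - √(Q.disc u), Q.c u])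
    · rw [contDiffAt_pi]
      intro i
      fin_cases i
      · simpa using hb.neg.sub hs
      · simpa using hc
    · intro h0
      have := congrFun h0 0
      simp at this
      have hp : 0 < √(Q.disc u₀) := Real.sqrt_pos.2 hu₀'
      linarith [h.2]
    · intro u hu
      have := hsq u hu
      constructor <;> simp <;> nlinarith
  · apply foliation_one_nonempty_of_field Q hu₀ (X := fun u => ![Q.a u, -Q.b u + √(Q.disc u)])
    · rw [contDiffAt_pi]
      intro i
      fin_cases i
      · simpa using ha
      · simpa using hb.neg.add hs
    · intro h0
      exact h ⟨by simpa using congrFun h0 0, by simpa using congrFun h0 1⟩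
    · intro u hu
      have := hsq u hu
      constructor <;> simp <;> nlinarith

/-- The two foliations differ as soon as `Ω` is nonempty: a nonzero velocity satisfying
`B v = √δ J v` and `B v = -√δ J v` would give `√δ J v = 0`. In particular `λ` is well defined. -/
theorem foliation_one_ne (Q : BDE) (hΩ : Q.Omega.Nonempty) : Q.foliation 1 ≠ Q.foliation (-1) := by
  intro h
  obtain ⟨C, hC⟩ := foliation_one_nonempty Q hΩ
  have hC' := hC
  rw [h] at hC'
  obtain ⟨-, -, ⟨t, ht⟩, h4⟩ := hC
  obtain ⟨hu, v, ⟨hv1, hv2⟩, hv0, hd⟩ := h4 t ht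
  obtain ⟨-, w, ⟨hw1, hw2⟩, -, hd'⟩ := hC'.2.2.2 t ht
  obtain rfl := hd.unique hd'
  have hp : 0 < √(Q.disc (C.2 t)) := Real.sqrt_pos.2 hu
  apply hv0
  push_cast at hv1 hv2 hw1 hw2
  have h0 : √(Q.disc (C.2 t)) * v 0 = 0 := by linarith
  have h1 : √(Q.disc (C.2 t)) * v 1 = 0 := by linarith
  ext i
  fin_cases i
  · simpa [hp.ne'] using h0
  · simpa [hp.ne'] using h1

theorem contDiff_eval (p : Poly) : ContDiff ℝ (⊤ : ℕ∞) (fun u : Plane => MvPolynomial.eval u p) :=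
  (contDiffOn_univ.1 (AnalyticOnNhd.contDiffOn (AnalyticOnNhd.eval_mvPolynomial p)
    uniqueDiffOn_univ))

/-- The form with polynomial coefficients given by a polynomial matrix. -/
noncomputable def ofPoly (M : PolyForm) : BDE where
  a := fun u => MvPolynomial.eval u (M 1 1)
  b := fun u => MvPolynomial.eval u (M 0 1)
  c := fun u => MvPolynomial.eval u (M 0 0)
  smooth_a := contDiff_eval _
  smooth_b := contDiff_eval _
  smooth_c := contDiff_eval _

theorem mat_ofPoly {M : PolyForm} (hM : M.IsSymm) (u : Plane) :
    (ofPoly M).mat u = PolyForm.evalAt M u := by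
  have : M 1 0 = M 0 1 := hM.apply 0 1
  ext i j
  fin_cases i <;> fin_cases j <;> simp [mat, ofPoly, PolyForm.evalAt, this]

end BDE

/-- The algebraic criterion for the kernel of `λ`: since `λ(γ) = det γ · η(γ)`, it consists of the
elements with `η(γ) = det γ`. -/
theorem isKerLambda_of_det {Γ : Subgroup O2} {η : Γ →* ℤˣ} {L : Subgroup O2} (hL : L ≤ Γ)
    {M : PolyForm} (hM : M ∈ equivariantForms Γ η) {u₀ : Plane}
    (hdet : (PolyForm.evalAt M u₀).det < 0)
    (h : ∀ γ : Γ, γ.1 ∈ L ↔ ((η γ : ℤ) : ℝ) = γ.1.1.det) : IsKerLambda Γ η L := by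
  refine ⟨hL, ⟨BDE.ofPoly M, ?_, u₀, ?_⟩, ?_⟩
  · rw [BDE.isEquivariant_iff]
    intro γ u
    rw [BDE.mat_ofPoly hM.1, BDE.mat_ofPoly hM.1, hM.2]
  · change 0 < BDE.disc _ _
    rw [BDE.disc_eq, BDE.mat_ofPoly hM.1]
    linarith
  · intro Q hQ hΩ γ hγ
    have hne := BDE.foliation_one_ne Q hΩ
    have hnot : ¬ ((∀ ε : ℤˣ, Q.MapsFoliation γ ε ε) ∧ ∀ ε : ℤˣ, Q.MapsFoliation γ ε (-ε)) :=
      fun hh => hne ((hh.1 1).symm.trans (hh.2 1))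
    have h1 : γ ∈ L → ∀ ε : ℤˣ, Q.MapsFoliation γ ε ε := by
      intro hγL ε
      apply BDE.mapsFoliation_of_eq hQ ⟨γ, hγ⟩
      rw [(h ⟨γ, hγ⟩).1 hγL]
      rcases det_sq γ with hd | hd <;> simp [hd]
    have h2 : γ ∉ L → ∀ ε : ℤˣ, Q.MapsFoliation γ ε (-ε) := by
      intro hγL ε
      apply BDE.mapsFoliation_of_eq hQ ⟨γ, hγ⟩
      rw [h ⟨γ, hγ⟩] at hγL
      rcases det_sq γ with hd | hd <;> rcases Int.units_eq_one_or (η ⟨γ, hγ⟩) with he | he <;>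
        simp [hd, he] at hγL ⊢
    by_cases hγL : γ ∈ L
    · exact ⟨⟨h1, fun _ => hγL⟩, ⟨fun hn => absurd hγL hn, fun hh => absurd ⟨h1 hγL, hh⟩ hnot⟩⟩
    · exact ⟨⟨fun hh => absurd hh hγL, fun hh => absurd ⟨hh, h2 hγL⟩ hnot⟩, ⟨h2, fun _ => hγL⟩⟩

/-! ### Polynomial functions in the complex coordinate -/

/-- The complex coordinate `z = x + i y`. -/
noncomputable def zc (u : Plane) : ℂ := (u 0 : ℂ) + u 1 * Complex.I

/-- The complex-valued function `p + i q`. -/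
noncomputable def cval (p q : Poly) (u : Plane) : ℂ :=
  (MvPolynomial.eval u p : ℂ) + (MvPolynomial.eval u q : ℝ) * Complex.I

theorem cval_re (p q : Poly) (u : Plane) : (cval p q u).re = MvPolynomial.eval u p := by
  simp [cval]

theorem cval_im (p q : Poly) (u : Plane) : (cval p q u).im = MvPolynomial.eval u q := by
  simp [cval]

theorem cval_mul (p q p' q' : Poly) (u : Plane) :
    cval p q u * cval p' q' u = cval (p * p' - q * q') (p * q' + q * p') u := by
  apply Complex.ext <;> simp [cval_re, cval_im]

theorem cval_add (p q p' q' : Poly) (u : Plane) :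
    cval p q u + cval p' q' u = cval (p + p') (q + q') u := by
  apply Complex.ext <;> simp [cval_re, cval_im]

theorem cval_conj (p q : Poly) (u : Plane) :
    (starRingEnd ℂ) (cval p q u) = cval p (-q) u := by
  apply Complex.ext <;> simp [cval_re, cval_im]

theorem zc_pow (k : ℕ) (u : Plane) : zc u ^ k = cval (reZ k) (imZ k) u := by
  have h := eval_powZ k u
  apply Complex.ext
  · rw [cval_re, h.1, zc]
  · rw [cval_im, h.2, zc]

theorem conj_zc_pow (k : ℕ) (u : Plane) :
    (starRingEnd ℂ) (zc u) ^ k = cval (reZ k) (-imZ k) u := by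
  rw [← map_pow, zc_pow, cval_conj]

theorem cval_inj {p q p' q' : Poly} :
    (∀ u, cval p q u = cval p' q' u) ↔ p = p' ∧ q = q' := by
  constructor
  · intro h
    constructor <;> apply MvPolynomial.funext <;> intro u
    · simpa [cval_re] using congrArg Complex.re (h u)
    · simpa [cval_im] using congrArg Complex.im (h u)
  · rintro ⟨rfl, rfl⟩ u; rfl

theorem zc_rot (θ : ℝ) (u : Plane) :
    zc ((rot θ).1 *ᵥ u) = Complex.exp (θ * Complex.I) * zc u := by
  rw [Complex.exp_mul_I, ← Complex.ofReal_cos, ← Complex.ofReal_sin]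
  simp only [zc, rot_val, Matrix.mulVec, dotProduct, Fin.sum_univ_two, Matrix.of_apply,
    Matrix.cons_val', Matrix.cons_val_zero, Matrix.cons_val_one, Matrix.cons_val_fin_one]
  apply Complex.ext <;> simp <;> ring

theorem zc_kx (u : Plane) : zc (kx.1 *ᵥ u) = (starRingEnd ℂ) (zc u) := by
  simp only [zc, kx_val, Matrix.mulVec, dotProduct, Fin.sum_univ_two, Matrix.of_apply,
    Matrix.cons_val', Matrix.cons_val_zero, Matrix.cons_val_one, Matrix.cons_val_fin_one]
  apply Complex.ext <;> simp

/-- The primitive `N`-th root of unity `exp (2 π i / N)`. -/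
noncomputable def zeta (N : ℕ) : ℂ := Complex.exp ((2 * Real.pi / N : ℝ) * Complex.I)

theorem isPrimitiveRoot_zeta {N : ℕ} (hN : N ≠ 0) : IsPrimitiveRoot (zeta N) N := by
  have := Complex.isPrimitiveRoot_exp N hN
  convert this using 1
  rw [zeta]; congr 1; push_cast; ring

theorem conj_exp_mul_I (θ : ℝ) :
    (starRingEnd ℂ) (Complex.exp (θ * Complex.I)) = (Complex.exp (θ * Complex.I))⁻¹ := by
  rw [← Complex.exp_conj, ← Complex.exp_neg]; simp

theorem zc_gen (N : ℕ) (u : Plane) :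
    zc ((rot (2 * Real.pi / N)).1 *ᵥ u) = zeta N * zc u := zc_rot _ u

theorem conj_zeta (N : ℕ) : (starRingEnd ℂ) (zeta N) = (zeta N)⁻¹ := conj_exp_mul_I _

theorem zeta_ne_zero (N : ℕ) : zeta N ≠ 0 := Complex.exp_ne_zero _

/-- The monomial `z ^ j * conj z ^ k`. -/
noncomputable def mono (i : ℕ × ℕ) (u : Plane) : ℂ := zc u ^ i.1 * (starRingEnd ℂ) (zc u) ^ i.2

/-- Real polynomials are combinations of the monomials in `z` and its conjugate. -/
theorem eval_mem_span (p : Poly) :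
    (fun u : Plane => (MvPolynomial.eval u p : ℂ)) ∈ Submodule.span ℂ (Set.range mono) := by
  set V := Submodule.span ℂ (Set.range mono) with hV
  have mulz : ∀ f ∈ V, (fun u => zc u * f u) ∈ V := by
    intro f hf
    induction hf using Submodule.span_induction with
    | mem f hf =>
      obtain ⟨i, rfl⟩ := hf
      refine Submodule.subset_span ⟨(i.1 + 1, i.2), ?_⟩
      funext u; simp [mono]; ring
    | zero => convert V.zero_mem using 1; funext u; simp
    | add f g _ _ hf hg =>
      convert V.add_mem hf hg using 1
      funext u; simp [mul_add]
    | smul a f _ hf =>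
      convert V.smul_mem a hf using 1
      funext u; simp; ring
  have mulzc : ∀ f ∈ V, (fun u => (starRingEnd ℂ) (zc u) * f u) ∈ V := by
    intro f hf
    induction hf using Submodule.span_induction with
    | mem f hf =>
      obtain ⟨i, rfl⟩ := hf
      refine Submodule.subset_span ⟨(i.1, i.2 + 1), ?_⟩
      funext u; simp [mono]; ring
    | zero => convert V.zero_mem using 1; funext u; simp
    | add f g _ _ hf hg =>
      convert V.add_mem hf hg using 1
      funext u; simp [mul_add]
    | smul a f _ hf =>
      convert V.smul_mem a hf using 1
      funext u; simp; ring
  induction p using MvPolynomial.induction_on with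
  | C a =>
    have : mono (0, 0) ∈ V := Submodule.subset_span ⟨_, rfl⟩
    convert V.smul_mem (a : ℂ) this using 1
    funext u; simp [mono]
  | add p q hp hq =>
    convert V.add_mem hp hq using 1
    funext u; simp
  | mul_X p i hp =>
    have h1 := mulz _ hp
    have h2 := mulzc _ hp
    fin_cases i
    · convert V.smul_mem (1 / 2 : ℂ) (V.add_mem h1 h2) using 1
      funext u; simp [zc]; ring
    · convert V.smul_mem (-Complex.I / 2 : ℂ) (V.sub_mem h1 h2) using 1
      funext u; simp [zc]; linear_combination ((MvPolynomial.eval u p : ℂ) * u 1) * Complex.I_sq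

theorem exists_expansion (p q : Poly) : ∃ (S : Finset (ℕ × ℕ)) (c : ℕ × ℕ → ℂ),
    ∀ u, cval p q u = ∑ i ∈ S, c i * mono i u := by
  have h : cval p q ∈ Submodule.span ℂ (Set.range mono) := by
    convert Submodule.add_mem _ (eval_mem_span p)
      (Submodule.smul_mem _ Complex.I (eval_mem_span q)) using 1
    funext u; simp [cval, mul_comm]
  obtain ⟨c, hc⟩ := Finsupp.mem_span_range_iff_exists_finsupp.1 h
  refine ⟨c.support, c, fun u => ?_⟩
  rw [← hc]
  simp [Finsupp.sum, Finset.sum_apply]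

theorem mono_gen {N : ℕ} (i : ℕ × ℕ) (u : Plane) :
    mono i ((rot (2 * Real.pi / N)).1 *ᵥ u) = zeta N ^ ((i.1 : ℤ) - i.2) * mono i u := by
  rw [mono, zc_gen, mono, map_mul, conj_zeta, mul_pow, mul_pow, zpow_sub₀ (zeta_ne_zero N),
    zpow_natCast, zpow_natCast, inv_pow]
  field_simp

theorem mono_kx (i : ℕ × ℕ) (u : Plane) : mono i (kx.1 *ᵥ u) = (starRingEnd ℂ) (mono i u) := by
  rw [mono, zc_kx, mono, map_mul, map_pow, map_pow]

theorem sum_zeta_zpow {N : ℕ} (hN : N ≠ 0) (a : ℤ) :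
    ∑ l ∈ Finset.range N, (zeta N ^ a) ^ l = if (N : ℤ) ∣ a then (N : ℂ) else 0 := by
  have hp := isPrimitiveRoot_zeta hN
  split_ifs with h
  · rw [(hp.zpow_eq_one_iff_dvd a).2 h]; simp
  · have h1 : zeta N ^ a ≠ 1 := fun h' => h ((hp.zpow_eq_one_iff_dvd a).1 h')
    rw [geom_sum_eq h1, ← zpow_natCast (zeta N ^ a), ← zpow_mul, mul_comm, zpow_mul, zpow_natCast,
      hp.pow_eq_one, one_zpow, sub_self, zero_div]

/-- In a function of type `ζ ^ r` under the rotation of order `N`, only the monomials of that type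
contribute: the others cancel in the average over the cyclic group. -/
theorem expansion_filter {N : ℕ} (hN : N ≠ 0) {f : Plane → ℂ} {S : Finset (ℕ × ℕ)}
    {c : ℕ × ℕ → ℂ} (hf : ∀ u, f u = ∑ i ∈ S, c i * mono i u) (r : ℕ)
    (h : ∀ u, f ((rot (2 * Real.pi / N)).1 *ᵥ u) = zeta N ^ r * f u) (u : Plane) :
    f u = ∑ i ∈ S with (N : ℤ) ∣ (i.1 : ℤ) - i.2 - r, c i * mono i u := by
  have hζ := zeta_ne_zero N
  have h1 : ∀ l : ℕ, ∑ i ∈ S, c i * mono i u * (zeta N ^ ((i.1 : ℤ) - i.2)) ^ l =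
      (zeta N ^ r) ^ l * f u := by
    intro l
    have h2 : ∀ l : ℕ, f (((rot (2 * Real.pi / N)) ^ l).1 *ᵥ u) = (zeta N ^ r) ^ l * f u := by
      intro l
      induction l with
      | zero => simp
      | succ l ih =>
        rw [pow_succ', Submonoid.coe_mul, ← Matrix.mulVec_mulVec, h, ih]; ring
    have h3 : ∀ (l : ℕ) i, mono i (((rot (2 * Real.pi / N)) ^ l).1 *ᵥ u) =
        (zeta N ^ ((i.1 : ℤ) - i.2)) ^ l * mono i u := by
      intro l i
      induction l with
      | zero => simp
      | succ l ih =>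
        rw [pow_succ', Submonoid.coe_mul, ← Matrix.mulVec_mulVec, mono_gen, ih]; ring
    rw [← h2 l, hf]
    refine Finset.sum_congr rfl fun i _ => ?_
    rw [h3]; ring
  have h4 : ∑ l ∈ Finset.range N, ∑ i ∈ S,
      c i * mono i u * (zeta N ^ ((i.1 : ℤ) - i.2 - r)) ^ l = N * f u := by
    have : ∀ l : ℕ, ∑ i ∈ S, c i * mono i u * (zeta N ^ ((i.1 : ℤ) - i.2 - r)) ^ l = f u := by
      intro l
      have h5 : (zeta N ^ r) ^ l ≠ 0 := pow_ne_zero _ (pow_ne_zero _ hζ)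
      apply mul_left_cancel₀ h5
      rw [← h1 l, Finset.mul_sum]
      refine Finset.sum_congr rfl fun i _ => ?_
      rw [zpow_sub₀ hζ _ (r : ℤ), zpow_natCast, div_pow]
      field_simp
    simp [this]
  rw [Finset.sum_comm] at h4
  simp_rw [← Finset.mul_sum, sum_zeta_zpow hN] at h4
  have hN' : (N : ℂ) ≠ 0 := by exact_mod_cast hN
  apply mul_left_cancel₀ hN'
  rw [← h4, Finset.sum_filter, Finset.mul_sum]
  refine Finset.sum_congr rfl fun i _ => ?_
  split_ifs <;> ring

/-- A function compatible with conjugation has an expansion with real coefficients. -/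
theorem expansion_real {f : Plane → ℂ} {S : Finset (ℕ × ℕ)} {c : ℕ × ℕ → ℂ}
    (hf : ∀ u, f u = ∑ i ∈ S, c i * mono i u)
    (h : ∀ u, f (kx.1 *ᵥ u) = (starRingEnd ℂ) (f u)) (u : Plane) :
    f u = ∑ i ∈ S, ((c i).re : ℂ) * mono i u := by
  have h1 : f u = ∑ i ∈ S, (starRingEnd ℂ) (c i) * mono i u := by
    have := congrArg (starRingEnd ℂ) (h u)
    rw [Complex.conj_conj] at this
    rw [← this, hf, map_sum]
    refine Finset.sum_congr rfl fun i _ => ?_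
    rw [map_mul, mono_kx, Complex.conj_conj]
  have h2 : (2 : ℂ) * f u = 2 * ∑ i ∈ S, ((c i).re : ℂ) * mono i u := by
    calc (2 : ℂ) * f u = f u + f u := two_mul _
      _ = ∑ i ∈ S, c i * mono i u + ∑ i ∈ S, (starRingEnd ℂ) (c i) * mono i u := by
        rw [← hf u, ← h1]
      _ = _ := by
        rw [← Finset.sum_add_distrib, Finset.mul_sum]
        refine Finset.sum_congr rfl fun i _ => ?_
        rw [← add_mul, Complex.add_conj]; push_cast; ring
  exact mul_left_cancel₀ two_ne_zero h2

/-! ### Invariant polynomials -/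

/-- The subgroup of the elements that leave a polynomial invariant. -/
def polyStabilizer (p : Poly) : Subgroup O2 where
  carrier := {γ | ∀ u : Plane, MvPolynomial.eval (γ.1 *ᵥ u) p = MvPolynomial.eval u p}
  one_mem' := fun u => by
    rw [Submonoid.coe_one, Matrix.one_mulVec]
  mul_mem' := fun {a b} ha hb u => by
    rw [Submonoid.coe_mul, ← Matrix.mulVec_mulVec, ha, hb]
  inv_mem' := fun {a} ha u => by
    rw [← ha, inv_val, Matrix.mulVec_mulVec, self_mul_transpose, Matrix.one_mulVec]

theorem mem_invariants_iff {Γ : Subgroup O2} {p : Poly} :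
    p ∈ invariants Γ ↔ Γ ≤ polyStabilizer p := Iff.rfl

theorem invariants_anti {Γ Γ' : Subgroup O2} (h : Γ ≤ Γ') : invariants Γ' ≤ invariants Γ :=
  fun _ hp γ hγ => hp γ (h hγ)

theorem mem_invariants_cyc {n : ℕ} {p : Poly} : p ∈ invariants (cyc n) ↔
    ∀ u : Plane, MvPolynomial.eval ((rot (2 * Real.pi / n)).1 *ᵥ u) p = MvPolynomial.eval u p := by
  rw [mem_invariants_iff, cyc, Subgroup.zpowers_le]; rfl

theorem mem_invariants_dih {n : ℕ} {p : Poly} : p ∈ invariants (dih n kx) ↔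
    (∀ u : Plane, MvPolynomial.eval ((rot (2 * Real.pi / n)).1 *ᵥ u) p = MvPolynomial.eval u p) ∧
    ∀ u : Plane, MvPolynomial.eval (kx.1 *ᵥ u) p = MvPolynomial.eval u p := by
  rw [mem_invariants_iff, dih, Subgroup.closure_le, Set.insert_subset_iff, Set.singleton_subset_iff]
  rfl

theorem normSq_mem_invariants (Γ : Subgroup O2) : x ^ 2 + y ^ 2 ∈ invariants Γ := by
  have : ∀ u : Plane, MvPolynomial.eval u (x ^ 2 + y ^ 2) = u ⬝ᵥ u := fun u => by
    simp [x, y, dotProduct, Fin.sum_univ_two]; ring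
  intro γ _ u
  rw [this, this, Matrix.dotProduct_mulVec, Matrix.vecMul_mulVec, transpose_mul_self,
    Matrix.vecMul_one]

theorem eval_normSq (u : Plane) :
    ((MvPolynomial.eval u (x ^ 2 + y ^ 2) : ℝ) : ℂ) = zc u * (starRingEnd ℂ) (zc u) := by
  rw [Complex.mul_conj, zc, Complex.normSq_add_mul_I]; simp [x, y]

theorem eval_reZ (k : ℕ) (u : Plane) :
    MvPolynomial.eval u (reZ k) = (zc u ^ k).re := by rw [zc_pow, cval_re]

theorem eval_imZ (k : ℕ) (u : Plane) :
    MvPolynomial.eval u (imZ k) = (zc u ^ k).im := by rw [zc_pow, cval_im]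

theorem reZ_mem_invariants {N : ℕ} (hN : N ≠ 0) : reZ N ∈ invariants (dih N kx) := by
  rw [mem_invariants_dih]
  constructor <;> intro u <;> rw [eval_reZ, eval_reZ]
  · rw [zc_gen, mul_pow, (isPrimitiveRoot_zeta hN).pow_eq_one, one_mul]
  · rw [zc_kx, ← map_pow, Complex.conj_re]

/-! ### Generators of the modules of relative invariants -/

/-- The combinations of `z ^ r` and `conj z ^ s` with coefficients in the invariants of `D_N`. -/
def dihModule (N r s : ℕ) : Submodule ℝ (Plane → ℂ) where
  carrier := {f | ∃ p ∈ invariants (dih N kx), ∃ q ∈ invariants (dih N kx), ∀ u,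
    f u = MvPolynomial.eval u p * zc u ^ r +
      (MvPolynomial.eval u q : ℝ) * (starRingEnd ℂ) (zc u) ^ s}
  zero_mem' := ⟨0, zero_mem _, 0, zero_mem _, fun u => by simp⟩
  add_mem' := by
    rintro f g ⟨p, hp, q, hq, h⟩ ⟨p', hp', q', hq', h'⟩
    refine ⟨p + p', add_mem hp hp', q + q', add_mem hq hq', fun u => ?_⟩
    simp [h, h']; ring
  smul_mem' := by
    rintro a f ⟨p, hp, q, hq, h⟩
    refine ⟨a • p, Subalgebra.smul_mem _ hp a, a • q, Subalgebra.smul_mem _ hq a, fun u => ?_⟩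
    simp [h, MvPolynomial.smul_eval]; ring

theorem dihModule_mul_normSq {N r s : ℕ} {f : Plane → ℂ} (hf : f ∈ dihModule N r s) :
    (fun u => zc u * (starRingEnd ℂ) (zc u) * f u) ∈ dihModule N r s := by
  obtain ⟨p, hp, q, hq, h⟩ := hf
  have hn := normSq_mem_invariants (dih N kx)
  refine ⟨(x ^ 2 + y ^ 2) * p, mul_mem hn hp, (x ^ 2 + y ^ 2) * q, mul_mem hn hq, fun u => ?_⟩
  rw [map_mul, map_mul, Complex.ofReal_mul, Complex.ofReal_mul, eval_normSq]
  simp only [h]; ring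

theorem two_reZ (N : ℕ) (u : Plane) : ((MvPolynomial.eval u (2 * reZ N) : ℝ) : ℂ) =
    zc u ^ N + (starRingEnd ℂ) (zc u) ^ N := by
  rw [← map_pow, Complex.add_conj, map_mul, eval_reZ]; simp

theorem eval_normSq_pow (k : ℕ) (u : Plane) :
    ((MvPolynomial.eval u ((x ^ 2 + y ^ 2) ^ k) : ℝ) : ℂ) =
      zc u ^ k * (starRingEnd ℂ) (zc u) ^ k := by
  rw [map_pow, Complex.ofReal_pow, eval_normSq, mul_pow]

/-- Although `z ^ N` is not invariant under `D_N`, the module is stable under it. -/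
theorem dihModule_mul_pow {N r s : ℕ} (hN : N ≠ 0) (hrs : r + s = N) {f : Plane → ℂ}
    (hf : f ∈ dihModule N r s) : (fun u => zc u ^ N * f u) ∈ dihModule N r s := by
  obtain ⟨p, hp, q, hq, h⟩ := hf
  have hn := normSq_mem_invariants (dih N kx)
  have hR : 2 * reZ N ∈ invariants (dih N kx) :=
    mul_mem (ofNat_mem _ 2) (reZ_mem_invariants hN)
  -- `z ^ N = 2 Re (z ^ N) - conj z ^ N`, and `z ^ r * conj z ^ N` is a multiple of `conj z ^ s`
  refine ⟨2 * reZ N * p + (x ^ 2 + y ^ 2) ^ s * q,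
    add_mem (mul_mem hR hp) (mul_mem (pow_mem hn s) hq),
    -((x ^ 2 + y ^ 2) ^ r * p), neg_mem (mul_mem (pow_mem hn r) hp), fun u => ?_⟩
  rw [map_add, map_neg, map_mul, map_mul _ ((x ^ 2 + y ^ 2) ^ s), map_mul _ ((x ^ 2 + y ^ 2) ^ r),
    Complex.ofReal_add, Complex.ofReal_neg, Complex.ofReal_mul, Complex.ofReal_mul,
    Complex.ofReal_mul, two_reZ, eval_normSq_pow, eval_normSq_pow]
  simp only [h, ← hrs]
  ring

theorem dihModule_mul_conj_pow {N r s : ℕ} (hN : N ≠ 0) (hrs : r + s = N) {f : Plane → ℂ}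
    (hf : f ∈ dihModule N r s) :
    (fun u => (starRingEnd ℂ) (zc u) ^ N * f u) ∈ dihModule N r s := by
  obtain ⟨p, hp, q, hq, h⟩ := hf
  have hn := normSq_mem_invariants (dih N kx)
  have hR : 2 * reZ N ∈ invariants (dih N kx) :=
    mul_mem (ofNat_mem _ 2) (reZ_mem_invariants hN)
  refine ⟨-((x ^ 2 + y ^ 2) ^ s * q), neg_mem (mul_mem (pow_mem hn s) hq),
    2 * reZ N * q + (x ^ 2 + y ^ 2) ^ r * p,
    add_mem (mul_mem hR hq) (mul_mem (pow_mem hn r) hp), fun u => ?_⟩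
  rw [map_add, map_neg, map_mul, map_mul _ (2 * reZ N), map_mul _ ((x ^ 2 + y ^ 2) ^ r),
    Complex.ofReal_add, Complex.ofReal_neg, Complex.ofReal_mul, Complex.ofReal_mul,
    Complex.ofReal_mul, two_reZ, eval_normSq_pow, eval_normSq_pow]
  simp only [h, ← hrs]
  ring

/-- Multiplication by a monomial that is invariant under the rotation of order `N`. -/
theorem dihModule_mul_mono {N r s : ℕ} (hN : N ≠ 0) (hrs : r + s = N) {f : Plane → ℂ}
    (hf : f ∈ dihModule N r s) (j k : ℕ) (h : (N : ℤ) ∣ (j : ℤ) - k) :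
    (fun u => mono (j, k) u * f u) ∈ dihModule N r s := by
  have h1 : ∀ t : ℕ, (fun u => (zc u * (starRingEnd ℂ) (zc u)) ^ t * f u) ∈ dihModule N r s := by
    intro t
    induction t with
    | zero => simpa using hf
    | succ t ih =>
      convert dihModule_mul_normSq ih using 2
      ring
  obtain ⟨l, hl⟩ := h
  rcases Int.eq_nat_or_neg l with ⟨l, rfl | rfl⟩
  · have hj : j = k + N * l := by zify; linarith
    have h2 : ∀ l : ℕ, (fun u => (zc u ^ N) ^ l *
        ((zc u * (starRingEnd ℂ) (zc u)) ^ k * f u)) ∈ dihModule N r s := by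
      intro l
      induction l with
      | zero => simpa using h1 k
      | succ l ih =>
        convert dihModule_mul_pow hN hrs ih using 2
        ring
    convert h2 l using 2
    rw [mono, hj]; ring
  · have hk : k = j + N * l := by zify; linarith
    have h2 : ∀ l : ℕ, (fun u => ((starRingEnd ℂ) (zc u) ^ N) ^ l *
        ((zc u * (starRingEnd ℂ) (zc u)) ^ j * f u)) ∈ dihModule N r s := by
      intro l
      induction l with
      | zero => simpa using h1 j
      | succ l ih =>
        convert dihModule_mul_conj_pow hN hrs ih using 2
        ring
    convert h2 l using 2
    rw [mono, hk]; ring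

/-- A monomial of type `ζ ^ r` is an invariant monomial times `z ^ r` or `conj z ^ s`. -/
theorem mono_mem_dihModule {N r s : ℕ} (hN : N ≠ 0) (hrs : r + s = N) (j k : ℕ)
    (h : (N : ℤ) ∣ (j : ℤ) - k - r) : mono (j, k) ∈ dihModule N r s := by
  by_cases hj : r ≤ j
  · obtain ⟨j, rfl⟩ := Nat.exists_eq_add_of_le hj
    have h0 : (fun u => zc u ^ r) ∈ dihModule N r s :=
      ⟨1, one_mem _, 0, zero_mem _, fun u => by simp⟩
    convert dihModule_mul_mono hN hrs h0 j k (by convert h using 1; push_cast; ring) using 1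
    funext u; simp only [mono]; ring
  · -- here `k ≡ j + s` modulo `N` and `j + s < N`, so that `k ≥ j + s`
    have hk : s ≤ k := by
      by_contra hlt
      have h2 : (N : ℤ) ∣ (j : ℤ) - k + s := by
        have : (j : ℤ) - k + s = ((j : ℤ) - k - r) + N := by rw [← hrs]; push_cast; ring
        rw [this]; exact dvd_add h (dvd_refl _)
      have h3 := Int.le_of_dvd (by omega) h2
      omega
    obtain ⟨k, rfl⟩ := Nat.exists_eq_add_of_le hk
    have h0 : (fun u => (starRingEnd ℂ) (zc u) ^ s) ∈ dihModule N r s :=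
      ⟨0, zero_mem _, 1, one_mem _, fun u => by simp⟩
    convert dihModule_mul_mono hN hrs h0 j k (by
      have : (j : ℤ) - k = ((j : ℤ) - (s + k : ℕ) - r) + N := by rw [← hrs]; push_cast; ring
      rw [this]; exact dvd_add h (dvd_refl _)) using 1
    funext u; simp only [mono]; ring

/-- The polynomial functions of type `ζ ^ r` under the rotation of order `N` that commute with
complex conjugation form the module over the invariants of `D_N` generated by `z ^ r` and
`conj z ^ s`, where `r + s = N`. -/
theorem dih_decomposition {N r s : ℕ} (hN : N ≠ 0) (hrs : r + s = N) {p q : Poly}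
    (hrot : ∀ u, cval p q ((rot (2 * Real.pi / N)).1 *ᵥ u) = zeta N ^ r * cval p q u)
    (hkx : ∀ u, cval p q (kx.1 *ᵥ u) = (starRingEnd ℂ) (cval p q u)) :
    ∃ p₁ p₂ : invariants (dih N kx), ∀ u, cval p q u =
      cval p₁ 0 u * zc u ^ r + cval p₂ 0 u * (starRingEnd ℂ) (zc u) ^ s := by
  obtain ⟨S, c, h⟩ := exists_expansion p q
  have h2 := expansion_real (expansion_filter hN h r hrot) hkx
  have h3 : cval p q ∈ dihModule N r s := by
    have : cval p q = ∑ i ∈ S with (N : ℤ) ∣ (i.1 : ℤ) - i.2 - r, (c i).re • mono i := by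
      funext u; rw [h2, Finset.sum_apply]
      refine Finset.sum_congr rfl fun i _ => ?_
      simp
    rw [this]
    refine Submodule.sum_mem _ fun i hi => Submodule.smul_mem _ _ ?_
    exact mono_mem_dihModule hN hrs i.1 i.2 (Finset.mem_filter.1 hi).2
  obtain ⟨p₁, h₁, p₂, h₂, h4⟩ := h3
  exact ⟨⟨p₁, h₁⟩, ⟨p₂, h₂⟩, fun u => by rw [h4]; simp [cval]⟩

/-! ### Parts of a polynomial function compatible with conjugation -/

/-- The polynomial `u ↦ p (A u)`. -/
noncomputable def substPoly (A : Matrix (Fin 2) (Fin 2) ℝ) (p : Poly) : Poly :=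
  MvPolynomial.bind₁ (fun i => ∑ j, MvPolynomial.C (A i j) * MvPolynomial.X j) p

theorem eval_substPoly (A : Matrix (Fin 2) (Fin 2) ℝ) (p : Poly) (u : Plane) :
    MvPolynomial.eval u (substPoly A p) = MvPolynomial.eval (A *ᵥ u) p := by
  induction p using MvPolynomial.induction_on with
  | C a => simp [substPoly]
  | add p q hp hq => rw [substPoly, map_add, map_add, map_add, ← substPoly, ← substPoly, hp, hq]
  | mul_X p i hp =>
    rw [substPoly, map_mul, map_mul, map_mul, ← substPoly, hp, MvPolynomial.bind₁_X_right,
      MvPolynomial.eval_X]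
    simp only [map_sum, map_mul, MvPolynomial.eval_C, MvPolynomial.eval_X]
    rfl

theorem conj_eq_inv_exp_pow (θ : ℝ) (r : ℕ) :
    (starRingEnd ℂ) (Complex.exp (θ * Complex.I) ^ r) = (Complex.exp (θ * Complex.I) ^ r)⁻¹ := by
  rw [map_pow, conj_exp_mul_I, inv_pow]

/-- Every complex polynomial function is `f₁ + i f₂` with `f₁` and `f₂` compatible with
conjugation; the parts inherit the type under rotations. -/
theorem exists_conj_parts (p q : Poly) : ∃ p₁ q₁ p₂ q₂ : Poly,
    (∀ u, cval p q u = cval p₁ q₁ u + Complex.I * cval p₂ q₂ u) ∧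
    (∀ u, cval p₁ q₁ (kx.1 *ᵥ u) = (starRingEnd ℂ) (cval p₁ q₁ u)) ∧
    (∀ u, cval p₂ q₂ (kx.1 *ᵥ u) = (starRingEnd ℂ) (cval p₂ q₂ u)) ∧
    ∀ (θ : ℝ) (r : ℕ),
      (∀ u, cval p q ((rot θ).1 *ᵥ u) = Complex.exp (θ * Complex.I) ^ r * cval p q u) →
      (∀ u, cval p₁ q₁ ((rot θ).1 *ᵥ u) = Complex.exp (θ * Complex.I) ^ r * cval p₁ q₁ u) ∧
      (∀ u, cval p₂ q₂ ((rot θ).1 *ᵥ u) = Complex.exp (θ * Complex.I) ^ r * cval p₂ q₂ u) := by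
  set h : Poly := MvPolynomial.C (1 / 2) with hh
  have hh' : ∀ u, MvPolynomial.eval u h = 1 / 2 := fun u => by simp [hh]
  set f : Plane → ℂ := cval p q with hf
  have e1 : ∀ u, cval (h * (p + substPoly kx.1 p)) (h * (q - substPoly kx.1 q)) u =
      1 / 2 * (f u + (starRingEnd ℂ) (f (kx.1 *ᵥ u))) := by
    intro u
    apply Complex.ext <;> simp [cval_re, cval_im, hh', eval_substPoly, hf]; ring
  have e2 : ∀ u, cval (h * (q + substPoly kx.1 q)) (h * (substPoly kx.1 p - p)) u =
      -Complex.I / 2 * (f u - (starRingEnd ℂ) (f (kx.1 *ᵥ u))) := by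
    intro u
    apply Complex.ext <;> simp [cval_re, cval_im, hh', eval_substPoly, hf] <;> ring
  have kk : ∀ u, kx.1 *ᵥ (kx.1 *ᵥ u) = u := by
    intro u
    rw [Matrix.mulVec_mulVec, ← Submonoid.coe_mul, kx_mul_kx, Submonoid.coe_one, Matrix.one_mulVec]
  refine ⟨h * (p + substPoly kx.1 p), h * (q - substPoly kx.1 q), h * (q + substPoly kx.1 q),
    h * (substPoly kx.1 p - p), fun u => ?_, fun u => ?_, fun u => ?_, fun θ r hr => ?_⟩
  · rw [e1, e2]
    linear_combination (1 / 2 * ((starRingEnd ℂ) (f (kx.1 *ᵥ u)) - f u)) * (-Complex.I_sq)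
  · rw [e1, e1, kk, map_mul, map_add, Complex.conj_conj]
    simp only [map_div₀, map_one, map_ofNat]; ring
  · rw [e2, e2, kk, map_mul, map_sub, Complex.conj_conj]
    simp only [map_div₀, map_ofNat, map_neg, Complex.conj_I]; ring
  · have hne := pow_ne_zero r (Complex.exp_ne_zero (θ * Complex.I))
    have hc : ∀ u, (starRingEnd ℂ) (f (kx.1 *ᵥ ((rot θ).1 *ᵥ u))) =
        Complex.exp (θ * Complex.I) ^ r * (starRingEnd ℂ) (f (kx.1 *ᵥ u)) := by
      intro u
      have h1 : (rot θ).1 *ᵥ (kx.1 *ᵥ ((rot θ).1 *ᵥ u)) = kx.1 *ᵥ u := by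
        have h0 : rot θ * kx * rot θ = kx := by
          rw [mul_assoc, kx_mul_rot, ← mul_assoc, ← rot_add, add_neg_cancel, rot_zero, one_mul]
        rw [Matrix.mulVec_mulVec, Matrix.mulVec_mulVec]
        exact congrArg (fun γ : O2 => γ.1 *ᵥ u) h0
      have h2 := hr (kx.1 *ᵥ ((rot θ).1 *ᵥ u))
      rw [h1] at h2
      rw [h2, map_mul, conj_eq_inv_exp_pow, mul_inv_cancel_left₀ hne]
    constructor <;> intro u
    · rw [e1, e1, hr, hc]; ring
    · rw [e2, e2, hr, hc]; ring

/-! ### Relative invariants of the cyclic, dihedral and full groups -/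

theorem eval_of_mem {Γ : Subgroup O2} (p : invariants Γ) {γ : O2} (hγ : γ ∈ Γ) (u : Plane) :
    MvPolynomial.eval (γ.1 *ᵥ u) (p : Poly) = MvPolynomial.eval u (p : Poly) := p.2 γ hγ u

theorem cval_of_mem {Γ : Subgroup O2} (p q : invariants Γ) {γ : O2} (hγ : γ ∈ Γ) (u : Plane) :
    cval p q (γ.1 *ᵥ u) = cval p q u := by
  rw [cval, eval_of_mem p hγ, eval_of_mem q hγ, cval]

theorem cval_zero_of_mem {Γ : Subgroup O2} (p : invariants Γ) {γ : O2} (hγ : γ ∈ Γ) (u : Plane) :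
    cval p 0 (γ.1 *ᵥ u) = cval p 0 u := by
  rw [cval, eval_of_mem p hγ, cval]; simp

theorem conj_zeta_pow {N r s : ℕ} (hN : N ≠ 0) (hrs : r + s = N) :
    (starRingEnd ℂ) (zeta N) ^ s = zeta N ^ r := by
  rw [conj_zeta, inv_pow]
  apply inv_eq_of_mul_eq_one_left
  rw [← pow_add, hrs, (isPrimitiveRoot_zeta hN).pow_eq_one]

/-- The polynomials `w`, `b` for which `w + i b` has type `ζ ^ r` under the rotation of order `N`
and is conjugated by `κ_x`: the real and imaginary parts of `p z ^ r + p' conj z ^ s`. -/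
theorem dih_iff {N r s : ℕ} (hN : N ≠ 0) (hrs : r + s = N) {w b : Poly} :
    ((∀ u, cval w b ((rot (2 * Real.pi / N)).1 *ᵥ u) = zeta N ^ r * cval w b u) ∧
      ∀ u, cval w b (kx.1 *ᵥ u) = (starRingEnd ℂ) (cval w b u)) ↔
    ∃ p p' : invariants (dih N kx), w = p * reZ r + p' * reZ s ∧ b = p * imZ r - p' * imZ s := by
  have key : ∀ (p p' : invariants (dih N kx)) (u : Plane),
      cval p 0 u * zc u ^ r + cval p' 0 u * (starRingEnd ℂ) (zc u) ^ s =
        cval (p * reZ r + p' * reZ s) (p * imZ r - p' * imZ s) u := by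
    intro p p' u
    rw [zc_pow, conj_zc_pow, cval_mul, cval_mul, cval_add]
    congr 1 <;> ring
  constructor
  · rintro ⟨h1, h2⟩
    obtain ⟨p, p', h⟩ := dih_decomposition hN hrs h1 h2
    refine ⟨p, p', cval_inj.1 fun u => ?_⟩
    rw [h, key]
  · rintro ⟨p, p', rfl, rfl⟩
    constructor
    · intro u
      rw [← key, ← key, cval_zero_of_mem p (gen_mem_dih N kx),
        cval_zero_of_mem p' (gen_mem_dih N kx), zc_gen, map_mul, mul_pow, mul_pow,
        conj_zeta_pow hN hrs]
      ring
    · intro u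
      rw [← key, ← key, cval_zero_of_mem p (refl_mem_dih N kx),
        cval_zero_of_mem p' (refl_mem_dih N kx), zc_kx]
      simp [cval]

/-- Without a condition under `κ_x` the generators are `z ^ r`, `i z ^ r`, `conj z ^ s` and
`i conj z ^ s`. -/
theorem cyc_iff {N r s : ℕ} (hN : N ≠ 0) (hrs : r + s = N) {w b : Poly} :
    (∀ u, cval w b ((rot (2 * Real.pi / N)).1 *ᵥ u) = zeta N ^ r * cval w b u) ↔
    ∃ p q p' q' : invariants (cyc N),
      w = p * reZ r - q * imZ r + (p' * reZ s + q' * imZ s) ∧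
      b = p * imZ r + q * reZ r + (q' * reZ s - p' * imZ s) := by
  have key : ∀ (p q p' q' : invariants (cyc N)) (u : Plane),
      cval p q u * zc u ^ r + cval p' q' u * (starRingEnd ℂ) (zc u) ^ s =
        cval (p * reZ r - q * imZ r + (p' * reZ s + q' * imZ s))
          (p * imZ r + q * reZ r + (q' * reZ s - p' * imZ s)) u := by
    intro p q p' q' u
    rw [zc_pow, conj_zc_pow, cval_mul, cval_mul, cval_add]
    congr 1 <;> ring
  constructor
  · intro h
    obtain ⟨p₁, q₁, p₂, q₂, h0, h1, h2, h3⟩ := exists_conj_parts w b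
    obtain ⟨h4, h5⟩ := h3 (2 * Real.pi / N) r h
    obtain ⟨p, p', hp⟩ := dih_decomposition hN hrs h4 h1
    obtain ⟨q, q', hq⟩ := dih_decomposition hN hrs h5 h2
    have hle := invariants_anti (cyc_le_dih N kx)
    refine ⟨⟨p, hle p.2⟩, ⟨q, hle q.2⟩, ⟨p', hle p'.2⟩, ⟨q', hle q'.2⟩, cval_inj.1 fun u => ?_⟩
    rw [← key, h0, hp, hq]
    simp [cval]; ring
  · rintro ⟨p, q, p', q', rfl, rfl⟩ u
    rw [← key, ← key, cval_of_mem p q (gen_mem_cyc N), cval_of_mem p' q' (gen_mem_cyc N), zc_gen,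
      map_mul, mul_pow, mul_pow, conj_zeta_pow hN hrs]
    ring

/-- Polynomial functions of type `r` under all rotations have only monomials
`z ^ (k + r) * conj z ^ k`, as one sees on a rotation of order exceeding the degree. -/
theorem o2_decomposition {r : ℕ} {w b : Poly}
    (hrot : ∀ (θ : ℝ) u, cval w b ((rot θ).1 *ᵥ u) =
      Complex.exp (θ * Complex.I) ^ r * cval w b u)
    (hkx : ∀ u, cval w b (kx.1 *ᵥ u) = (starRingEnd ℂ) (cval w b u)) :
    ∃ p : invariants ⊤, ∀ u, cval w b u = cval p 0 u * zc u ^ r := by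
  obtain ⟨S, c, h⟩ := exists_expansion w b
  set N := S.sup (fun i => i.1 + i.2) + r + 1 with hN
  have h2 := expansion_real (expansion_filter (N := N) (by omega) h r
    (fun u => hrot (2 * Real.pi / N) u)) hkx
  set S' := S.filter fun i => (N : ℤ) ∣ (i.1 : ℤ) - i.2 - r with hS'
  have hi : ∀ i ∈ S', i.1 = i.2 + r := by
    intro i hi
    obtain ⟨hi, hd⟩ := Finset.mem_filter.1 hi
    have hle : i.1 + i.2 ≤ S.sup (fun i => i.1 + i.2) :=
      Finset.le_sup (f := fun i : ℕ × ℕ => i.1 + i.2) hi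
    have := Int.eq_zero_of_abs_lt_dvd hd (by rw [abs_lt]; constructor <;> omega)
    omega
  refine ⟨⟨∑ i ∈ S', (c i).re • (x ^ 2 + y ^ 2) ^ i.2, Subalgebra.sum_mem _ fun i _ =>
    Subalgebra.smul_mem _ (Subalgebra.pow_mem _ (normSq_mem_invariants _) _) _⟩, fun u => ?_⟩
  rw [h2, cval, map_sum, Complex.ofReal_sum]
  simp only [map_zero, Complex.ofReal_zero, zero_mul, add_zero]
  rw [Finset.sum_mul]
  refine Finset.sum_congr rfl fun i hi' => ?_
  rw [MvPolynomial.smul_eval, Complex.ofReal_mul, eval_normSq_pow, mono, hi i hi']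
  ring

/-- The analogue of `dih_iff` for all rotations: only the generator `z ^ r` is left. -/
theorem o2_iff {r : ℕ} {w b : Poly} :
    ((∀ (θ : ℝ) u, cval w b ((rot θ).1 *ᵥ u) = Complex.exp (θ * Complex.I) ^ r * cval w b u) ∧
      ∀ u, cval w b (kx.1 *ᵥ u) = (starRingEnd ℂ) (cval w b u)) ↔
    ∃ p : invariants ⊤, w = p * reZ r ∧ b = p * imZ r := by
  have key : ∀ (p : invariants ⊤) (u : Plane),
      cval p 0 u * zc u ^ r = cval (p * reZ r) (p * imZ r) u := by
    intro p u
    rw [zc_pow, cval_mul]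
    congr 1 <;> ring
  constructor
  · rintro ⟨h1, h2⟩
    obtain ⟨p, h⟩ := o2_decomposition h1 h2
    refine ⟨p, cval_inj.1 fun u => ?_⟩
    rw [h, key]
  · rintro ⟨p, rfl, rfl⟩
    constructor
    · intro θ u
      rw [← key, ← key, cval_zero_of_mem p (Subgroup.mem_top _), zc_rot, mul_pow]
      ring
    · intro u
      rw [← key, ← key, cval_zero_of_mem p (Subgroup.mem_top _), zc_kx]
      simp [cval]

/-- The analogue of `cyc_iff` for all rotations: the generators are `z ^ r` and `i z ^ r`. -/
theorem so2_iff {r : ℕ} {w b : Poly} :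
    (∀ (θ : ℝ) u, cval w b ((rot θ).1 *ᵥ u) = Complex.exp (θ * Complex.I) ^ r * cval w b u) ↔
    ∃ p q : invariants SO2, w = p * reZ r - q * imZ r ∧ b = p * imZ r + q * reZ r := by
  have key : ∀ (p q : invariants SO2) (u : Plane),
      cval p q u * zc u ^ r = cval (p * reZ r - q * imZ r) (p * imZ r + q * reZ r) u := by
    intro p q u
    rw [zc_pow, cval_mul]
  constructor
  · intro h
    obtain ⟨p₁, q₁, p₂, q₂, h0, h1, h2, h3⟩ := exists_conj_parts w b
    obtain ⟨p, hp⟩ := o2_decomposition (fun θ => (h3 θ r (h θ)).1) h1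
    obtain ⟨q, hq⟩ := o2_decomposition (fun θ => (h3 θ r (h θ)).2) h2
    have hle := invariants_anti (le_top : SO2 ≤ ⊤)
    refine ⟨⟨p, hle p.2⟩, ⟨q, hle q.2⟩, cval_inj.1 fun u => ?_⟩
    rw [← key, h0, hp, hq]
    simp [cval]; ring
  · rintro ⟨p, q, rfl, rfl⟩ θ u
    rw [← key, ← key, cval_of_mem p q (rot_mem_SO2 θ), zc_rot, mul_pow]
    ring

theorem cval_neg_left (w b : Poly) (u : Plane) : cval (-b) w u = Complex.I * cval w b u := by
  apply Complex.ext <;> simp [cval_re, cval_im]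

/-- Multiplication by `i` exchanges the two signs under conjugation. -/
theorem mul_I_conj_iff {w b : Poly} :
    (∀ u, cval (-b) w (kx.1 *ᵥ u) = (starRingEnd ℂ) (cval (-b) w u)) ↔
      ∀ u, cval w b (kx.1 *ᵥ u) = -(starRingEnd ℂ) (cval w b u) := by
  refine forall_congr' fun u => ?_
  rw [cval_neg_left, cval_neg_left, map_mul, Complex.conj_I, neg_mul, ← mul_neg]
  exact mul_right_inj' Complex.I_ne_zero

theorem mul_I_rot_iff {w b : Poly} (γ : O2) (χ : ℂ) :
    (∀ u, cval (-b) w (γ.1 *ᵥ u) = χ * cval (-b) w u) ↔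
      ∀ u, cval w b (γ.1 *ᵥ u) = χ * cval w b u := by
  refine forall_congr' fun u => ?_
  rw [cval_neg_left, cval_neg_left, mul_left_comm]
  exact mul_right_inj' Complex.I_ne_zero

theorem zeta_half {m : ℕ} (hm : m ≠ 0) : zeta (2 * m) ^ m = -1 := by
  have h := (isPrimitiveRoot_zeta (N := 2 * m) (by omega))
  have h2 : (zeta (2 * m) ^ m) ^ 2 = 1 := by rw [← pow_mul, mul_comm m, h.pow_eq_one]
  exact (mul_self_eq_one_iff.1 ((sq _).symm.trans h2)).resolve_left
    (h.pow_ne_one_of_pos_of_lt hm (by omega))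

/-- Polynomials invariant under the rotation of order `N` and odd under `κ_x` are imaginary parts of
functions of type `ζ ^ N = 1`. -/
theorem anti_iff {N : ℕ} (hN : N ≠ 0) {t : Poly} :
    ((∀ u, MvPolynomial.eval ((rot (2 * Real.pi / N)).1 *ᵥ u) t = MvPolynomial.eval u t) ∧
      ∀ u, MvPolynomial.eval (kx.1 *ᵥ u) t = -MvPolynomial.eval u t) ↔
    ∃ p : invariants (dih N kx), t = imZ N * p := by
  constructor
  · rintro ⟨h1, h2⟩
    obtain ⟨p, p', -, h⟩ := (dih_iff (r := N) (s := 0) hN (add_zero N) (w := 0) (b := t)).1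
      ⟨fun u => by rw [(isPrimitiveRoot_zeta hN).pow_eq_one]; simp only [cval, h1]; simp,
        fun u => by simp only [cval, h2]; simp⟩
    exact ⟨p, by rw [h, show imZ 0 = 0 from rfl]; ring⟩
  · rintro ⟨p, rfl⟩
    constructor <;> intro u
    · rw [map_mul, map_mul, eval_of_mem p (gen_mem_dih N kx), eval_imZ, eval_imZ, zc_gen, mul_pow,
        (isPrimitiveRoot_zeta hN).pow_eq_one, one_mul]
    · rw [map_mul, map_mul, eval_of_mem p (refl_mem_dih N kx), eval_imZ, eval_imZ, zc_kx,
        ← map_pow, Complex.conj_im]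
      ring

/-- A function of type `ζ ^ m` under the rotation of order `2 m` changes sign, since
`ζ ^ m = -1`. -/
theorem half_iff {m : ℕ} (hm : m ≠ 0) {t : Poly} :
    ((∀ u, MvPolynomial.eval ((rot (2 * Real.pi / (2 * m : ℕ))).1 *ᵥ u) t =
        -MvPolynomial.eval u t) ∧
      ∀ u, MvPolynomial.eval (kx.1 *ᵥ u) t = MvPolynomial.eval u t) ↔
    ∃ p : invariants (dih (2 * m) kx), t = reZ m * p := by
  have hN : 2 * m ≠ 0 := by omega
  constructor
  · rintro ⟨h1, h2⟩
    obtain ⟨p, p', h, -⟩ := (dih_iff (r := m) (s := m) hN (by ring) (w := t) (b := 0)).1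
      ⟨fun u => by rw [zeta_half hm]; simp only [cval, h1]; simp,
        fun u => by simp only [cval, h2]; simp⟩
    exact ⟨p + p', by rw [h]; push_cast; ring⟩
  · rintro ⟨p, rfl⟩
    constructor <;> intro u
    · rw [map_mul, map_mul, eval_of_mem p (gen_mem_dih _ kx), eval_reZ, eval_reZ, zc_gen, mul_pow,
        zeta_half hm]
      simp
    · rw [map_mul, map_mul, eval_of_mem p (refl_mem_dih _ kx), eval_reZ, eval_reZ, zc_kx,
        ← map_pow, Complex.conj_re]

theorem half_anti_iff {m : ℕ} (hm : m ≠ 0) {t : Poly} :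
    ((∀ u, MvPolynomial.eval ((rot (2 * Real.pi / (2 * m : ℕ))).1 *ᵥ u) t =
        -MvPolynomial.eval u t) ∧
      ∀ u, MvPolynomial.eval (kx.1 *ᵥ u) t = -MvPolynomial.eval u t) ↔
    ∃ p : invariants (dih (2 * m) kx), t = imZ m * p := by
  have hN : 2 * m ≠ 0 := by omega
  constructor
  · rintro ⟨h1, h2⟩
    obtain ⟨p, p', -, h⟩ := (dih_iff (r := m) (s := m) hN (by ring) (w := 0) (b := t)).1
      ⟨fun u => by rw [zeta_half hm]; simp only [cval, h1]; simp,
        fun u => by simp only [cval, h2]; simp⟩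
    exact ⟨p - p', by rw [h]; push_cast; ring⟩
  · rintro ⟨p, rfl⟩
    constructor <;> intro u
    · rw [map_mul, map_mul, eval_of_mem p (gen_mem_dih _ kx), eval_imZ, eval_imZ, zc_gen, mul_pow,
        zeta_half hm]
      simp
    · rw [map_mul, map_mul, eval_of_mem p (refl_mem_dih _ kx), eval_imZ, eval_imZ, zc_kx,
        ← map_pow, Complex.conj_im]
      ring

theorem half_cyc_iff {m : ℕ} (hm : m ≠ 0) {t : Poly} :
    (∀ u, MvPolynomial.eval ((rot (2 * Real.pi / (2 * m : ℕ))).1 *ᵥ u) t =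
        -MvPolynomial.eval u t) ↔
    ∃ p q : invariants (cyc (2 * m)), t = reZ m * p + imZ m * q := by
  have hN : 2 * m ≠ 0 := by omega
  constructor
  · intro h1
    obtain ⟨p, q, p', q', h, -⟩ := (cyc_iff (r := m) (s := m) hN (by ring) (w := t) (b := 0)).1
      fun u => by rw [zeta_half hm]; simp only [cval, h1]; simp
    exact ⟨p + p', q' - q, by rw [h]; push_cast; ring⟩
  · rintro ⟨p, q, rfl⟩ u
    rw [map_add, map_add, map_mul, map_mul, map_mul, map_mul, eval_of_mem p (gen_mem_cyc _),
      eval_of_mem q (gen_mem_cyc _), eval_imZ, eval_imZ, eval_reZ, eval_reZ, zc_gen, mul_pow,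
      zeta_half hm]
    simp; ring

/-- No nonzero polynomial is invariant under the rotations and changes sign under a reflection. -/
theorem eq_zero_of_anti {t : Poly}
    (h1 : ∀ (θ : ℝ) u, MvPolynomial.eval ((rot θ).1 *ᵥ u) t = MvPolynomial.eval u t)
    (h2 : ∀ u, MvPolynomial.eval (kx.1 *ᵥ u) t = -MvPolynomial.eval u t) : t = 0 := by
  obtain ⟨p, -, h⟩ := (o2_iff (r := 0) (w := 0) (b := t)).1
    ⟨fun θ u => by simp only [cval, h1]; simp, fun u => by simp only [cval, h2]; simp⟩
  rw [h, show imZ 0 = 0 from rfl, mul_zero]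

/-! ### Equivariance of a form in terms of generators -/

/-- `B(γ u) = e γ B(u) γᵗ` for all `u`. -/
def IsCovariant (M : PolyForm) (γ : O2) (e : ℝ) : Prop :=
  ∀ u : Plane, PolyForm.evalAt M (γ.1 *ᵥ u) = e • (γ.1 * PolyForm.evalAt M u * γ.1ᵀ)

theorem IsCovariant.one (M : PolyForm) : IsCovariant M 1 1 := fun u => by simp

theorem IsCovariant.mul {M : PolyForm} {γ γ' : O2} {e e' : ℝ} (h : IsCovariant M γ e)
    (h' : IsCovariant M γ' e') : IsCovariant M (γ * γ') (e * e') := fun u => by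
  rw [Submonoid.coe_mul, ← Matrix.mulVec_mulVec, h, h', Matrix.transpose_mul, Matrix.mul_smul,
    Matrix.smul_mul, smul_smul]
  simp only [mul_assoc]

theorem IsCovariant.inv {M : PolyForm} {γ : O2} {e : ℝ} (he : e * e = 1)
    (h : IsCovariant M γ e) : IsCovariant M γ⁻¹ e := fun u => by
  have h1 := h ((γ⁻¹).1 *ᵥ u)
  rw [inv_val, Matrix.mulVec_mulVec, self_mul_transpose, Matrix.one_mulVec] at h1
  rw [inv_val, h1, Matrix.mul_smul, Matrix.smul_mul, smul_smul, he, one_smul,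
    Matrix.transpose_transpose, ← mul_assoc, ← mul_assoc, transpose_mul_self, one_mul, mul_assoc,
    transpose_mul_self, mul_one]

theorem mem_equivariantForms {Γ : Subgroup O2} {η : Γ →* ℤˣ} {M : PolyForm} :
    M ∈ equivariantForms Γ η ↔
      M.IsSymm ∧ ∀ γ : Γ, IsCovariant M γ.1 (((η γ : ℤˣ) : ℤ) : ℝ) := Iff.rfl

/-- Equivariance has to be checked on generators only. -/
theorem mem_equivariantForms_closure {Γ : Subgroup O2} {S : Set O2}
    (hΓ : Γ = Subgroup.closure S) {η : Γ →* ℤˣ} {M : PolyForm} :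
    M ∈ equivariantForms Γ η ↔ M.IsSymm ∧ ∀ (γ : O2) (h : γ ∈ Γ), γ ∈ S →
      IsCovariant M γ (((η ⟨γ, h⟩ : ℤˣ) : ℤ) : ℝ) := by
  rw [mem_equivariantForms]
  refine and_congr_right fun _ => ⟨fun h γ hγ _ => h ⟨γ, hγ⟩, fun h => ?_⟩
  have key : ∀ γ ∈ Subgroup.closure S, ∃ hγ : γ ∈ Γ,
      IsCovariant M γ (((η ⟨γ, hγ⟩ : ℤˣ) : ℤ) : ℝ) := by
    intro γ hγ
    induction hγ using Subgroup.closure_induction with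
    | mem γ hγ =>
      have hm : γ ∈ Γ := by rw [hΓ]; exact Subgroup.subset_closure hγ
      exact ⟨hm, h γ hm hγ⟩
    | one =>
      refine ⟨one_mem Γ, ?_⟩
      have : η ⟨1, one_mem Γ⟩ = 1 := map_one η
      rw [this]; simpa using IsCovariant.one M
    | mul a b _ _ ha hb =>
      obtain ⟨ha, ha'⟩ := ha
      obtain ⟨hb, hb'⟩ := hb
      refine ⟨mul_mem ha hb, ?_⟩
      have : η ⟨a * b, mul_mem ha hb⟩ = η ⟨a, ha⟩ * η ⟨b, hb⟩ := map_mul η ⟨a, ha⟩ ⟨b, hb⟩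
      rw [this]
      simpa using ha'.mul hb'
    | inv a _ ha =>
      obtain ⟨ha, ha'⟩ := ha
      refine ⟨inv_mem ha, ?_⟩
      have : η ⟨a⁻¹, inv_mem ha⟩ = η ⟨a, ha⟩ := by
        have h1 : η (⟨a, ha⟩⁻¹) = _ := map_inv η ⟨a, ha⟩
        rw [Int.units_inv_eq_self] at h1
        exact h1
      rw [this]
      exact ha'.inv (BDE.units_cast_mul_self _)
  intro γ
  obtain ⟨_, h'⟩ := key γ.1 (by rw [← hΓ]; exact γ.2)
  exact h'

theorem isSymm_quad (a b c : Poly) : (quad a b c).IsSymm := by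
  apply Matrix.IsSymm.ext
  intro i j
  fin_cases i <;> fin_cases j <;> simp [quad]

theorem eq_quad_of_isSymm {M : PolyForm} (hM : M.IsSymm) :
    M = quad (M 1 1) (M 0 1) (M 0 0) := by
  have : M 1 0 = M 0 1 := hM.apply 0 1
  ext1 i j
  fin_cases i <;> fin_cases j <;> simp [quad, this]

theorem evalAt_quad (a b c : Poly) (u : Plane) : PolyForm.evalAt (quad a b c) u =
    !![MvPolynomial.eval u c, MvPolynomial.eval u b;
      MvPolynomial.eval u b, MvPolynomial.eval u a] := by
  ext i j
  fin_cases i <;> fin_cases j <;> simp [quad, PolyForm.evalAt]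

theorem matrix_two_ext_iff {c b a c' b' a' : ℝ} :
    (!![c, b; b, a] : Matrix (Fin 2) (Fin 2) ℝ) = !![c', b'; b', a'] ↔
      c = c' ∧ b = b' ∧ a = a' := by
  rw [← Matrix.ext_iff, Fin.forall_fin_two]
  simp only [Fin.forall_fin_two]
  simp
  tauto

theorem smul_matrix_two (e c b a : ℝ) :
    e • (!![c, b; b, a] : Matrix (Fin 2) (Fin 2) ℝ) = !![e * c, e * b; e * b, e * a] := by
  ext i j
  fin_cases i <;> fin_cases j <;> simp

theorem isCovariant_kx_iff {a b c : Poly} {e : ℝ} : IsCovariant (quad a b c) kx e ↔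
    (∀ u, MvPolynomial.eval (kx.1 *ᵥ u) a = e * MvPolynomial.eval u a) ∧
    (∀ u, MvPolynomial.eval (kx.1 *ᵥ u) b = -(e * MvPolynomial.eval u b)) ∧
    ∀ u, MvPolynomial.eval (kx.1 *ᵥ u) c = e * MvPolynomial.eval u c := by
  rw [← forall_and, ← forall_and]
  refine forall_congr' fun u => ?_
  have : ∀ c b a : ℝ, kx.1 * !![c, b; b, a] * kx.1ᵀ = !![c, -b; -b, a] := by
    intro c b a
    rw [kx_val]
    ext i j
    fin_cases i <;> fin_cases j <;> simp [Matrix.vecMul, dotProduct, Fin.sum_univ_two]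
  rw [evalAt_quad, evalAt_quad, this, smul_matrix_two, matrix_two_ext_iff, mul_neg]
  tauto

theorem isCovariant_negI_iff {a b c : Poly} {e : ℝ} : IsCovariant (quad a b c) negI e ↔
    (∀ u, MvPolynomial.eval (negI.1 *ᵥ u) a = e * MvPolynomial.eval u a) ∧
    (∀ u, MvPolynomial.eval (negI.1 *ᵥ u) b = e * MvPolynomial.eval u b) ∧
    ∀ u, MvPolynomial.eval (negI.1 *ᵥ u) c = e * MvPolynomial.eval u c := by
  rw [← forall_and, ← forall_and]
  refine forall_congr' fun u => ?_
  have : ∀ B : Matrix (Fin 2) (Fin 2) ℝ, negI.1 * B * negI.1ᵀ = B := by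
    intro B
    rw [show negI.1 = -1 from rfl]
    simp
  rw [evalAt_quad, evalAt_quad, this, smul_matrix_two, matrix_two_ext_iff]
  tauto

/-- The form with half trace `t` and traceless part `[w, b; b, -w]`. Under a rotation by `ζ` the
function `t` is invariant, and `w + i b` is multiplied by `ζ ^ 2`. -/
noncomputable def qform (t w b : Poly) : PolyForm := quad (t - w) b (t + w)

theorem quad_eq_qform (a b c : Poly) : quad a b c =
    qform (MvPolynomial.C (1 / 2) * (a + c)) (MvPolynomial.C (1 / 2) * (c - a)) b := by
  have h : (MvPolynomial.C (1 / 2) : Poly) * 2 = 1 := by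
    rw [← map_ofNat (MvPolynomial.C : ℝ →+* Poly) 2, ← map_mul]; norm_num
  rw [qform]
  congr 1
  · linear_combination (-a) * h
  · linear_combination (-c) * h

/-- Conjugation by a rotation fixes the trace and turns the traceless part by twice the angle. -/
theorem isCovariant_rot_iff {t w b : Poly} {θ e : ℝ} : IsCovariant (qform t w b) (rot θ) e ↔
    (∀ u, MvPolynomial.eval ((rot θ).1 *ᵥ u) t = e * MvPolynomial.eval u t) ∧
    ∀ u, cval w b ((rot θ).1 *ᵥ u) = e * (Complex.exp (θ * Complex.I) ^ 2 * cval w b u) := by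
  rw [← forall_and]
  refine forall_congr' fun u => ?_
  have hcs := Real.sin_sq_add_cos_sq θ
  set C := Real.cos θ with hC
  set s := Real.sin θ with hs
  have hE : Complex.exp (θ * Complex.I) ^ 2 =
      ((C ^ 2 - s ^ 2 : ℝ) : ℂ) + ((2 * C * s : ℝ) : ℂ) * Complex.I := by
    rw [Complex.exp_mul_I, ← Complex.ofReal_cos, ← Complex.ofReal_sin, ← hC, ← hs]
    push_cast
    linear_combination ((s : ℂ) ^ 2) * Complex.I_sq
  have hM : ∀ c b a : ℝ, (rot θ).1 * !![c, b; b, a] * (rot θ).1ᵀ =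
      !![C ^ 2 * c - 2 * C * s * b + s ^ 2 * a, C * s * (c - a) + (C ^ 2 - s ^ 2) * b;
        C * s * (c - a) + (C ^ 2 - s ^ 2) * b, s ^ 2 * c + 2 * C * s * b + C ^ 2 * a] := by
    intro c b a
    rw [rot_val, ← hC, ← hs]
    ext i j
    fin_cases i <;> fin_cases j <;> simp [Matrix.vecMul, dotProduct, Fin.sum_univ_two] <;> ring
  rw [qform, evalAt_quad, evalAt_quad, hM, smul_matrix_two, matrix_two_ext_iff, hE, Complex.ext_iff]
  simp only [map_add, map_sub, Complex.mul_re, Complex.mul_im, Complex.add_re, Complex.add_im,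
    Complex.ofReal_re, Complex.ofReal_im, Complex.I_re, Complex.I_im, cval_re, cval_im]
  set t₀ := MvPolynomial.eval u t
  set w₀ := MvPolynomial.eval u w
  set b₀ := MvPolynomial.eval u b
  constructor
  · rintro ⟨h1, h2, h3⟩
    refine ⟨?_, ?_, ?_⟩
    · linear_combination h1 / 2 + h3 / 2 + e * t₀ * hcs
    · linear_combination h1 / 2 - h3 / 2
    · linear_combination h2
  · rintro ⟨h1, h2, h3⟩
    refine ⟨?_, ?_, ?_⟩
    · linear_combination h1 + h2 - e * t₀ * hcs
    · linear_combination h3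
    · linear_combination h1 - h2 - e * t₀ * hcs

theorem isCovariant_qform_kx_iff {t w b : Poly} {e : ℝ} : IsCovariant (qform t w b) kx e ↔
    (∀ u, MvPolynomial.eval (kx.1 *ᵥ u) t = e * MvPolynomial.eval u t) ∧
    ∀ u, cval w b (kx.1 *ᵥ u) = e * (starRingEnd ℂ) (cval w b u) := by
  rw [qform, isCovariant_kx_iff, ← forall_and, ← forall_and, ← forall_and]
  refine forall_congr' fun u => ?_
  rw [Complex.ext_iff]
  simp only [map_add, map_sub, Complex.re_ofReal_mul, Complex.im_ofReal_mul, Complex.conj_re,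
    Complex.conj_im, cval_re, cval_im]
  constructor
  · rintro ⟨h1, h2, h3⟩
    exact ⟨by linarith, by linarith, by linarith⟩
  · rintro ⟨h1, h2, h3⟩
    exact ⟨by linarith, by linarith, by linarith⟩

theorem mem_forms_cyc {n : ℕ} {η : cyc n →* ℤˣ} {e : ℝ}
    (he : ((η ⟨_, gen_mem_cyc n⟩ : ℤ) : ℝ) = e) {t w b : Poly} :
    qform t w b ∈ equivariantForms (cyc n) η ↔
      (∀ u, MvPolynomial.eval ((rot (2 * Real.pi / n)).1 *ᵥ u) t = e * MvPolynomial.eval u t) ∧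
      ∀ u, cval w b ((rot (2 * Real.pi / n)).1 *ᵥ u) = e * (zeta n ^ 2 * cval w b u) := by
  rw [mem_equivariantForms_closure (show cyc n = Subgroup.closure {_} from
    Subgroup.zpowers_eq_closure _)]
  change _ ↔ _ ∧ ∀ u, _ = _ * (Complex.exp _ ^ 2 * _)
  rw [← isCovariant_rot_iff]
  subst he
  constructor
  · rintro ⟨-, h⟩
    exact h _ _ rfl
  · intro h
    refine ⟨isSymm_quad _ _ _, ?_⟩
    rintro γ hγ rfl
    exact h

theorem mem_forms_dih {n : ℕ} {η : dih n kx →* ℤˣ} {e e' : ℝ}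
    (he : ((η ⟨_, gen_mem_dih n kx⟩ : ℤ) : ℝ) = e)
    (he' : ((η ⟨_, refl_mem_dih n kx⟩ : ℤ) : ℝ) = e')
    {t w b : Poly} :
    qform t w b ∈ equivariantForms (dih n kx) η ↔
      ((∀ u, MvPolynomial.eval ((rot (2 * Real.pi / n)).1 *ᵥ u) t = e * MvPolynomial.eval u t) ∧
      ∀ u, MvPolynomial.eval (kx.1 *ᵥ u) t = e' * MvPolynomial.eval u t) ∧
      (∀ u, cval w b ((rot (2 * Real.pi / n)).1 *ᵥ u) = e * (zeta n ^ 2 * cval w b u)) ∧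
      ∀ u, cval w b (kx.1 *ᵥ u) = e' * (starRingEnd ℂ) (cval w b u) := by
  rw [mem_equivariantForms_closure (show dih n kx = Subgroup.closure {_, kx} from rfl),
    and_and_and_comm]
  subst he he'
  change _ ↔ (_ ∧ ∀ u, _ = _ * (Complex.exp _ ^ 2 * _)) ∧ _
  rw [← isCovariant_qform_kx_iff, ← isCovariant_rot_iff]
  constructor
  · rintro ⟨-, h⟩
    exact ⟨h _ _ (by simp), h _ _ (by simp)⟩
  · rintro ⟨h, h'⟩
    refine ⟨isSymm_quad _ _ _, ?_⟩
    rintro γ hγ (rfl | rfl)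
    · exact h
    · exact h'

theorem forms_eq {Γ : Subgroup O2} {η : Γ →* ℤˣ} {S : Set PolyForm}
    (h1 : ∀ t w b, qform t w b ∈ equivariantForms Γ η → qform t w b ∈ S)
    (h2 : ∀ M ∈ S, M ∈ equivariantForms Γ η) : (equivariantForms Γ η : Set PolyForm) = S := by
  apply Set.Subset.antisymm
  · intro M hM
    rw [eq_quad_of_isSymm hM.1, quad_eq_qform]
    apply h1
    rw [← quad_eq_qform, ← eq_quad_of_isSymm hM.1]
    exact hM
  · exact h2

theorem forms_eq_quad {Γ : Subgroup O2} {η : Γ →* ℤˣ} {S : Set PolyForm}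
    (h1 : ∀ a b c, quad a b c ∈ equivariantForms Γ η → quad a b c ∈ S)
    (h2 : ∀ M ∈ S, M ∈ equivariantForms Γ η) : (equivariantForms Γ η : Set PolyForm) = S := by
  apply Set.Subset.antisymm
  · intro M hM
    rw [eq_quad_of_isSymm hM.1]
    apply h1
    rw [← eq_quad_of_isSymm hM.1]
    exact hM
  · exact h2

theorem mem_kerEta {Γ : Subgroup O2} {η : Γ →* ℤˣ} (γ : Γ) : γ.1 ∈ kerEta Γ η ↔ η γ = 1 := by
  constructor
  · rintro ⟨γ', h, h'⟩
    rw [← Subtype.ext h']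
    exact h
  · exact fun h => ⟨γ, h, rfl⟩

theorem eta_of_mem {Γ K : Subgroup O2} {η : Γ →* ℤˣ} (h : kerEta Γ η = K) {γ : O2} (hγ : γ ∈ Γ)
    (hK : γ ∈ K) : ((η ⟨γ, hγ⟩ : ℤ) : ℝ) = 1 := by
  subst h
  rw [(mem_kerEta ⟨γ, hγ⟩).1 hK]; simp

theorem eta_of_not_mem {Γ K : Subgroup O2} {η : Γ →* ℤˣ} (h : kerEta Γ η = K) {γ : O2}
    (hγ : γ ∈ Γ) (hK : γ ∉ K) : ((η ⟨γ, hγ⟩ : ℤ) : ℝ) = -1 := by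
  subst h
  rw [mem_kerEta ⟨γ, hγ⟩] at hK
  rw [(Int.units_eq_one_or _).resolve_left hK]; simp

/-! ### The algebraic content of a row of the table -/

/-- The algebraic content of a row of the table: `K` and `L` are kernels of characters of `Γ`
whose product is the determinant, some form in `S` has negative determinant at a point, and `S`
is the module of equivariant forms. -/
structure IsRow (Γ K L : Subgroup O2) (S : Set PolyForm) : Prop where
  K_le : K ≤ Γ
  mul_mem_K : ∀ a ∈ Γ, ∀ b ∈ Γ, (a * b ∈ K ↔ (a ∈ K ↔ b ∈ K))
  L_le : L ≤ Γ
  mem_L : ∀ γ ∈ Γ, (γ ∈ L ↔ (γ ∈ K ↔ γ ∈ SO2))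
  exists_det_neg : ∃ M ∈ S, ∃ u, (PolyForm.evalAt M u).det < 0
  forms : ∀ η : Γ →* ℤˣ, kerEta Γ η = K → (equivariantForms Γ η : Set PolyForm) = S

/-- A row with `η` trivial: `λ` is the determinant. -/
theorem IsRow.of_full {Γ L : Subgroup O2} {S : Set PolyForm}
    (hL : ∀ γ, γ ∈ L ↔ γ ∈ Γ ∧ γ ∈ SO2)
    (hdet : ∃ M ∈ S, ∃ u, (PolyForm.evalAt M u).det < 0)
    (hS : ∀ η : Γ →* ℤˣ, kerEta Γ η = Γ → (equivariantForms Γ η : Set PolyForm) = S) :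
    IsRow Γ Γ L S where
  K_le := le_rfl
  mul_mem_K a ha b hb := by simp [ha, hb, mul_mem]
  L_le γ hγ := ((hL γ).1 hγ).1
  mem_L γ hγ := by simp [hL, hγ]
  exists_det_neg := hdet
  forms := hS

/-- A row with `η` the determinant: `λ` is trivial. -/
theorem IsRow.of_rotations {Γ K : Subgroup O2} {S : Set PolyForm}
    (hK : ∀ γ, γ ∈ K ↔ γ ∈ Γ ∧ γ ∈ SO2)
    (hdet : ∃ M ∈ S, ∃ u, (PolyForm.evalAt M u).det < 0)
    (hS : ∀ η : Γ →* ℤˣ, kerEta Γ η = K → (equivariantForms Γ η : Set PolyForm) = S) :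
    IsRow Γ K Γ S where
  K_le γ hγ := ((hK γ).1 hγ).1
  mul_mem_K a ha b hb := by simp [hK, ha, hb, mul_mem, mul_mem_SO2_iff]
  L_le := le_rfl
  mem_L γ hγ := by simp [hK, hγ]
  exists_det_neg := hdet
  forms := hS

/-- The base point `(1, 0)`, at which `Re (z ^ k) = 1` and `Im (z ^ k) = 0`. -/
noncomputable def basePt : Plane := ![1, 0]

theorem eval_reZ_basePt (k : ℕ) : MvPolynomial.eval basePt (reZ k) = 1 := by
  simp [eval_reZ, zc, basePt]

theorem eval_imZ_basePt (k : ℕ) : MvPolynomial.eval basePt (imZ k) = 0 := by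
  simp [eval_imZ, zc, basePt]

theorem eval_x_basePt : MvPolynomial.eval basePt x = 1 := by simp [x, basePt]

theorem eval_y_basePt : MvPolynomial.eval basePt y = 0 := by simp [y, basePt]

theorem exists_det_neg_of {S : Set PolyForm} {a b c : Poly} (hM : quad a b c ∈ S)
    (h : MvPolynomial.eval basePt c * MvPolynomial.eval basePt a <
      MvPolynomial.eval basePt b * MvPolynomial.eval basePt b) :
    ∃ M ∈ S, ∃ u, (PolyForm.evalAt M u).det < 0 := by
  refine ⟨_, hM, basePt, ?_⟩
  rw [evalAt_quad, Matrix.det_fin_two_of]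
  linarith

theorem reZ_two : reZ 2 = x ^ 2 - y ^ 2 := by simp [reZ, powZ]; ring

theorem imZ_two : imZ 2 = 2 * x * y := by simp [imZ, powZ]; ring

theorem reZ_one : reZ 1 = x := by simp [reZ, powZ]

theorem imZ_one : imZ 1 = y := by simp [imZ, powZ]

/-! ### The rows with a group of order at least three, or infinite -/

theorem isRow_cyc (n : ℕ) (hn : 3 ≤ n) : IsRow (cyc n) (cyc n) (cyc n)
      {B | ∃ p₁ p₂ p₃ p₄ p₅ : invariants (cyc n), B = quad
        (p₁ + (y ^ 2 - x ^ 2) * p₂ + 2 * x * y * p₃ - reZ (n - 2) * p₄ - imZ (n - 2) * p₅)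
        (2 * x * y * p₂ + (x ^ 2 - y ^ 2) * p₃ + reZ (n - 2) * p₅ - imZ (n - 2) * p₄)
        (p₁ + (x ^ 2 - y ^ 2) * p₂ - 2 * x * y * p₃ + reZ (n - 2) * p₄ + imZ (n - 2) * p₅)} := by
  have hN : n ≠ 0 := by omega
  have hrs : 2 + (n - 2) = n := by omega
  refine .of_full (fun γ => ⟨fun h => ⟨h, cyc_le_SO2 n h⟩, fun h => h.1⟩) ?_ fun η hη => ?_
  · refine exists_det_neg_of ⟨0, 1, 0, 0, 0, rfl⟩ ?_
    simp [eval_x_basePt, eval_y_basePt]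
  have he := eta_of_mem hη (gen_mem_cyc n) (gen_mem_cyc n)
  apply forms_eq
  · intro t w b h
    rw [mem_forms_cyc he] at h
    simp only [Complex.ofReal_one, one_mul] at h
    obtain ⟨p, q, p', q', rfl, rfl⟩ := (cyc_iff hN hrs).1 h.2
    obtain ⟨p₁, rfl⟩ : ∃ p₁ : invariants _, t = p₁ := ⟨⟨t, mem_invariants_cyc.2 h.1⟩, rfl⟩
    refine ⟨p₁, p, q, p', q', ?_⟩
    rw [qform, reZ_two, imZ_two]
    congr 1 <;> ring
  · rintro M ⟨p₁, p, q, p', q', rfl⟩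
    have h := (mem_forms_cyc (w := p * reZ 2 - q * imZ 2 + (p' * reZ (n - 2) + q' * imZ (n - 2)))
      (b := p * imZ 2 + q * reZ 2 + (q' * reZ (n - 2) - p' * imZ (n - 2))) (t := p₁) he).2
      (by
        simp only [Complex.ofReal_one, one_mul]
        exact ⟨eval_of_mem p₁ (gen_mem_cyc n), (cyc_iff hN hrs).2 ⟨p, q, p', q', rfl, rfl⟩⟩)
    convert h using 1
    rw [qform, reZ_two, imZ_two]
    congr 1 <;> ring

theorem gen_not_mem_half {m : ℕ} (hm : m ≠ 0) : rot (2 * Real.pi / (2 * m : ℕ)) ∉ cyc m := by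
  have := (gen_zpow_mem_cyc_half hm 1).not.2 (by decide)
  rwa [zpow_one] at this

theorem isRow_cyc_cyc (m : ℕ) (hm : 2 ≤ m) : IsRow (cyc (2 * m)) (cyc m) (cyc m)
      {B | ∃ p₁ p₂ p₃ p₄ p₅ p₆ : invariants (cyc (2 * m)), B = quad
        (-(reZ (m - 2) * p₁) - imZ (m - 2) * p₂ + reZ m * p₃ - reZ (m + 2) * p₄
          + imZ (m + 2) * p₅ + imZ m * p₆)
        (-(imZ (m - 2) * p₁) + reZ (m - 2) * p₂ + imZ (m + 2) * p₄ + reZ (m + 2) * p₅)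
        (reZ (m - 2) * p₁ + imZ (m - 2) * p₂ + reZ m * p₃ + reZ (m + 2) * p₄
          - imZ (m + 2) * p₅ + imZ m * p₆)} := by
  have hm0 : m ≠ 0 := by omega
  have hN : 2 * m ≠ 0 := by omega
  have hrs : (m + 2) + (m - 2) = 2 * m := by omega
  refine ⟨cyc_half_le hm0, fun a ha b hb => mul_mem_cyc_half hm0 ha hb, cyc_half_le hm0,
    fun γ hγ => by simp [cyc_le_SO2 _ hγ], ?_, fun η hη => ?_⟩
  · refine exists_det_neg_of ⟨1, 0, 0, 0, 0, 0, rfl⟩ ?_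
    simp [eval_reZ_basePt, eval_imZ_basePt]
  have he := eta_of_not_mem hη (gen_mem_cyc (2 * m)) (gen_not_mem_half hm0)
  have hz : ∀ c : ℂ, ((-1 : ℝ) : ℂ) * (zeta (2 * m) ^ 2 * c) = zeta (2 * m) ^ (m + 2) * c := by
    intro c
    rw [pow_add, zeta_half hm0]; push_cast; ring
  apply forms_eq
  · intro t w b h
    rw [mem_forms_cyc he] at h
    simp only [hz, neg_one_mul] at h
    obtain ⟨p₄, p₅, p₁, p₂, rfl, rfl⟩ := (cyc_iff hN hrs).1 h.2
    obtain ⟨p₃, p₆, rfl⟩ := (half_cyc_iff hm0).1 h.1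
    refine ⟨p₁, p₂, p₃, p₄, p₅, p₆, ?_⟩
    rw [qform]
    congr 1 <;> ring
  · rintro M ⟨p₁, p₂, p₃, p₄, p₅, p₆, rfl⟩
    have h := (mem_forms_cyc
      (w := p₄ * reZ (m + 2) - p₅ * imZ (m + 2) + (p₁ * reZ (m - 2) + p₂ * imZ (m - 2)))
      (b := p₄ * imZ (m + 2) + p₅ * reZ (m + 2) + (p₂ * reZ (m - 2) - p₁ * imZ (m - 2)))
      (t := reZ m * p₃ + imZ m * p₆) he).2
      (by
        simp only [hz, neg_one_mul]
        exact ⟨(half_cyc_iff hm0).2 ⟨p₃, p₆, rfl⟩,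
          (cyc_iff hN hrs).2 ⟨p₄, p₅, p₁, p₂, rfl, rfl⟩⟩)
    convert h using 1
    rw [qform]
    congr 1 <;> ring

theorem mem_cyc_iff_mem_dih {n : ℕ} (γ : O2) : γ ∈ cyc n ↔ γ ∈ dih n kx ∧ γ ∈ SO2 := by
  constructor
  · exact fun h => ⟨cyc_le_dih _ _ h, cyc_le_SO2 n h⟩
  · exact fun h => (mem_dih_iff_of_mem_SO2 kx_not_mem_SO2 h.2).1 h.1

theorem isRow_dih (n : ℕ) (hn : 3 ≤ n) : IsRow (dih n kx) (dih n kx) (cyc n)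
      {B | ∃ p₁ p₂ p₃ : invariants (dih n kx), B = quad
        (p₁ + (y ^ 2 - x ^ 2) * p₂ - reZ (n - 2) * p₃)
        (2 * x * y * p₂ - imZ (n - 2) * p₃)
        (p₁ + (x ^ 2 - y ^ 2) * p₂ + reZ (n - 2) * p₃)} := by
  have hN : n ≠ 0 := by omega
  have hrs : 2 + (n - 2) = n := by omega
  refine .of_full mem_cyc_iff_mem_dih ?_ fun η hη => ?_
  · refine exists_det_neg_of ⟨0, 1, 0, rfl⟩ ?_
    simp [eval_x_basePt, eval_y_basePt]
  have he := eta_of_mem hη (gen_mem_dih n kx) (gen_mem_dih n kx)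
  have he' := eta_of_mem hη (refl_mem_dih n kx) (refl_mem_dih n kx)
  apply forms_eq
  · intro t w b h
    rw [mem_forms_dih he he'] at h
    simp only [Complex.ofReal_one, one_mul] at h
    obtain ⟨p, p', rfl, rfl⟩ := (dih_iff hN hrs).1 h.2
    obtain ⟨p₁, rfl⟩ : ∃ p₁ : invariants _, t = p₁ := ⟨⟨t, mem_invariants_dih.2 h.1⟩, rfl⟩
    refine ⟨p₁, p, p', ?_⟩
    rw [qform, reZ_two, imZ_two]
    congr 1 <;> ring
  · rintro M ⟨p₁, p, p', rfl⟩
    have h := (mem_forms_dih (w := p * reZ 2 + p' * reZ (n - 2))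
      (b := p * imZ 2 - p' * imZ (n - 2)) (t := p₁) he he').2
      (by
        simp only [Complex.ofReal_one, one_mul]
        exact ⟨mem_invariants_dih.1 p₁.2, (dih_iff hN hrs).2 ⟨p, p', rfl, rfl⟩⟩)
    convert h using 1
    rw [qform, reZ_two, imZ_two]
    congr 1 <;> ring

/-- The case in which `κ_x` carries `w + i b` to minus its conjugate reduces to `dih_iff` through
multiplication by `i`. -/
theorem dih_anti_iff {N r s : ℕ} (hN : N ≠ 0) (hrs : r + s = N) {w b : Poly} :
    ((∀ u, cval w b ((rot (2 * Real.pi / N)).1 *ᵥ u) = zeta N ^ r * cval w b u) ∧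
      ∀ u, cval w b (kx.1 *ᵥ u) = -(starRingEnd ℂ) (cval w b u)) ↔
    ∃ p p' : invariants (dih N kx),
      w = -(p * imZ r) + p' * imZ s ∧ b = p * reZ r + p' * reZ s := by
  rw [← mul_I_conj_iff, ← mul_I_rot_iff, dih_iff hN hrs]
  constructor
  · rintro ⟨p, p', h1, h2⟩
    exact ⟨-p, -p', by rw [h2]; push_cast; ring, by
      rw [← neg_neg b, h1]; push_cast; ring⟩
  · rintro ⟨p, p', h1, h2⟩
    exact ⟨-p, -p', by rw [h2]; push_cast; ring, by rw [h1]; push_cast; ring⟩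

theorem isRow_dih_cyc (n : ℕ) (hn : 3 ≤ n) : IsRow (dih n kx) (cyc n) (dih n kx)
      {B | ∃ p₁ p₂ p₃ : invariants (dih n kx), B = quad
        (2 * x * y * p₁ - imZ (n - 2) * p₂ + imZ n * p₃)
        ((x ^ 2 - y ^ 2) * p₁ + reZ (n - 2) * p₂)
        (-(2 * x * y * p₁) + imZ (n - 2) * p₂ + imZ n * p₃)} := by
  have hN : n ≠ 0 := by omega
  have hrs : 2 + (n - 2) = n := by omega
  refine .of_rotations mem_cyc_iff_mem_dih ?_ fun η hη => ?_
  · refine exists_det_neg_of ⟨1, 0, 0, rfl⟩ ?_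
    simp [eval_x_basePt, eval_y_basePt]
  have he := eta_of_mem hη (gen_mem_dih n kx) (gen_mem_cyc n)
  have he' := eta_of_not_mem hη (refl_mem_dih n kx) (fun h => kx_not_mem_SO2 (cyc_le_SO2 n h))
  apply forms_eq
  · intro t w b h
    rw [mem_forms_dih he he'] at h
    simp only [Complex.ofReal_one, one_mul, Complex.ofReal_neg, neg_one_mul] at h
    obtain ⟨p, p', rfl, rfl⟩ := (dih_anti_iff hN hrs).1 h.2
    obtain ⟨p₃, rfl⟩ := (anti_iff hN).1 h.1
    refine ⟨p, p', p₃, ?_⟩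
    rw [qform, reZ_two, imZ_two]
    congr 1 <;> ring
  · rintro M ⟨p, p', p₃, rfl⟩
    have h := (mem_forms_dih (w := -(p * imZ 2) + p' * imZ (n - 2))
      (b := p * reZ 2 + p' * reZ (n - 2)) (t := imZ n * p₃) he he').2
      (by
        simp only [Complex.ofReal_one, one_mul, Complex.ofReal_neg, neg_one_mul]
        exact ⟨(anti_iff hN).2 ⟨p₃, rfl⟩, (dih_anti_iff hN hrs).2 ⟨p, p', rfl, rfl⟩⟩)
    convert h using 1
    rw [qform, reZ_two, imZ_two]
    congr 1 <;> ring

theorem gen_not_mem_dih_half {m : ℕ} (hm : m ≠ 0) :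
    rot (2 * Real.pi / (2 * m : ℕ)) ∉ dih m kx := by
  rw [mem_dih_iff_of_mem_SO2 kx_not_mem_SO2 (rot_mem_SO2 _)]
  exact gen_not_mem_half hm

theorem isRow_dih_dih (m : ℕ) (hm : 2 ≤ m) :
      IsRow (dih (2 * m) kx) (dih m kx) (dih m (rot (Real.pi / m) * kx))
      {B | ∃ p₁ p₂ p₃ : invariants (dih (2 * m) kx), B = quad
        (-(reZ (m - 2) * p₁) + reZ m * p₂ - reZ (m + 2) * p₃)
        (-(imZ (m - 2) * p₁) + imZ (m + 2) * p₃)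
        (reZ (m - 2) * p₁ + reZ m * p₂ + reZ (m + 2) * p₃)} := by
  have hm0 : m ≠ 0 := by omega
  have hN : 2 * m ≠ 0 := by omega
  have hrs : (m + 2) + (m - 2) = 2 * m := by omega
  refine ⟨dih_half_le hm0 (refl_mem_dih _ _), fun a ha b hb => mul_mem_dih_half hm0 ha hb,
    dih_half_le hm0 (refl_half_mem_dih m), fun γ hγ => mem_dih_half_iff hm0 hγ, ?_, fun η hη => ?_⟩
  · refine exists_det_neg_of ⟨1, 0, 0, rfl⟩ ?_
    simp [eval_reZ_basePt, eval_imZ_basePt]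
  have he := eta_of_not_mem hη (gen_mem_dih (2 * m) kx) (gen_not_mem_dih_half hm0)
  have he' := eta_of_mem hη (refl_mem_dih (2 * m) kx) (refl_mem_dih m kx)
  have hz : ∀ c : ℂ, ((-1 : ℝ) : ℂ) * (zeta (2 * m) ^ 2 * c) = zeta (2 * m) ^ (m + 2) * c := by
    intro c
    rw [pow_add, zeta_half hm0]; push_cast; ring
  apply forms_eq
  · intro t w b h
    rw [mem_forms_dih he he'] at h
    simp only [hz, neg_one_mul, Complex.ofReal_one, one_mul] at h
    obtain ⟨p₃, p₁, rfl, rfl⟩ := (dih_iff hN hrs).1 h.2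
    obtain ⟨p₂, rfl⟩ := (half_iff hm0).1 h.1
    refine ⟨p₁, p₂, p₃, ?_⟩
    rw [qform]
    congr 1 <;> ring
  · rintro M ⟨p₁, p₂, p₃, rfl⟩
    have h := (mem_forms_dih (w := p₃ * reZ (m + 2) + p₁ * reZ (m - 2))
      (b := p₃ * imZ (m + 2) - p₁ * imZ (m - 2)) (t := reZ m * p₂) he he').2
      (by
        simp only [hz, neg_one_mul, Complex.ofReal_one, one_mul]
        exact ⟨(half_iff hm0).2 ⟨p₂, rfl⟩, (dih_iff hN hrs).2 ⟨p₃, p₁, rfl, rfl⟩⟩)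
    convert h using 1
    rw [qform]
    congr 1 <;> ring

theorem mem_invariants_SO2 {p : Poly} : p ∈ invariants SO2 ↔
    ∀ (θ : ℝ) (u : Plane), MvPolynomial.eval ((rot θ).1 *ᵥ u) p = MvPolynomial.eval u p := by
  constructor
  · exact fun h θ => h _ (rot_mem_SO2 θ)
  · intro h γ hγ
    obtain ⟨θ, rfl⟩ := exists_rot_of_mem_SO2 hγ
    exact h θ

/-- `O(2)` is generated by the rotations and `κ_x`. -/
theorem top_eq_closure : (⊤ : Subgroup O2) = Subgroup.closure (Set.range rot ∪ {kx}) := by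
  refine le_antisymm (fun γ _ => ?_) le_top
  have hr : ∀ θ, rot θ ∈ Subgroup.closure (Set.range rot ∪ {kx}) := fun θ =>
    Subgroup.subset_closure (Or.inl ⟨θ, rfl⟩)
  by_cases h : γ ∈ SO2
  · obtain ⟨θ, rfl⟩ := exists_rot_of_mem_SO2 h
    exact hr θ
  · obtain ⟨θ, rfl⟩ := exists_rot_mul_kx h
    exact mul_mem (hr θ) (Subgroup.subset_closure (Or.inr rfl))

theorem mem_invariants_top {p : Poly} : p ∈ invariants ⊤ ↔
    (∀ (θ : ℝ) (u : Plane), MvPolynomial.eval ((rot θ).1 *ᵥ u) p = MvPolynomial.eval u p) ∧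
    ∀ u : Plane, MvPolynomial.eval (kx.1 *ᵥ u) p = MvPolynomial.eval u p := by
  constructor
  · exact fun h => ⟨fun θ => h _ trivial, h _ trivial⟩
  · intro h
    rw [mem_invariants_iff, top_eq_closure, Subgroup.closure_le]
    rintro _ (⟨θ, rfl⟩ | rfl)
    · exact h.1 θ
    · exact h.2

theorem isRow_so2 : IsRow SO2 SO2 SO2
      {B | ∃ p₁ p₂ p₃ : invariants SO2, B = quad
        (p₁ + (y ^ 2 - x ^ 2) * p₂ + 2 * x * y * p₃)
        (2 * x * y * p₂ + (x ^ 2 - y ^ 2) * p₃)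
        (p₁ + (x ^ 2 - y ^ 2) * p₂ - 2 * x * y * p₃)} := by
  refine .of_full (fun γ => ⟨fun h => ⟨h, h⟩, fun h => h.1⟩) ?_ fun η hη => ?_
  · refine exists_det_neg_of ⟨0, 1, 0, rfl⟩ ?_
    simp [eval_x_basePt, eval_y_basePt]
  have hcov : ∀ t w b, qform t w b ∈ equivariantForms SO2 η ↔
      t ∈ invariants SO2 ∧ ∀ (θ : ℝ) u, cval w b ((rot θ).1 *ᵥ u) =
        Complex.exp (θ * Complex.I) ^ 2 * cval w b u := by
    intro t w b
    rw [mem_equivariantForms, mem_invariants_SO2, ← forall_and]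
    have : (∀ θ, IsCovariant (qform t w b) (rot θ) 1) ↔ _ := forall_congr' fun θ =>
      isCovariant_rot_iff
    simp only [Complex.ofReal_one, one_mul] at this
    rw [← this]
    constructor
    · intro h θ
      have h1 := h.2 ⟨rot θ, rot_mem_SO2 θ⟩
      rwa [eta_of_mem hη (rot_mem_SO2 θ) (rot_mem_SO2 θ)] at h1
    · refine fun h => ⟨isSymm_quad _ _ _, fun ⟨γ, hγ⟩ => ?_⟩
      rw [eta_of_mem hη hγ hγ]
      obtain ⟨θ, rfl⟩ := exists_rot_of_mem_SO2 hγ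
      exact h θ
  apply forms_eq
  · intro t w b h
    rw [hcov] at h
    obtain ⟨p, q, rfl, rfl⟩ := so2_iff.1 h.2
    obtain ⟨p₁, rfl⟩ : ∃ p₁ : invariants _, t = p₁ := ⟨⟨t, h.1⟩, rfl⟩
    refine ⟨p₁, p, q, ?_⟩
    rw [qform, reZ_two, imZ_two]
    congr 1 <;> ring
  · rintro M ⟨p₁, p, q, rfl⟩
    have h := (hcov p₁ (p * reZ 2 - q * imZ 2) (p * imZ 2 + q * reZ 2)).2
      ⟨p₁.2, so2_iff.2 ⟨p, q, rfl, rfl⟩⟩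
    convert h using 1
    rw [qform, reZ_two, imZ_two]
    congr 1 <;> ring

theorem mem_forms_top {η : (⊤ : Subgroup O2) →* ℤˣ} {K : Subgroup O2} (hη : kerEta ⊤ η = K)
    (hK : SO2 ≤ K) {e' : ℝ} (he' : ((η ⟨kx, trivial⟩ : ℤ) : ℝ) = e') {t w b : Poly} :
    qform t w b ∈ equivariantForms ⊤ η ↔
      ((∀ (θ : ℝ) (u : Plane), MvPolynomial.eval ((rot θ).1 *ᵥ u) t = MvPolynomial.eval u t) ∧
      ∀ u, MvPolynomial.eval (kx.1 *ᵥ u) t = e' * MvPolynomial.eval u t) ∧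
      (∀ (θ : ℝ) u, cval w b ((rot θ).1 *ᵥ u) =
        Complex.exp (θ * Complex.I) ^ 2 * cval w b u) ∧
      ∀ u, cval w b (kx.1 *ᵥ u) = e' * (starRingEnd ℂ) (cval w b u) := by
  rw [mem_equivariantForms_closure top_eq_closure, and_and_and_comm, ← forall_and]
  have : (∀ θ, IsCovariant (qform t w b) (rot θ) 1) ↔ _ := forall_congr' fun θ =>
    isCovariant_rot_iff
  simp only [Complex.ofReal_one, one_mul] at this
  subst he'
  rw [← this, ← isCovariant_qform_kx_iff]
  constructor
  · rintro ⟨-, h⟩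
    refine ⟨fun θ => ?_, h _ trivial (Or.inr rfl)⟩
    have h1 := h (rot θ) trivial (Or.inl ⟨θ, rfl⟩)
    rwa [eta_of_mem hη trivial (hK (rot_mem_SO2 θ))] at h1
  · rintro ⟨h, h'⟩
    refine ⟨isSymm_quad _ _ _, ?_⟩
    rintro _ hγ (⟨θ, rfl⟩ | rfl)
    · rw [eta_of_mem hη trivial (hK (rot_mem_SO2 θ))]
      exact h θ
    · exact h'

theorem isRow_o2 : IsRow ⊤ ⊤ SO2
      {B | ∃ p₁ p₂ : invariants ⊤, B = quad
        (p₁ + (y ^ 2 - x ^ 2) * p₂)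
        (2 * x * y * p₂)
        (p₁ + (x ^ 2 - y ^ 2) * p₂)} := by
  refine .of_full (fun γ => by simp) ?_ fun η hη => ?_
  · refine exists_det_neg_of ⟨0, 1, rfl⟩ ?_
    simp [eval_x_basePt, eval_y_basePt]
  have he' := eta_of_mem hη (γ := kx) trivial trivial
  apply forms_eq
  · intro t w b h
    rw [mem_forms_top hη le_top he'] at h
    simp only [Complex.ofReal_one, one_mul] at h
    obtain ⟨p, rfl, rfl⟩ := o2_iff.1 h.2
    obtain ⟨p₁, rfl⟩ : ∃ p₁ : invariants _, t = p₁ := ⟨⟨t, mem_invariants_top.2 h.1⟩, rfl⟩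
    refine ⟨p₁, p, ?_⟩
    rw [qform, reZ_two, imZ_two]
    congr 1 <;> ring
  · rintro M ⟨p₁, p, rfl⟩
    have h := (mem_forms_top (t := p₁) (w := p * reZ 2) (b := p * imZ 2) hη le_top he').2
      (by
        simp only [Complex.ofReal_one, one_mul]
        exact ⟨mem_invariants_top.1 p₁.2, o2_iff.2 ⟨p, rfl, rfl⟩⟩)
    convert h using 1
    rw [qform, reZ_two, imZ_two]
    congr 1 <;> ring

theorem isRow_o2_so2 : IsRow ⊤ SO2 ⊤
      {B | ∃ p : invariants ⊤, B = quad
        (2 * x * y * p)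
        ((x ^ 2 - y ^ 2) * p)
        (-(2 * x * y * p))} := by
  refine .of_rotations (fun γ => by simp) ?_ fun η hη => ?_
  · refine exists_det_neg_of ⟨1, rfl⟩ ?_
    simp [eval_x_basePt, eval_y_basePt]
  have he' := eta_of_not_mem hη (γ := kx) trivial kx_not_mem_SO2
  apply forms_eq
  · intro t w b h
    rw [mem_forms_top hη le_rfl he'] at h
    simp only [Complex.ofReal_one, Complex.ofReal_neg, neg_one_mul] at h
    obtain rfl := eq_zero_of_anti h.1.1 h.1.2
    obtain ⟨p, hp, hw⟩ := o2_iff.1 ⟨fun θ => (mul_I_rot_iff (rot θ) _).2 (h.2.1 θ),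
      mul_I_conj_iff.2 h.2.2⟩
    refine ⟨-p, ?_⟩
    rw [qform, hw, ← neg_neg b, hp, reZ_two, imZ_two]
    push_cast
    congr 1 <;> ring
  · rintro M ⟨p, rfl⟩
    obtain ⟨h1, h2⟩ := o2_iff.2 ⟨-p, rfl, rfl⟩
    have h := (mem_forms_top (t := 0) (w := (-p : invariants ⊤) * imZ 2)
      (b := -((-p : invariants ⊤) * reZ 2)) hη le_rfl he').2
      (by
        simp only [Complex.ofReal_one, Complex.ofReal_neg, neg_one_mul]
        refine ⟨by simp, fun θ => (mul_I_rot_iff (rot θ) _).1 ?_, mul_I_conj_iff.1 ?_⟩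
        · rw [neg_neg]; exact h1 θ
        · rw [neg_neg]; exact h2)
    convert h using 1
    rw [qform, reZ_two, imZ_two]
    push_cast
    congr 1 <;> ring

/-! ### The rows with a group generated by reflections in the axes or by the half turn -/

theorem eval_x_kx (u : Plane) :
    MvPolynomial.eval (kx.1 *ᵥ u) x = MvPolynomial.eval u x := by
  rw [← reZ_one, eval_reZ, eval_reZ, zc_kx]; simp

theorem eval_y_kx (u : Plane) :
    MvPolynomial.eval (kx.1 *ᵥ u) y = -MvPolynomial.eval u y := by
  rw [← imZ_one, eval_imZ, eval_imZ, zc_kx]; simp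

theorem eval_x_negI (u : Plane) :
    MvPolynomial.eval (negI.1 *ᵥ u) x = -MvPolynomial.eval u x := by
  rw [show negI.1 = -1 from rfl]; simp [x]

theorem eval_y_negI (u : Plane) :
    MvPolynomial.eval (negI.1 *ᵥ u) y = -MvPolynomial.eval u y := by
  rw [show negI.1 = -1 from rfl]; simp [y]

theorem gen_two : rot (2 * Real.pi / (2 : ℕ)) = negI := by
  rw [negI_eq, Nat.cast_two, mul_div_cancel_left₀ _ two_ne_zero]

theorem gen_two_mul_one : rot (2 * Real.pi / (2 * 1 : ℕ)) = negI := gen_two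

theorem mem_invariants_zpowers {γ : O2} {p : Poly} : p ∈ invariants (Subgroup.zpowers γ) ↔
    ∀ u : Plane, MvPolynomial.eval (γ.1 *ᵥ u) p = MvPolynomial.eval u p := by
  rw [mem_invariants_iff, Subgroup.zpowers_le]; rfl

theorem mem_invariants_dih_two {p : Poly} : p ∈ invariants (dih 2 kx) ↔
    (∀ u : Plane, MvPolynomial.eval (negI.1 *ᵥ u) p = MvPolynomial.eval u p) ∧
    ∀ u : Plane, MvPolynomial.eval (kx.1 *ᵥ u) p = MvPolynomial.eval u p := by
  rw [mem_invariants_dih, gen_two]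

theorem mem_forms_zpowers {γ : O2} {η : Subgroup.zpowers γ →* ℤˣ} {e : ℝ}
    (he : ((η ⟨γ, Subgroup.mem_zpowers γ⟩ : ℤ) : ℝ) = e) {a b c : Poly} :
    quad a b c ∈ equivariantForms (Subgroup.zpowers γ) η ↔ IsCovariant (quad a b c) γ e := by
  rw [mem_equivariantForms_closure (Subgroup.zpowers_eq_closure γ)]
  subst he
  constructor
  · rintro ⟨-, h⟩
    exact h _ _ rfl
  · intro h
    refine ⟨isSymm_quad _ _ _, ?_⟩
    rintro γ hγ rfl
    exact h

theorem negI_mem_dih_two : negI ∈ dih 2 kx := by rw [← gen_two]; exact gen_mem_dih 2 kx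

theorem mem_forms_dih_two {η : dih 2 kx →* ℤˣ} {e e' : ℝ}
    (he : ((η ⟨negI, negI_mem_dih_two⟩ : ℤ) : ℝ) = e)
    (he' : ((η ⟨kx, refl_mem_dih 2 kx⟩ : ℤ) : ℝ) = e') {a b c : Poly} :
    quad a b c ∈ equivariantForms (dih 2 kx) η ↔
      IsCovariant (quad a b c) negI e ∧ IsCovariant (quad a b c) kx e' := by
  have hcl : dih 2 kx = Subgroup.closure {negI, kx} := by rw [dih, gen_two]
  rw [mem_equivariantForms_closure hcl]
  subst he he'
  constructor
  · rintro ⟨-, h⟩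
    exact ⟨h _ _ (by simp), h _ _ (by simp)⟩
  · rintro ⟨h, h'⟩
    refine ⟨isSymm_quad _ _ _, ?_⟩
    rintro γ hγ (rfl | rfl)
    · exact h
    · exact h'

theorem exists_eq_y_mul_of_odd {t : Poly}
    (h : ∀ u : Plane, MvPolynomial.eval (kx.1 *ᵥ u) t = -MvPolynomial.eval u t) :
    ∃ p : invariants (Subgroup.zpowers kx), t = y * p := by
  rw [← dih_one, ← imZ_one, ← anti_iff one_ne_zero]
  refine ⟨fun u => ?_, h⟩
  rw [Nat.cast_one, div_one, rot_two_pi, Submonoid.coe_one, Matrix.one_mulVec]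

theorem exists_eq_x_mul_add_y_mul_of_odd {t : Poly}
    (h : ∀ u : Plane, MvPolynomial.eval (negI.1 *ᵥ u) t = -MvPolynomial.eval u t) :
    ∃ p q : invariants (Subgroup.zpowers negI), t = x * p + y * q := by
  have := (half_cyc_iff (t := t) one_ne_zero).1 (by rw [gen_two_mul_one]; exact h)
  rwa [reZ_one, imZ_one, mul_one, cyc_two] at this

theorem exists_eq_x_mul {t : Poly}
    (h : ∀ u : Plane, MvPolynomial.eval (negI.1 *ᵥ u) t = -MvPolynomial.eval u t)
    (h' : ∀ u : Plane, MvPolynomial.eval (kx.1 *ᵥ u) t = MvPolynomial.eval u t) :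
    ∃ p : invariants (dih 2 kx), t = x * p := by
  have := (half_iff (t := t) one_ne_zero).1 ⟨by rw [gen_two_mul_one]; exact h, h'⟩
  rwa [reZ_one, mul_one] at this

theorem exists_eq_y_mul {t : Poly}
    (h : ∀ u : Plane, MvPolynomial.eval (negI.1 *ᵥ u) t = -MvPolynomial.eval u t)
    (h' : ∀ u : Plane, MvPolynomial.eval (kx.1 *ᵥ u) t = -MvPolynomial.eval u t) :
    ∃ p : invariants (dih 2 kx), t = y * p := by
  have := (half_anti_iff (t := t) one_ne_zero).1 ⟨by rw [gen_two_mul_one]; exact h, h'⟩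
  rwa [imZ_one, mul_one] at this

theorem exists_eq_x_mul_y_mul {t : Poly}
    (h : ∀ u : Plane, MvPolynomial.eval (negI.1 *ᵥ u) t = MvPolynomial.eval u t)
    (h' : ∀ u : Plane, MvPolynomial.eval (kx.1 *ᵥ u) t = -MvPolynomial.eval u t) :
    ∃ p : invariants (dih 2 kx), t = x * y * p := by
  obtain ⟨p, hp⟩ := (anti_iff (t := t) two_ne_zero).1 ⟨by rw [gen_two]; exact h, h'⟩
  exact ⟨p + p, by rw [hp, imZ_two]; push_cast; ring⟩

theorem mem_bot_iff_zpowers_kx (γ : O2) :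
    γ ∈ (⊥ : Subgroup O2) ↔ γ ∈ Subgroup.zpowers kx ∧ γ ∈ SO2 := by
  rw [← dih_one, ← cyc_one]; exact mem_cyc_iff_mem_dih γ

theorem isRow_z2 : IsRow (Subgroup.zpowers kx) (Subgroup.zpowers kx) ⊥
      {B | ∃ p₁ p₂ p₃ : invariants (Subgroup.zpowers kx), B = quad p₁ (y * p₂) p₃} := by
  refine .of_full mem_bot_iff_zpowers_kx ?_ fun η hη => ?_
  · refine exists_det_neg_of ⟨1, 0, -1, rfl⟩ ?_
    simp
  have hm := Subgroup.mem_zpowers kx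
  have he := eta_of_mem hη hm hm
  apply forms_eq_quad
  · intro a b c h
    rw [mem_forms_zpowers he, isCovariant_kx_iff] at h
    simp only [one_mul] at h
    obtain ⟨p, rfl⟩ := exists_eq_y_mul_of_odd h.2.1
    exact ⟨⟨a, mem_invariants_zpowers.2 h.1⟩, p, ⟨c, mem_invariants_zpowers.2 h.2.2⟩, rfl⟩
  · rintro M ⟨p₁, p₂, p₃, rfl⟩
    rw [mem_forms_zpowers he, isCovariant_kx_iff]
    refine ⟨fun u => ?_, fun u => ?_, fun u => ?_⟩ <;>
      simp only [map_mul, eval_of_mem _ hm, eval_y_kx, one_mul, neg_mul]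

theorem isRow_z2_one : IsRow (Subgroup.zpowers kx) ⊥ (Subgroup.zpowers kx)
      {B | ∃ p₁ p₂ p₃ : invariants (Subgroup.zpowers kx), B = quad (y * p₁) p₂ (y * p₃)} := by
  refine .of_rotations mem_bot_iff_zpowers_kx ?_ fun η hη => ?_
  · refine exists_det_neg_of ⟨0, 1, 0, rfl⟩ ?_
    simp
  have hm := Subgroup.mem_zpowers kx
  have he := eta_of_not_mem hη hm (fun h => kx_not_mem_SO2 ((mem_bot_iff_zpowers_kx _).1 h).2)
  apply forms_eq_quad
  · intro a b c h
    rw [mem_forms_zpowers he, isCovariant_kx_iff] at h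
    simp only [neg_one_mul, neg_neg] at h
    obtain ⟨p, rfl⟩ := exists_eq_y_mul_of_odd h.1
    obtain ⟨q, rfl⟩ := exists_eq_y_mul_of_odd h.2.2
    exact ⟨p, ⟨b, mem_invariants_zpowers.2 h.2.1⟩, q, rfl⟩
  · rintro M ⟨p₁, p₂, p₃, rfl⟩
    rw [mem_forms_zpowers he, isCovariant_kx_iff]
    refine ⟨fun u => ?_, fun u => ?_, fun u => ?_⟩ <;>
      simp only [map_mul, eval_of_mem _ hm, eval_y_kx, neg_mul, one_mul, neg_neg]

theorem isRow_klein : IsRow klein klein (Subgroup.zpowers negI)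
      {B | ∃ p₁ p₂ p₃ : invariants klein, B = quad p₁ (x * y * p₂) p₃} := by
  rw [← dih_two, ← cyc_two]
  refine .of_full mem_cyc_iff_mem_dih ?_ fun η hη => ?_
  · refine exists_det_neg_of ⟨1, 0, -1, rfl⟩ ?_
    simp
  have hm := negI_mem_dih_two
  have hm' := refl_mem_dih 2 kx
  have he := eta_of_mem hη hm hm
  have he' := eta_of_mem hη hm' hm'
  apply forms_eq_quad
  · intro a b c h
    rw [mem_forms_dih_two he he', isCovariant_kx_iff, isCovariant_negI_iff] at h
    simp only [one_mul] at h
    obtain ⟨p, rfl⟩ := exists_eq_x_mul_y_mul h.1.2.1 h.2.2.1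
    exact ⟨⟨a, mem_invariants_dih_two.2 ⟨h.1.1, h.2.1⟩⟩, p,
      ⟨c, mem_invariants_dih_two.2 ⟨h.1.2.2, h.2.2.2⟩⟩, rfl⟩
  · rintro M ⟨p₁, p₂, p₃, rfl⟩
    rw [mem_forms_dih_two he he', isCovariant_kx_iff, isCovariant_negI_iff]
    refine ⟨⟨fun u => ?_, fun u => ?_, fun u => ?_⟩, fun u => ?_, fun u => ?_, fun u => ?_⟩ <;>
      simp only [map_mul, eval_of_mem _ hm, eval_of_mem _ hm', eval_x_kx, eval_y_kx, eval_x_negI,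
        eval_y_negI] <;> ring

theorem isRow_klein_negI : IsRow klein (Subgroup.zpowers negI) klein
      {B | ∃ p₁ p₂ p₃ : invariants klein, B = quad (x * y * p₁) p₂ (x * y * p₃)} := by
  rw [← dih_two, ← cyc_two]
  refine .of_rotations mem_cyc_iff_mem_dih ?_ fun η hη => ?_
  · refine exists_det_neg_of ⟨0, 1, 0, rfl⟩ ?_
    simp
  have hm := negI_mem_dih_two
  have hm' := refl_mem_dih 2 kx
  have he := eta_of_mem hη hm (by rw [← gen_two]; exact gen_mem_cyc 2)
  have he' := eta_of_not_mem hη hm' (fun h => kx_not_mem_SO2 (cyc_le_SO2 _ h))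
  apply forms_eq_quad
  · intro a b c h
    rw [mem_forms_dih_two he he', isCovariant_kx_iff, isCovariant_negI_iff] at h
    simp only [one_mul, neg_one_mul, neg_neg] at h
    obtain ⟨p, rfl⟩ := exists_eq_x_mul_y_mul h.1.1 h.2.1
    obtain ⟨q, rfl⟩ := exists_eq_x_mul_y_mul h.1.2.2 h.2.2.2
    exact ⟨p, ⟨b, mem_invariants_dih_two.2 ⟨h.1.2.1, h.2.2.1⟩⟩, q, rfl⟩
  · rintro M ⟨p₁, p₂, p₃, rfl⟩
    rw [mem_forms_dih_two he he', isCovariant_kx_iff, isCovariant_negI_iff]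
    refine ⟨⟨fun u => ?_, fun u => ?_, fun u => ?_⟩, fun u => ?_, fun u => ?_, fun u => ?_⟩ <;>
      simp only [map_mul, eval_of_mem _ hm, eval_of_mem _ hm', eval_x_kx, eval_y_kx, eval_x_negI,
        eval_y_negI] <;> ring

theorem isRow_klein_kx : IsRow klein (Subgroup.zpowers kx) (Subgroup.zpowers ky)
      {B | ∃ p₁ p₂ p₃ : invariants klein, B = quad (x * p₁) (y * p₂) (x * p₃)} := by
  have hky : ky = rot (Real.pi / (1 : ℕ)) * kx := by rw [Nat.cast_one, div_one, ky_eq]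
  rw [← dih_two, ← dih_one kx, ← dih_one ky]
  refine ⟨dih_half_le one_ne_zero (refl_mem_dih _ _),
    fun a ha b hb => mul_mem_dih_half one_ne_zero ha hb, ?_, ?_, ?_, fun η hη => ?_⟩
  · rw [hky]; exact dih_half_le one_ne_zero (refl_half_mem_dih 1)
  · rw [hky]; exact fun γ hγ => mem_dih_half_iff one_ne_zero hγ
  · refine exists_det_neg_of ⟨1, 0, -1, rfl⟩ ?_
    simp [eval_x_basePt]
  have hm := negI_mem_dih_two
  have hm' := refl_mem_dih 2 kx
  have he := eta_of_not_mem hη hm (by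
    rw [← gen_two_mul_one]; exact gen_not_mem_dih_half one_ne_zero)
  have he' := eta_of_mem hη hm' (refl_mem_dih 1 kx)
  apply forms_eq_quad
  · intro a b c h
    rw [mem_forms_dih_two he he', isCovariant_kx_iff, isCovariant_negI_iff] at h
    simp only [one_mul, neg_one_mul] at h
    obtain ⟨p₁, rfl⟩ := exists_eq_x_mul h.1.1 h.2.1
    obtain ⟨p₂, rfl⟩ := exists_eq_y_mul h.1.2.1 h.2.2.1
    obtain ⟨p₃, rfl⟩ := exists_eq_x_mul h.1.2.2 h.2.2.2
    exact ⟨p₁, p₂, p₃, rfl⟩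
  · rintro M ⟨p₁, p₂, p₃, rfl⟩
    rw [mem_forms_dih_two he he', isCovariant_kx_iff, isCovariant_negI_iff]
    refine ⟨⟨fun u => ?_, fun u => ?_, fun u => ?_⟩, fun u => ?_, fun u => ?_, fun u => ?_⟩ <;>
      simp only [map_mul, eval_of_mem _ hm, eval_of_mem _ hm', eval_x_kx, eval_y_kx, eval_x_negI,
        eval_y_negI] <;> ring

theorem isRow_one : IsRow ⊥ ⊥ ⊥ {B | ∃ p₁ p₂ p₃ : invariants ⊥, B = quad p₁ p₂ p₃} := by
  refine .of_full (fun γ => ⟨fun h => ⟨h, bot_le (a := SO2) h⟩, fun h => h.1⟩) ?_ fun η hη => ?_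
  · refine exists_det_neg_of ⟨0, 1, 0, rfl⟩ ?_
    simp
  have hinv : ∀ p : Poly, p ∈ invariants ⊥ := fun p => by
    rw [mem_invariants_iff]; exact bot_le
  apply forms_eq_quad
  · exact fun a b c _ => ⟨⟨a, hinv a⟩, ⟨b, hinv b⟩, ⟨c, hinv c⟩, rfl⟩
  · rintro M ⟨p₁, p₂, p₃, rfl⟩
    refine mem_equivariantForms.2 ⟨isSymm_quad _ _ _, fun ⟨γ, hγ⟩ => ?_⟩
    rw [eta_of_mem hη hγ hγ]
    obtain rfl := Subgroup.mem_bot.1 hγ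
    exact IsCovariant.one _

theorem negI_mem_SO2 : negI ∈ SO2 := by rw [negI_eq]; exact rot_mem_SO2 _

theorem isRow_negI :
    IsRow (Subgroup.zpowers negI) (Subgroup.zpowers negI) (Subgroup.zpowers negI)
      {B | ∃ p₁ p₂ p₃ : invariants (Subgroup.zpowers negI), B = quad p₁ p₂ p₃} := by
  refine .of_full (fun γ => ⟨fun h => ⟨h, Subgroup.zpowers_le.2 negI_mem_SO2 h⟩, fun h => h.1⟩)
    ?_ fun η hη => ?_
  · refine exists_det_neg_of ⟨0, 1, 0, rfl⟩ ?_
    simp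
  have hm := Subgroup.mem_zpowers negI
  have he := eta_of_mem hη hm hm
  apply forms_eq_quad
  · intro a b c h
    rw [mem_forms_zpowers he, isCovariant_negI_iff] at h
    simp only [one_mul] at h
    exact ⟨⟨a, mem_invariants_zpowers.2 h.1⟩, ⟨b, mem_invariants_zpowers.2 h.2.1⟩,
      ⟨c, mem_invariants_zpowers.2 h.2.2⟩, rfl⟩
  · rintro M ⟨p₁, p₂, p₃, rfl⟩
    rw [mem_forms_zpowers he, isCovariant_negI_iff]
    refine ⟨fun u => ?_, fun u => ?_, fun u => ?_⟩ <;> simp only [eval_of_mem _ hm, one_mul]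

theorem isRow_negI_one : IsRow (Subgroup.zpowers negI) ⊥ ⊥
      {B | ∃ p₁ p₂ p₃ p₄ p₅ p₆ : invariants (Subgroup.zpowers negI), B = quad
        (x * p₁ + y * p₂) (x * p₃ + y * p₄) (x * p₅ + y * p₆)} := by
  have hne : negI ∉ (⊥ : Subgroup O2) := by
    rw [← cyc_one, ← gen_two_mul_one]; exact gen_not_mem_half one_ne_zero
  refine ⟨bot_le, ?_, bot_le, ?_, ?_, fun η hη => ?_⟩
  · rw [← cyc_two, ← cyc_one]
    exact fun a ha b hb => mul_mem_cyc_half one_ne_zero ha hb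
  · exact fun γ hγ => by simp [Subgroup.zpowers_le.2 negI_mem_SO2 hγ]
  · refine exists_det_neg_of ⟨0, 0, 1, 0, 0, 0, rfl⟩ ?_
    simp [eval_x_basePt]
  have hm := Subgroup.mem_zpowers negI
  have he := eta_of_not_mem hη hm hne
  apply forms_eq_quad
  · intro a b c h
    rw [mem_forms_zpowers he, isCovariant_negI_iff] at h
    simp only [neg_one_mul] at h
    obtain ⟨p₁, p₂, rfl⟩ := exists_eq_x_mul_add_y_mul_of_odd h.1
    obtain ⟨p₃, p₄, rfl⟩ := exists_eq_x_mul_add_y_mul_of_odd h.2.1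
    obtain ⟨p₅, p₆, rfl⟩ := exists_eq_x_mul_add_y_mul_of_odd h.2.2
    exact ⟨p₁, p₂, p₃, p₄, p₅, p₆, rfl⟩
  · rintro M ⟨p₁, p₂, p₃, p₄, p₅, p₆, rfl⟩
    rw [mem_forms_zpowers he, isCovariant_negI_iff]
    refine ⟨fun u => ?_, fun u => ?_, fun u => ?_⟩ <;>
      simp only [map_add, map_mul, eval_of_mem _ hm, eval_x_negI, eval_y_negI] <;> ring

theorem Table.isRow {Γ K L : Subgroup O2} {S : Set PolyForm} (h : Table Γ K L S) :
    IsRow Γ K L S := by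
  cases h with
  | row_so2 => exact isRow_so2
  | row_o2 => exact isRow_o2
  | row_o2_so2 => exact isRow_o2_so2
  | row_cyc n hn => exact isRow_cyc n hn
  | row_cyc_cyc m hm => exact isRow_cyc_cyc m hm
  | row_dih n hn => exact isRow_dih n hn
  | row_dih_cyc n hn => exact isRow_dih_cyc n hn
  | row_dih_dih m hm => exact isRow_dih_dih m hm
  | row_z2 => exact isRow_z2
  | row_z2_one => exact isRow_z2_one
  | row_klein => exact isRow_klein
  | row_klein_negI => exact isRow_klein_negI
  | row_klein_kx => exact isRow_klein_kx
  | row_one => exact isRow_one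
  | row_negI => exact isRow_negI
  | row_negI_one => exact isRow_negI_one

/-! ### Realization and transport of a row -/

/-- Membership in `K` is a character, because `K` has index at most two. -/
theorem IsRow.exists_eta {Γ K L : Subgroup O2} {S : Set PolyForm} (h : IsRow Γ K L S) :
    ∃ η : Γ →* ℤˣ, kerEta Γ η = K := by
  classical
  let η : Γ →* ℤˣ :=
    { toFun := fun γ => if γ.1 ∈ K then 1 else -1
      map_one' := by simp [one_mem]
      map_mul' := fun a b => by
        have := h.mul_mem_K a.1 a.2 b.1 b.2
        by_cases ha : a.1 ∈ K <;> by_cases hb : b.1 ∈ K <;> simp_all }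
  refine ⟨η, Subgroup.ext fun γ => ⟨?_, fun hγ => ?_⟩⟩
  · rintro ⟨γ', h', rfl⟩
    have h1 : (if γ'.1 ∈ K then (1 : ℤˣ) else -1) = 1 := h'
    by_contra hn
    have hn' : γ'.1 ∉ K := hn
    rw [if_neg hn'] at h1
    exact absurd h1 (by decide)
  · exact (mem_kerEta (η := η) ⟨γ, h.K_le hγ⟩).2 (if_pos hγ)

theorem mem_conj {g γ : O2} {H : Subgroup O2} : γ ∈ conj g H ↔ g⁻¹ * γ * g ∈ H := by
  constructor
  · rintro ⟨δ, hδ, rfl⟩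
    simpa [mul_assoc] using hδ
  · exact fun h => ⟨_, h, by simp [mul_assoc]⟩

theorem conj_mem_conj {g γ : O2} {H : Subgroup O2} (h : γ ∈ H) : g * γ * g⁻¹ ∈ conj g H :=
  ⟨γ, h, rfl⟩

theorem conj_mono {g : O2} {H H' : Subgroup O2} (h : H ≤ H') : conj g H ≤ conj g H' :=
  Subgroup.map_mono h

theorem conj_one_eq (H : Subgroup O2) : conj 1 H = H :=
  Subgroup.ext fun γ => by rw [mem_conj]; simp

theorem det_conj (g γ : O2) : (g⁻¹ * γ * g).1.det = γ.1.det := by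
  rw [det_mul, det_mul, inv_val, Matrix.det_transpose]
  rcases det_sq g with h | h <;> rw [h] <;> ring

/-- `M(g u) = g N(u) gᵗ`: the form `M` is the transport of `N` by `g`. -/
def IsTransport (g : O2) (M N : PolyForm) : Prop :=
  ∀ u : Plane, PolyForm.evalAt M (g.1 *ᵥ u) = g.1 * PolyForm.evalAt N u * g.1ᵀ

theorem IsTransport.symm {g : O2} {M N : PolyForm} (h : IsTransport g M N) :
    IsTransport g⁻¹ N M := fun u => by
  have h1 := h (g.1ᵀ *ᵥ u)
  rw [Matrix.mulVec_mulVec, self_mul_transpose, Matrix.one_mulVec] at h1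
  rw [inv_val, h1, Matrix.transpose_transpose, ← mul_assoc, ← mul_assoc, transpose_mul_self,
    one_mul, mul_assoc, transpose_mul_self, mul_one]

/-- The form `u ↦ gᵗ M(g u) g`. -/
noncomputable def pullForm (g : O2) (M : PolyForm) : PolyForm :=
  g.1ᵀ.map MvPolynomial.C * M.map (substPoly g.1) * g.1.map MvPolynomial.C

/-- Every form is a transport by `g`. -/
theorem isTransport_pullForm (g : O2) (M : PolyForm) : IsTransport g M (pullForm g M) := fun u => by
  have h1 : PolyForm.evalAt (pullForm g M) u =
      g.1ᵀ * PolyForm.evalAt M (g.1 *ᵥ u) * g.1 := by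
    rw [PolyForm.evalAt, pullForm, Matrix.map_mul, Matrix.map_mul]
    congr 2
    · ext i j; simp
    · ext i j; simp [PolyForm.evalAt, eval_substPoly]
    · ext i j; simp
  rw [h1, ← mul_assoc, ← mul_assoc, self_mul_transpose, one_mul, mul_assoc, self_mul_transpose,
    mul_one]

theorem isSymm_iff_evalAt {M : PolyForm} :
    M.IsSymm ↔ ∀ u, (PolyForm.evalAt M u).IsSymm := by
  constructor
  · intro h u
    rw [Matrix.IsSymm, PolyForm.evalAt, ← Matrix.transpose_map, h.eq]
  · intro h
    refine Matrix.IsSymm.ext fun i j => MvPolynomial.funext fun u => ?_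
    exact (h u).apply i j

theorem IsTransport.isSymm {g : O2} {M N : PolyForm} (h : IsTransport g M N) (hN : N.IsSymm) :
    M.IsSymm := by
  rw [isSymm_iff_evalAt] at hN ⊢
  intro u
  have h1 := h (g.1ᵀ *ᵥ u)
  rw [Matrix.mulVec_mulVec, self_mul_transpose, Matrix.one_mulVec] at h1
  rw [h1, Matrix.IsSymm, Matrix.transpose_mul, Matrix.transpose_mul, Matrix.transpose_transpose,
    (hN _).eq, mul_assoc]

theorem IsTransport.isCovariant {g γ : O2} {M N : PolyForm} {e : ℝ} (h : IsTransport g M N)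
    (hN : IsCovariant N γ e) : IsCovariant M (g * γ * g⁻¹) e := fun u => by
  have h1 := h.symm u
  have h2 := h (γ.1 *ᵥ ((g⁻¹).1 *ᵥ u))
  have h3 : (g * γ * g⁻¹).1 = g.1 * γ.1 * (g⁻¹).1 := rfl
  rw [Matrix.mulVec_mulVec, Matrix.mulVec_mulVec, hN, ← h3, h1] at h2
  rw [h2, h3, Matrix.transpose_mul, Matrix.transpose_mul, Matrix.mul_smul, Matrix.smul_mul]
  simp only [mul_assoc]

/-- Transport of a row by conjugation. -/
theorem IsRow.transport {Γ Γ₀ K₀ L₀ : Subgroup O2} {S₀ : Set PolyForm} (h : IsRow Γ₀ K₀ L₀ S₀)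
    {g : O2} (hΓ : Γ = conj g Γ₀) {η : Γ →* ℤˣ} (hη : kerEta Γ η = conj g K₀) :
    IsKerLambda Γ η (conj g L₀) ∧
      ∀ M : PolyForm, M ∈ equivariantForms Γ η ↔ ∃ N ∈ S₀, IsTransport g M N := by
  have hmem : ∀ γ ∈ Γ₀, g * γ * g⁻¹ ∈ Γ := fun γ hγ => by rw [hΓ]; exact conj_mem_conj hγ
  let φ : Γ₀ →* Γ :=
    { toFun := fun γ => ⟨g * γ.1 * g⁻¹, hmem γ.1 γ.2⟩
      map_one' := Subtype.ext (by simp)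
      map_mul' := fun a b => Subtype.ext (by simp [mul_assoc]) }
  have hη₀ : kerEta Γ₀ (η.comp φ) = K₀ := by
    have key : ∀ γ : Γ₀, (η.comp φ) γ = 1 ↔ γ.1 ∈ K₀ := fun γ => by
      rw [MonoidHom.comp_apply, ← mem_kerEta, hη, mem_conj]
      simp [φ, mul_assoc]
    refine Subgroup.ext fun γ => ⟨?_, fun hγ => (mem_kerEta ⟨γ, h.K_le hγ⟩).2 ((key _).2 hγ)⟩
    rintro ⟨γ', h', rfl⟩
    exact (key γ').1 h'
  have hforms : ∀ M : PolyForm, M ∈ equivariantForms Γ η ↔ ∃ N ∈ S₀, IsTransport g M N := by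
    intro M
    rw [← h.forms _ hη₀]
    constructor
    · intro hM
      have hT := isTransport_pullForm g M
      refine ⟨_, mem_equivariantForms.2 ⟨hT.symm.isSymm hM.1, fun γ => ?_⟩, hT⟩
      have h1 := hT.symm.isCovariant ((mem_equivariantForms.1 hM).2 (φ γ))
      have h2 : g⁻¹ * (φ γ).1 * g⁻¹⁻¹ = γ.1 := by simp [φ, mul_assoc]
      rw [h2] at h1
      exact h1
    · rintro ⟨N, hN, hT⟩
      refine mem_equivariantForms.2 ⟨hT.isSymm hN.1, fun ⟨γ, hγ⟩ => ?_⟩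
      have hγ₀ : g⁻¹ * γ * g ∈ Γ₀ := by rw [← mem_conj, ← hΓ]; exact hγ
      have h1 := hT.isCovariant ((mem_equivariantForms.1 hN).2 ⟨_, hγ₀⟩)
      have h2 : g * (g⁻¹ * γ * g) * g⁻¹ = γ := by group
      have h3 : φ ⟨_, hγ₀⟩ = ⟨γ, hγ⟩ := Subtype.ext h2
      rw [MonoidHom.comp_apply, h3] at h1
      rw [h2] at h1
      exact h1
  refine ⟨?_, hforms⟩
  obtain ⟨N, hN, u, hu⟩ := h.exists_det_neg
  have hT : IsTransport g (pullForm g⁻¹ N) N := by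
    have := (isTransport_pullForm g⁻¹ N).symm
    rwa [inv_inv] at this
  refine isKerLambda_of_det (by rw [hΓ]; exact conj_mono h.L_le) ((hforms _).2 ⟨N, hN, hT⟩)
    (u₀ := g.1 *ᵥ u) ?_ ?_
  · rw [hT u, Matrix.det_mul, Matrix.det_mul, Matrix.det_transpose]
    rcases det_sq g with hd | hd <;> rw [hd] <;> linarith
  · rintro ⟨γ, hγ⟩
    have hγ₀ : g⁻¹ * γ * g ∈ Γ₀ := by rw [← mem_conj, ← hΓ]; exact hγ
    rw [mem_conj, h.mem_L _ hγ₀, mem_SO2, det_conj, ← mem_conj]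
    by_cases hK : γ ∈ conj g K₀
    · rw [eta_of_mem hη hγ hK]
      simp [hK, eq_comm]
    · rw [eta_of_not_mem hη hγ hK]
      rcases det_sq γ with hd | hd <;> simp [hK, hd]
      all_goals norm_num

/-! ### Classification of the closed subgroups and their characters -/

theorem continuous_rot : Continuous rot := by
  refine Continuous.subtype_mk ?_ _
  refine continuous_matrix fun i j => ?_
  fin_cases i <;> fin_cases j <;> simp <;> fun_prop

/-- The rotations in a closed subgroup of `O(2)` are all rotations or form a cyclic group. -/
theorem rotations_of_isClosed {Γ : Subgroup O2} (hΓ : IsClosed (Γ : Set O2)) :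
    SO2 ≤ Γ ∨ ∃ n : ℕ, n ≠ 0 ∧ cyc n ≤ Γ ∧ ∀ γ ∈ Γ, γ ∈ SO2 → γ ∈ cyc n := by
  let A : AddSubgroup ℝ :=
    { carrier := {θ | rot θ ∈ Γ}
      zero_mem' := by
        change rot 0 ∈ Γ
        rw [rot_zero]; exact one_mem Γ
      add_mem' := fun {a b} ha hb => by
        change rot (a + b) ∈ Γ
        rw [rot_add]; exact mul_mem ha hb
      neg_mem' := fun {a} ha => by
        change rot (-a) ∈ Γ
        rw [rot_neg]; exact inv_mem ha }
  have hA : ∀ θ, θ ∈ A ↔ rot θ ∈ Γ := fun _ => Iff.rfl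
  have hcl : IsClosed (A : Set ℝ) := hΓ.preimage continuous_rot
  rcases A.dense_or_cyclic with hd | ⟨a, ha⟩
  · left
    intro γ hγ
    obtain ⟨θ, rfl⟩ := exists_rot_of_mem_SO2 hγ
    have : (A : Set ℝ) = Set.univ := by rw [← hcl.closure_eq]; exact hd.closure_eq
    have h1 : θ ∈ (A : Set ℝ) := by rw [this]; trivial
    exact h1
  · right
    have hmem : ∀ θ, rot θ ∈ Γ ↔ ∃ k : ℤ, k * a = θ := by
      intro θ
      rw [← hA, ha, AddSubgroup.mem_closure_singleton]
      simp
    obtain ⟨k, hk⟩ := (hmem (2 * Real.pi)).1 (by rw [rot_two_pi]; exact one_mem Γ)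
    have hk0 : k ≠ 0 := by
      rintro rfl
      have := Real.pi_pos
      simp at hk
    have hk0' : (k : ℝ) ≠ 0 := by exact_mod_cast hk0
    have haΓ : rot a ∈ Γ := (hmem a).2 ⟨1, by simp⟩
    have hgen : rot (2 * Real.pi / (k.natAbs : ℕ)) = rot a ∨
        rot (2 * Real.pi / (k.natAbs : ℕ)) = (rot a)⁻¹ := by
      rcases Int.natAbs_eq k with h | h
      · left
        congr 1
        have h' : (k : ℝ) = (k.natAbs : ℕ) := by
          rw [← Int.cast_natCast, ← h]
        rw [← hk, ← h', mul_div_cancel_left₀ _ hk0']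
      · right
        rw [← rot_neg]
        congr 1
        have h' : ((k.natAbs : ℕ) : ℝ) = -k := by
          rw [← Int.cast_natCast, ← Int.cast_neg]; congr 1; omega
        rw [← hk, h', div_neg, mul_div_cancel_left₀ _ hk0']
    refine ⟨k.natAbs, Int.natAbs_ne_zero.2 hk0, ?_, ?_⟩
    · rw [cyc, Subgroup.zpowers_le]
      rcases hgen with h | h <;> rw [h]
      · exact haΓ
      · exact inv_mem haΓ
    · intro γ hγ hs
      obtain ⟨θ, rfl⟩ := exists_rot_of_mem_SO2 hs
      obtain ⟨l, rfl⟩ := (hmem θ).1 hγ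
      rw [rot_zsmul]
      apply zpow_mem
      have := gen_mem_cyc k.natAbs
      rcases hgen with h | h <;> rw [h] at this
      · exact this
      · simpa using inv_mem this

theorem exists_table_cyc {n : ℕ} (hn : n ≠ 0) : ∃ L S, Table (cyc n) (cyc n) L S := by
  obtain rfl | rfl | h : n = 1 ∨ n = 2 ∨ 3 ≤ n := by omega
  · rw [cyc_one]; exact ⟨_, _, .row_one⟩
  · rw [cyc_two]; exact ⟨_, _, .row_negI⟩
  · exact ⟨_, _, .row_cyc n h⟩

theorem exists_table_cyc_half {m : ℕ} (hm : m ≠ 0) : ∃ L S, Table (cyc (2 * m)) (cyc m) L S := by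
  obtain rfl | h : m = 1 ∨ 2 ≤ m := by omega
  · rw [mul_one, cyc_one, cyc_two]; exact ⟨_, _, .row_negI_one⟩
  · exact ⟨_, _, .row_cyc_cyc m h⟩

theorem exists_table_dih {n : ℕ} (hn : n ≠ 0) : ∃ L S, Table (dih n kx) (dih n kx) L S := by
  obtain rfl | rfl | h : n = 1 ∨ n = 2 ∨ 3 ≤ n := by omega
  · rw [dih_one]; exact ⟨_, _, .row_z2⟩
  · rw [dih_two]; exact ⟨_, _, .row_klein⟩
  · exact ⟨_, _, .row_dih n h⟩

theorem exists_table_dih_cyc {n : ℕ} (hn : n ≠ 0) : ∃ L S, Table (dih n kx) (cyc n) L S := by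
  obtain rfl | rfl | h : n = 1 ∨ n = 2 ∨ 3 ≤ n := by omega
  · rw [dih_one, cyc_one]; exact ⟨_, _, .row_z2_one⟩
  · rw [dih_two, cyc_two]; exact ⟨_, _, .row_klein_negI⟩
  · exact ⟨_, _, .row_dih_cyc n h⟩

theorem exists_table_dih_half {m : ℕ} (hm : m ≠ 0) :
    ∃ L S, Table (dih (2 * m) kx) (dih m kx) L S := by
  obtain rfl | h : m = 1 ∨ 2 ≤ m := by omega
  · rw [mul_one, dih_one, dih_two]; exact ⟨_, _, .row_klein_kx⟩
  · exact ⟨_, _, .row_dih_dih m h⟩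

theorem kerEta_eq {Γ K : Subgroup O2} {η : Γ →* ℤˣ} (hK : K ≤ Γ)
    (h : ∀ γ (hγ : γ ∈ Γ), η ⟨γ, hγ⟩ = 1 ↔ γ ∈ K) : kerEta Γ η = K := by
  refine Subgroup.ext fun γ => ⟨?_, fun hγ => ?_⟩
  · rintro ⟨⟨γ', hγ'⟩, h', rfl⟩
    exact (h γ' hγ').1 h'
  · exact (mem_kerEta ⟨γ, hK hγ⟩).2 ((h _ _).2 hγ)

/-- A character with values `±1` is trivial on `SO(2)`, where every element is a square. -/
theorem eta_rot {Γ : Subgroup O2} (h : SO2 ≤ Γ) (η : Γ →* ℤˣ) {γ : O2} (hγ : γ ∈ SO2) :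
    η ⟨γ, h hγ⟩ = 1 := by
  obtain ⟨θ, rfl⟩ := exists_rot_of_mem_SO2 hγ
  have h1 : (⟨rot θ, h hγ⟩ : Γ) = ⟨rot (θ / 2), h (rot_mem_SO2 _)⟩ *
      ⟨rot (θ / 2), h (rot_mem_SO2 _)⟩ :=
    Subtype.ext (by
      change rot θ = rot (θ / 2) * rot (θ / 2)
      rw [← rot_add, add_halves])
  rw [h1, map_mul, Int.units_mul_self]

theorem eta_zpow {Γ : Subgroup O2} (η : Γ →* ℤˣ) {γ : O2} (hγ : γ ∈ Γ) (k : ℤ) :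
    η ⟨γ ^ k, zpow_mem hγ k⟩ = η ⟨γ, hγ⟩ ^ k := map_zpow η ⟨γ, hγ⟩ k

theorem eta_mul {Γ : Subgroup O2} (η : Γ →* ℤˣ) {γ γ' : O2} (hγ : γ ∈ Γ) (hγ' : γ' ∈ Γ) :
    η ⟨γ * γ', mul_mem hγ hγ'⟩ = η ⟨γ, hγ⟩ * η ⟨γ', hγ'⟩ := map_mul η ⟨γ, hγ⟩ ⟨γ', hγ'⟩

theorem neg_one_zpow_units_eq_one_iff (k : ℤ) : (-1 : ℤˣ) ^ k = 1 ↔ Even k := by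
  rcases Int.even_or_odd' k with ⟨l, rfl | rfl⟩
  · simp [zpow_mul]
  · rw [zpow_add, zpow_mul]
    simp

/-- The restriction of `η` to the rotations of order `n` of `Γ`: either trivial, or `n = 2 m` and
its kernel is the group of rotations of order `m`. -/
theorem eta_cyc {Γ : Subgroup O2} (η : Γ →* ℤˣ) {n : ℕ} (hn : n ≠ 0) (h : cyc n ≤ Γ) :
    (∀ γ (hγ : γ ∈ cyc n), η ⟨γ, h hγ⟩ = 1) ∨
      (η ⟨_, h (gen_mem_cyc n)⟩ = -1 ∧ ∃ m, m ≠ 0 ∧ n = 2 * m ∧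
        ∀ γ (hγ : γ ∈ cyc n), η ⟨γ, h hγ⟩ = 1 ↔ γ ∈ cyc m) := by
  rcases Int.units_eq_one_or (η ⟨_, h (gen_mem_cyc n)⟩) with h1 | h1
  · left
    intro γ hγ
    obtain ⟨k, rfl⟩ := mem_cyc.1 hγ
    rw [eta_zpow η (h (gen_mem_cyc n)), h1, one_zpow]
  · right
    refine ⟨h1, ?_⟩
    have h2 : Even (n : ℤ) := by
      rw [← neg_one_zpow_units_eq_one_iff, ← h1, ← eta_zpow η (h (gen_mem_cyc n))]
      have : (⟨rot (2 * Real.pi / n) ^ (n : ℤ), zpow_mem (h (gen_mem_cyc n)) n⟩ : Γ) = 1 :=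
        Subtype.ext (by simpa using rot_pow_self hn)
      rw [this, map_one]
    obtain ⟨m, hm⟩ := h2
    obtain ⟨m, rfl⟩ : ∃ m : ℕ, n = 2 * m := ⟨m.toNat, by omega⟩
    have hm0 : m ≠ 0 := by omega
    refine ⟨m, hm0, rfl, fun γ hγ => ?_⟩
    obtain ⟨k, rfl⟩ := mem_cyc.1 hγ
    rw [eta_zpow η (h (gen_mem_cyc _)), h1, neg_one_zpow_units_eq_one_iff,
      gen_zpow_mem_cyc_half hm0]

theorem conj_closure_pair (g a b : O2) : conj g (Subgroup.closure {a, b}) =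
    Subgroup.closure {g * a * g⁻¹, g * b * g⁻¹} := by
  rw [conj, MonoidHom.map_closure, Set.image_pair]; rfl

theorem rot_conj_rot (α β : ℝ) : rot α * rot β * (rot α)⁻¹ = rot β := by
  rw [← rot_add, add_comm, rot_add, mul_inv_cancel_right]

theorem conj_rot_cyc (α : ℝ) (n : ℕ) : conj (rot α) (cyc n) = cyc n := by
  rw [conj, cyc, MonoidHom.map_zpowers]
  congr 1
  exact rot_conj_rot α _

theorem conj_rot_dih (α : ℝ) (n : ℕ) :
    conj (rot α) (dih n kx) = dih n (rot (α + α) * kx) := by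
  rw [dih, conj_closure_pair, rot_conj_rot, ← rot_neg, mul_assoc, kx_mul_rot, neg_neg,
    ← mul_assoc, ← rot_add, dih]

theorem eq_dih {Γ : Subgroup O2} {n : ℕ} {κ : O2} (hκ : κ ∉ SO2) (hκΓ : κ ∈ Γ) (h : cyc n ≤ Γ)
    (h' : ∀ γ ∈ Γ, γ ∈ SO2 → γ ∈ cyc n) : Γ = dih n κ := by
  apply le_antisymm
  · intro γ hγ
    rw [mem_dih hκ]
    by_cases hs : γ ∈ SO2
    · exact Or.inl (h' γ hγ hs)
    · exact Or.inr (h' _ (mul_mem hγ hκΓ) ((mul_mem_SO2_iff _ _).2 (by simp [hs, hκ])))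
  · rw [dih, Subgroup.closure_le]
    rintro _ (rfl | rfl)
    · exact h (gen_mem_cyc n)
    · exact hκΓ

/-- The kernel of `η` on a dihedral group that is nontrivial on the rotations, for a reflection
`κ` in the kernel. -/
theorem kerEta_dih_half {m : ℕ} (hm : m ≠ 0) {κ : O2} (hκ : κ ∉ SO2)
    {η : dih (2 * m) κ →* ℤˣ} (hηκ : η ⟨κ, refl_mem_dih _ _⟩ = 1)
    (h : ∀ γ (hγ : γ ∈ cyc (2 * m)), η ⟨γ, cyc_le_dih _ κ hγ⟩ = 1 ↔ γ ∈ cyc m) :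
    kerEta (dih (2 * m) κ) η = dih m κ := by
  apply kerEta_eq
  · rw [dih, Subgroup.closure_le]
    rintro _ (rfl | rfl)
    · exact cyc_le_dih _ _ (cyc_half_le hm (gen_mem_cyc m))
    · exact refl_mem_dih _ _
  · intro γ hγ
    by_cases hs : γ ∈ SO2
    · rw [mem_dih_iff_of_mem_SO2 hκ hs, ← h γ ((mem_dih_iff_of_mem_SO2 hκ hs).1 hγ)]
    · have h1 := (mem_dih_iff_of_not_mem_SO2 hκ hs).1 hγ
      rw [mem_dih_iff_of_not_mem_SO2 hκ hs, ← h _ h1, eta_mul η hγ (refl_mem_dih _ _), hηκ, mul_one]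

/-- Every closed subgroup with a character is conjugate to the pair of groups of a row. -/
theorem classification {Γ : Subgroup O2} (hΓ : IsClosed (Γ : Set O2)) (η : Γ →* ℤˣ) :
    ∃ (g : O2) (Γ₀ K₀ L₀ : Subgroup O2) (S₀ : Set PolyForm), Table Γ₀ K₀ L₀ S₀ ∧
      Γ = conj g Γ₀ ∧ kerEta Γ η = conj g K₀ := by
  by_cases hrot : Γ ≤ SO2
  · rcases rotations_of_isClosed hΓ with h | ⟨n, hn, h, h'⟩
    · obtain rfl := le_antisymm hrot h
      refine ⟨1, _, _, _, _, .row_so2, (conj_one_eq _).symm, ?_⟩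
      rw [conj_one_eq]
      exact kerEta_eq le_rfl fun γ hγ => by simp [hγ, eta_rot le_rfl η hγ]
    · obtain rfl : Γ = cyc n := le_antisymm (fun γ hγ => h' γ hγ (hrot hγ)) h
      rcases eta_cyc η hn le_rfl with h1 | ⟨-, m, hm, rfl, h1⟩
      · obtain ⟨L, S, hT⟩ := exists_table_cyc hn
        refine ⟨1, _, _, _, _, hT, (conj_one_eq _).symm, ?_⟩
        rw [conj_one_eq]
        exact kerEta_eq le_rfl fun γ hγ => by simp [hγ, h1 γ hγ]
      · obtain ⟨L, S, hT⟩ := exists_table_cyc_half hm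
        refine ⟨1, _, _, _, _, hT, (conj_one_eq _).symm, ?_⟩
        rw [conj_one_eq]
        exact kerEta_eq (cyc_half_le hm) h1
  obtain ⟨κ₀, hκ₀Γ, hκ₀⟩ := Set.not_subset.1 hrot
  rcases rotations_of_isClosed hΓ with h | ⟨n, hn, h, h'⟩
  · have hkx : kx ∈ Γ := by
      obtain ⟨θ, rfl⟩ := exists_rot_mul_kx hκ₀
      have := mul_mem (inv_mem (h (rot_mem_SO2 θ))) hκ₀Γ
      rwa [inv_mul_cancel_left] at this
    obtain rfl : Γ = ⊤ := by
      rw [top_eq_closure]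
      refine le_antisymm (by rw [← top_eq_closure]; exact le_top) ?_
      rw [Subgroup.closure_le]
      rintro _ (⟨θ, rfl⟩ | rfl)
      · exact h (rot_mem_SO2 θ)
      · exact hkx
    have hrefl : ∀ γ ∉ SO2, η ⟨γ, trivial⟩ = η ⟨kx, trivial⟩ := by
      intro γ hγ
      obtain ⟨θ, rfl⟩ := exists_rot_mul_kx hγ
      have := eta_mul η (γ := rot θ) (γ' := kx) trivial trivial
      rw [this, eta_rot le_top η (rot_mem_SO2 θ), one_mul]
    rcases Int.units_eq_one_or (η ⟨kx, trivial⟩) with h1 | h1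
    · refine ⟨1, _, _, _, _, .row_o2, (conj_one_eq _).symm, ?_⟩
      rw [conj_one_eq]
      refine kerEta_eq le_rfl fun γ hγ => ?_
      simp only [Subgroup.mem_top, iff_true]
      by_cases hs : γ ∈ SO2
      · exact eta_rot le_top η hs
      · rw [hrefl γ hs, h1]
    · refine ⟨1, _, _, _, _, .row_o2_so2, (conj_one_eq _).symm, ?_⟩
      rw [conj_one_eq]
      refine kerEta_eq le_top fun γ hγ => ?_
      by_cases hs : γ ∈ SO2
      · simp [hs, eta_rot le_top η hs]
      · rw [hrefl γ hs, h1]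
        simp [hs]
  · -- conjugation by `rot (φ / 2)` carries `κ_x` to the reflection `rot φ * κ_x`
    have of_refl : ∀ κ ∉ SO2, κ ∈ Γ →
        (η ⟨_, h (gen_mem_cyc n)⟩ = -1 → ∀ hκ : κ ∈ Γ, η ⟨κ, hκ⟩ = 1) →
        ∃ (g : O2) (Γ₀ K₀ L₀ : Subgroup O2) (S₀ : Set PolyForm), Table Γ₀ K₀ L₀ S₀ ∧
          Γ = conj g Γ₀ ∧ kerEta Γ η = conj g K₀ := by
      intro κ hκ hκΓ hηκ
      obtain rfl := eq_dih hκ hκΓ h h'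
      obtain ⟨φ, hφ⟩ := exists_rot_mul_kx hκ
      have hdih : ∀ n, conj (rot (φ / 2)) (dih n kx) = dih n κ := fun n => by
        rw [conj_rot_dih, add_halves, hφ]
      rcases eta_cyc η hn h with h1 | ⟨h0, m, hm, rfl, h1⟩
      · rcases Int.units_eq_one_or (η ⟨κ, hκΓ⟩) with h2 | h2
        · obtain ⟨L, S, hT⟩ := exists_table_dih hn
          refine ⟨rot (φ / 2), _, _, _, _, hT, (hdih n).symm, ?_⟩
          rw [hdih]
          refine kerEta_eq le_rfl fun γ hγ => ?_
          simp only [hγ, iff_true]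
          by_cases hs : γ ∈ SO2
          · exact h1 γ (h' γ hγ hs)
          · have h3 := h1 _ ((mem_dih_iff_of_not_mem_SO2 hκ hs).1 hγ)
            rwa [eta_mul η hγ hκΓ, h2, mul_one] at h3
        · obtain ⟨L, S, hT⟩ := exists_table_dih_cyc hn
          refine ⟨rot (φ / 2), _, _, _, _, hT, (hdih n).symm, ?_⟩
          rw [conj_rot_cyc]
          refine kerEta_eq h fun γ hγ => ?_
          by_cases hs : γ ∈ SO2
          · simp [h1 γ (h' γ hγ hs), h' γ hγ hs]
          · have h3 := h1 _ ((mem_dih_iff_of_not_mem_SO2 hκ hs).1 hγ)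
            rw [eta_mul η hγ hκΓ, h2] at h3
            refine ⟨fun h4 => ?_, fun h4 => absurd (cyc_le_SO2 n h4) hs⟩
            rw [h4] at h3
            exact absurd h3 (by decide)
      · obtain ⟨L, S, hT⟩ := exists_table_dih_half hm
        refine ⟨rot (φ / 2), _, _, _, _, hT, (hdih _).symm, ?_⟩
        rw [hdih]
        exact kerEta_dih_half hm hκ (hηκ h0 hκΓ) h1
    -- if `η` is `-1` on the generating rotation `ρ`, it is `1` on one of `κ₀`, `ρ κ₀`
    rcases Int.units_eq_one_or (η ⟨κ₀, hκ₀Γ⟩) with h1 | h1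
    · exact of_refl κ₀ hκ₀ hκ₀Γ fun _ _ => h1
    · by_cases h2 : η ⟨_, h (gen_mem_cyc n)⟩ = -1
      · refine of_refl (rot (2 * Real.pi / n) * κ₀) ?_
          (mul_mem (h (gen_mem_cyc n)) hκ₀Γ) fun _ _ => ?_
        · rw [mul_mem_SO2_iff]
          simpa [rot_mem_SO2] using hκ₀
        · rw [eta_mul η (h (gen_mem_cyc n)) hκ₀Γ, h1, h2]; decide
      · exact of_refl κ₀ hκ₀ hκ₀Γ fun h3 => absurd h3 h2

end EquivariantBDE

theorem mainTheorem2 :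
    -- every row of the table is correct
    (∀ (Γ K L : Subgroup EquivariantBDE.O2) (S : Set EquivariantBDE.PolyForm),
      EquivariantBDE.Table Γ K L S →
        (∃ η : Γ →* ℤˣ, EquivariantBDE.kerEta Γ η = K) ∧
        ∀ η : Γ →* ℤˣ, EquivariantBDE.kerEta Γ η = K →
          (EquivariantBDE.equivariantForms Γ η : Set EquivariantBDE.PolyForm) = S ∧
          EquivariantBDE.IsKerLambda Γ η L) ∧
    -- every closed subgroup with every homomorphism is, up to conjugacy, in the table
    (∀ Γ : Subgroup EquivariantBDE.O2, IsClosed (Γ : Set EquivariantBDE.O2) →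
      ∀ η : Γ →* ℤˣ, ∃ (g : EquivariantBDE.O2) (Γ₀ K₀ L₀ : Subgroup EquivariantBDE.O2)
        (S₀ : Set EquivariantBDE.PolyForm), EquivariantBDE.Table Γ₀ K₀ L₀ S₀ ∧
          Γ = EquivariantBDE.conj g Γ₀ ∧
          EquivariantBDE.kerEta Γ η = EquivariantBDE.conj g K₀ ∧
          EquivariantBDE.IsKerLambda Γ η (EquivariantBDE.conj g L₀) ∧
          ∀ M : EquivariantBDE.PolyForm, M ∈ EquivariantBDE.equivariantForms Γ η ↔
            ∃ N ∈ S₀, ∀ u : EquivariantBDE.Plane,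
              EquivariantBDE.PolyForm.evalAt M (g.1.mulVec u) =
                g.1 * EquivariantBDE.PolyForm.evalAt N u * g.1.transpose) ∧
    -- the kernel of `λ` in the row `D_{2m}[D_m(κ_x)]` is `D_m(κ_y)` if `m` is odd
    (∀ m : ℕ, 2 ≤ m → Odd m →
      EquivariantBDE.dih m (EquivariantBDE.rot (Real.pi / m) * EquivariantBDE.kx) =
        EquivariantBDE.dih m EquivariantBDE.ky) := by
  refine ⟨fun Γ K L S hT => ⟨hT.isRow.exists_eta, fun η hη => ⟨hT.isRow.forms η hη, ?_⟩⟩,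
    fun Γ hΓ η => ?_, fun m hm hodd => EquivariantBDE.dih_rot_pi_eq m (by omega) hodd⟩
  · have h := hT.isRow.transport (g := 1) (EquivariantBDE.conj_one_eq Γ).symm
      (hη.trans (EquivariantBDE.conj_one_eq K).symm)
    rw [EquivariantBDE.conj_one_eq] at h
    exact h.1
  · obtain ⟨g, Γ₀, K₀, L₀, S₀, hT, hg, hK⟩ := EquivariantBDE.classification hΓ η
    exact ⟨g, Γ₀, K₀, L₀, S₀, hT, hg, hK, hT.isRow.transport hg hK⟩
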